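/- Let $(M,g)$ be a smooth $n$-dimensional Riemannian manifold with Levi-Civita connection $\nabla$ and curvature tensor $R(X,Y)Z=\nabla_X\nabla_YZ-\nabla_Y\nabla_XZ-\nabla_{[X,Y]}Z$, and suppose that $M$ is a space form of constant curvature $K\in\mathbb R$, i.e. $R(X,Y)Z=K(\langle Z,Y\rangle X-\langle Z,X\rangle Y)$. Let $p>0$, $I=[a,b]$ with $a<b$. For a curve $c\colon I\to M$ with parameter $s$ write $\tau(c)=\nabla_{c'}c'$ and $$E_{2,p}(c)=\frac1p\int_I|\tau(c)|^p\,ds .$$ Let $\gamma_t$, $t\in(-\epsilon,\epsilon)$, be a variation of $\gamma=\gamma_0$, smooth in $(t,s)$ (up to and across the end points of $I$), with variation field $\eta=\frac{\partial\gamma_t}{\partial t}\big|_{t=0}$. Assume that either all $\gamma_t$ have the same end points and the same velocities at the end points, or all $\gamma_t$ are closed curves (periodic in $s$ with period $b-a$). Assume that $\gamma$ is $p$-biharmonic, i.e. that $|\tau(\gamma)|^{p-2}\tau(\gamma)$ is twice differentiable along $\gamma$ in the interior of $I$ and $$\nabla_{\gamma'}\nabla_{\gamma'}\big(|\nabla_{\gamma'}\gamma'|^{p-2}\nabla_{\gamma'}\gamma'\big)-|\nabla_{\gamma'}\gamma'|^{p-2}R(\gamma',\nabla_{\gamma'}\gamma')\gamma'=0$$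 there; if $p<2$, assume moreover that $\tau(\gamma)$ vanishes nowhere on $I$. (Where $\tau(\gamma)=0$ and $p\ge2$, the products containing $|\tau(\gamma)|^{p-4}$ below are read as $0$, and $|\tau(\gamma)|^{0}=1$ if $p=2$.) Then $t\mapsto E_{2,p}(\gamma_t)$ is differentiable near $t=0$ and twice differentiable at $t=0$, all integrals below converge, and \begin{align*} \frac{d^2}{dt^2}\Big|_{t=0}E_{2,p}(\gamma_t) =&\,(p-2)\int_I|\nabla_{\gamma'}\gamma'|^{p-4}|\langle\nabla_{\gamma'}\nabla_{\gamma'}\eta,\nabla_{\gamma'}\gamma'\rangle|^2ds+\int_I|\nabla_{\gamma'}\gamma'|^{p-2}|\nabla_{\gamma'}\nabla_{\gamma'}\eta|^2ds\\ &+(p-2)K^2\int_I|\nabla_{\gamma'}\gamma'|^{p-4}\big|\langle\eta,\gamma'\rangle\langle\gamma',\nabla_{\gamma'}\gamma'\rangle-|\gamma'|^2\langle\nabla_{\gamma'}\gamma',\eta\rangle\big|^2ds\\ &+K^2\int_I|\nabla_{\gamma'}\gamma'|^{p-2}\big|\langle\eta,\gamma'\rangle\gamma'-|\gamma'|^2\eta\big|^2ds\\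 &+K\int_I\Big(|\eta|^2\langle\gamma',\nabla_{\gamma'}(|\nabla_{\gamma'}\gamma'|^{p-2}\nabla_{\gamma'}\gamma')\rangle-\langle\eta,\gamma'\rangle\langle\eta,\nabla_{\gamma'}(|\nabla_{\gamma'}\gamma'|^{p-2}\nabla_{\gamma'}\gamma')\rangle\Big)ds\\ &-2K\int_I|\nabla_{\gamma'}\gamma'|^{p-2}\big(\langle\gamma',\nabla_{\gamma'}\gamma'\rangle\langle\nabla_{\gamma'}\eta,\eta\rangle-\langle\nabla_{\gamma'}\eta,\gamma'\rangle\langle\nabla_{\gamma'}\gamma',\eta\rangle\big)ds\\ &+2(p-2)K\int_I\langle\nabla_{\gamma'}\nabla_{\gamma'}\eta,\nabla_{\gamma'}\gamma'\rangle|\nabla_{\gamma'}\gamma'|^{p-4}\big(|\gamma'|^2\langle\eta,\nabla_{\gamma'}\gamma'\rangle-\langle\eta,\gamma'\rangle\langle\gamma',\nabla_{\gamma'}\gamma'\rangle\big)ds\\ &-2K\int_I|\nabla_{\gamma'}\gamma'|^{p-2}\big(\langle\gamma',\nabla_{\gamma'}\nabla_{\gamma'}\eta\rangle\langle\gamma',\eta\rangle-|\gamma'|^2\langle\nabla_{\gamma'}\nabla_{\gamma'}\eta,\eta\rangle\big)ds\\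 &-K\int_I|\nabla_{\gamma'}\gamma'|^{p-2}\big(\langle\nabla_{\gamma'}\gamma',\nabla_{\gamma'}\eta\rangle\langle\gamma',\eta\rangle-\langle\nabla_{\gamma'}\eta,\gamma'\rangle\langle\nabla_{\gamma'}\gamma',\eta\rangle\big)ds . \end{align*} -/

import Mathlib

open Bundle Manifold Set Filter Topology MeasureTheory
open scoped ContDiff

noncomputable section

namespace PBiharmonic

variable {E : Type*} [NormedAddCommGroup E] [NormedSpace ℝ E]
  {H : Type*} [TopologicalSpace H] (I : ModelWithCorners ℝ E H)
  {M : Type*} [TopologicalSpace M] [ChartedSpace H M]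

/-! ### Coordinates on the tangent bundle -/

section Coordinates

variable [IsManifold I 1 M]

/-- The coordinates of a tangent vector at `y` in the chart centred at `x`. -/
def toCoord (x y : M) : TangentSpace I y →L[ℝ] E :=
  (trivializationAt E (TangentSpace I) x).continuousLinearMapAt ℝ y

/-- The tangent vector at `y` with given coordinates in the chart centred at `x`. -/
def ofCoord (x y : M) : E →L[ℝ] TangentSpace I y :=
  (trivializationAt E (TangentSpace I) x).symmL ℝ y

/-- The vector field that extends `v : TₓM` and has constant coordinates in the chart at `x`. -/
def frozen {x : M} (v : TangentSpace I x) : (y : M) → TangentSpace I y :=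
  fun y => ofCoord I x y (toCoord I x x v)

theorem ofCoord_toCoord (x : M) (v : TangentSpace I x) :
    ofCoord I x x (toCoord I x x v) = v :=
  (trivializationAt E (TangentSpace I) x).symmL_continuousLinearMapAt
    (FiberBundle.mem_baseSet_trivializationAt' x) v

theorem frozen_self {x : M} (v : TangentSpace I x) : frozen I v x = v := ofCoord_toCoord I x v

theorem frozen_eq_extend {x y : M} (v : TangentSpace I x)
    (hy : y ∈ (trivializationAt E (TangentSpace I : M → Type _) x).baseSet) :
    frozen I v y = FiberBundle.extend E v y := by
  rw [frozen, ofCoord, toCoord, Trivialization.symmL_apply _ hy,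
    FiberBundle.extend]
  congr 1
  exact congrFun (Trivialization.coe_linearMapAt_of_mem _
    (FiberBundle.mem_baseSet_trivializationAt' x)) v

theorem baseSet_mem (x : M) :
    (trivializationAt E (TangentSpace I : M → Type _) x).baseSet ∈ 𝓝 x :=
  (trivializationAt E (TangentSpace I) x).open_baseSet.mem_nhds
    (FiberBundle.mem_baseSet_trivializationAt' x)

theorem frozen_eventuallyEq {x : M} (v : TangentSpace I x) :
    ∀ᶠ y in 𝓝 x, frozen I v y = FiberBundle.extend E v y := by
  filter_upwards [baseSet_mem I x] with y hy using frozen_eq_extend I v hy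

theorem mdiff_frozen {x : M} (v : TangentSpace I x) :
    MDifferentiableAt I (I.prod 𝓘(ℝ, E)) (fun y => TotalSpace.mk' E y (frozen I v y)) x := by
  refine (FiberBundle.mdifferentiableAt_extend I E v).congr_of_eventuallyEq ?_
  filter_upwards [frozen_eventuallyEq I v] with y hy
  rw [hy]

theorem mdiff_toCoord {σ : (x : M) → TangentSpace I x} {x : M}
    (h : MDifferentiableAt I (I.prod 𝓘(ℝ, E)) (fun y => TotalSpace.mk' E y (σ y)) x) :
    MDifferentiableAt I 𝓘(ℝ, E) (fun y => toCoord I x y (σ y)) x := by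
  refine ((mdifferentiableAt_section I σ).1 h).congr_of_eventuallyEq ?_
  filter_upwards [baseSet_mem I x] with y hy
  exact congrFun (Trivialization.coe_linearMapAt_of_mem _ hy) _

end Coordinates

/-! ### The Levi-Civita connection -/

theorem mlieBracket_extend [IsManifold I ∞ M] (x : M) (u v : TangentSpace I x) :
    VectorField.mlieBracket I (FiberBundle.extend E u) (FiberBundle.extend E v) x = 0 := by
  have key : ∀ w : TangentSpace I x,
      (VectorField.mpullbackWithin 𝓘(ℝ, E) I (extChartAt I x).symm (FiberBundle.extend E w)
        (range I) : E → E) =ᶠ[𝓝[range I] (extChartAt I x x)] fun _ => toCoord I x x w := by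
    intro w
    filter_upwards [extChartAt_target_mem_nhdsWithin (I := I) x] with z hz
    have hy : (extChartAt I x).symm z ∈ (chartAt H x).source := by
      simpa using (extChartAt I x).map_target hz
    have hinv := isInvertible_mfderivWithin_extChartAt_symm (I := I) hz
    have h1 := TangentBundle.symmL_trivializationAt (I := I) hy
    rw [(extChartAt I x).right_inv hz] at h1
    have h2 : FiberBundle.extend E w ((extChartAt I x).symm z) =
        (mfderivWithin 𝓘(ℝ, E) I (extChartAt I x).symm (range I) z) (toCoord I x x w) := by
      rw [← h1]
      exact (frozen_eq_extend I w (by rwa [TangentBundle.trivializationAt_baseSet])).symm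
    rw [VectorField.mpullbackWithin_apply, h2]
    exact hinv.inverse_apply_eq.2 rfl
  rw [← VectorField.mlieBracketWithin_univ, VectorField.mlieBracketWithin_apply]
  have h0 : VectorField.lieBracketWithin ℝ
      (VectorField.mpullbackWithin 𝓘(ℝ, E) I (extChartAt I x).symm (FiberBundle.extend E u)
        (range I))
      (VectorField.mpullbackWithin 𝓘(ℝ, E) I (extChartAt I x).symm (FiberBundle.extend E v)
        (range I))
      (range I) (extChartAt I x x) = 0 := by
    refine ((key u).lieBracketWithin_vectorField_eq_of_mem (key v) (mem_range_self _)).trans ?_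
    simp [VectorField.lieBracketWithin]
  rw [preimage_univ, univ_inter, h0]
  exact map_zero _

variable [IsManifold I ∞ M]
  [RiemannianBundle (fun x : M => TangentSpace I x)]

/-- `dMetric I x v w u` is the derivative at `x` in the direction `u` of the function `⟨V, W⟩`,
where `V`, `W` extend `v`, `w` with constant coordinates in the chart at `x`. In that chart:
`uᵏ vⁱ wʲ ∂ₖ gᵢⱼ(x)`. -/
def dMetric (x : M) (v w : TangentSpace I x) : TangentSpace I x →L[ℝ] ℝ :=
  mvfderiv I (fun y => (inner ℝ (frozen I v y) (frozen I w y) : ℝ)) x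

theorem dMetric_comm (x : M) (v w : TangentSpace I x) :
    dMetric I x v w = dMetric I x w v := by
  unfold dMetric
  congr 1
  funext y
  exact real_inner_comm _ _

variable [IsContMDiffRiemannianBundle I ∞ E (fun x : M => TangentSpace I x)]

theorem mdiff_inner {x : M} (v w : TangentSpace I x) :
    MDifferentiableAt I 𝓘(ℝ, ℝ)
      (fun y => (inner ℝ (frozen I v y) (frozen I w y) : ℝ)) x := by
  have : IsContMDiffRiemannianBundle I 1 E (fun x : M => TangentSpace I x) := inferInstance
  have h1 := mdiff_frozen I v
  have h2 := mdiff_frozen I w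
  exact MDifferentiableAt.inner_bundle (IB := I) (F := E) (E := fun y : M => TangentSpace I y)
    (b := fun y => y) (v := fun y => frozen I v y) (w := fun y => frozen I w y) h1 h2

theorem dMetric_add (x : M) (v v' w : TangentSpace I x) :
    dMetric I x (v + v') w = dMetric I x v w + dMetric I x v' w := by
  unfold dMetric
  rw [← mvfderiv_add (mdiff_inner I v w) (mdiff_inner I v' w)]
  congr 1
  funext y
  simp only [frozen, map_add, Pi.add_apply]
  exact inner_add_left _ _ _

theorem dMetric_smul (x : M) (c : ℝ) (v w : TangentSpace I x) :
    dMetric I x (c • v) w = c • dMetric I x v w := by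
  unfold dMetric
  have h := mvfderiv_smul (mdifferentiableAt_const (c := c)) (mdiff_inner I v w)
  rw [mvfderiv_const] at h
  have h0 : c • mvfderiv I (fun y => (inner ℝ (frozen I v y) (frozen I w y) : ℝ)) x =
      mvfderiv I ((fun _ : M => c) • fun y => (inner ℝ (frozen I v y) (frozen I w y) : ℝ)) x := by
    rw [h]
    ext u
    simp
  rw [h0]
  congr 1
  funext y
  simp only [frozen, map_smul]
  exact real_inner_smul_left _ _ _

/-- The Christoffel symbols of the first kind in the chart at `x`, contracted with `u` and `v`:
`w ↦ ½ (∂ᵤ g(v, w) + ∂ᵥ g(u, w) - ∂_w g(u, v))`. -/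
def christoffelForm (x : M) (u v : TangentSpace I x) : TangentSpace I x →ₗ[ℝ] ℝ where
  toFun w := (1 / 2 : ℝ) * (dMetric I x v w u + dMetric I x u w v - dMetric I x u v w)
  map_add' w w' := by
    simp only [dMetric_comm I x _ (w + w'), dMetric_add, map_add, add_apply,
      dMetric_comm I x _ w, dMetric_comm I x _ w']
    ring
  map_smul' c w := by
    simp only [dMetric_comm I x _ (c • w), dMetric_smul, map_smul, smul_apply,
      dMetric_comm I x _ w, smul_eq_mul, RingHom.id_apply]
    ring

variable [FiniteDimensional ℝ E]

/-- The Christoffel symbols of the second kind, `uⁱ vʲ Γᵏᵢⱼ(x) ∂ₖ`, in the chart at `x`. -/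
def christoffelVec (x : M) (u v : TangentSpace I x) : TangentSpace I x :=
  haveI : FiniteDimensional ℝ (TangentSpace I x) := inferInstanceAs (FiniteDimensional ℝ E)
  haveI : CompleteSpace (TangentSpace I x) := FiniteDimensional.complete ℝ _
  (InnerProductSpace.toDual ℝ (TangentSpace I x)).symm
    (christoffelForm I x u v).toContinuousLinearMap

theorem inner_christoffelVec (x : M) (u v w : TangentSpace I x) :
    inner ℝ (christoffelVec I x u v) w =
      (1 / 2 : ℝ) * (dMetric I x v w u + dMetric I x u w v - dMetric I x u v w) := by
  have : FiniteDimensional ℝ (TangentSpace I x) := inferInstanceAs (FiniteDimensional ℝ E)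
  have : CompleteSpace (TangentSpace I x) := FiniteDimensional.complete ℝ _
  rw [christoffelVec, InnerProductSpace.toDual_symm_apply]
  rfl

/-- `christoffelVec` as a bilinear map. -/
def christoffel (x : M) : TangentSpace I x →ₗ[ℝ] TangentSpace I x →ₗ[ℝ] TangentSpace I x :=
  LinearMap.mk₂ ℝ (christoffelVec I x)
    (fun u u' v => ext_inner_right ℝ fun w => by
      simp only [inner_add_left, inner_christoffelVec, dMetric_add, map_add, add_apply]
      ring)
    (fun c u v => ext_inner_right ℝ fun w => by
      simp only [real_inner_smul_left, inner_christoffelVec, dMetric_smul, map_smul, smul_apply,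
        smul_eq_mul]
      ring)
    (fun u v v' => ext_inner_right ℝ fun w => by
      simp only [inner_add_left, inner_christoffelVec, dMetric_add, map_add, add_apply,
        dMetric_comm I x u (v + v'), dMetric_comm I x u v, dMetric_comm I x u v']
      ring)
    (fun c u v => ext_inner_right ℝ fun w => by
      simp only [real_inner_smul_left, inner_christoffelVec, dMetric_smul, map_smul, smul_apply,
        smul_eq_mul, dMetric_comm I x u (c • v), dMetric_comm I x u v]
      ring)

/-- `(∇ᵤ σ)(x)`: the derivative of the coordinates of `σ` in the chart at `x`, plus the
Christoffel term. -/
def leviCivitaFun (σ : (x : M) → TangentSpace I x) (x : M) :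
    TangentSpace I x →L[ℝ] TangentSpace I x :=
  haveI : FiniteDimensional ℝ (TangentSpace I x) := inferInstanceAs (FiniteDimensional ℝ E)
  ofCoord I x x ∘L mvfderiv I (fun y => toCoord I x y (σ y)) x +
    LinearMap.toContinuousLinearMap ((christoffel I x).flip (σ x))

/-- The Levi-Civita connection of the Riemannian manifold `M`; `leviCivita I σ x u` is
`(∇ᵤ σ)(x)`. It is metric and torsion-free, as shown below. -/
def leviCivita : CovariantDerivative I E (TangentSpace I : M → Type _) where
  toFun := leviCivitaFun I
  isCovariantDerivativeOnUniv :=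
    { add := by
        intro σ σ' x hσ hσ' _
        have h := mvfderiv_add (mdiff_toCoord I hσ) (mdiff_toCoord I hσ')
        have h' : (fun y => toCoord I x y ((σ + σ') y)) =
            (fun y => toCoord I x y (σ y)) + fun y => toCoord I x y (σ' y) := by
          funext y; simp
        ext u
        simp only [leviCivitaFun, h', h]
        simp
        abel
      leibniz := by
        intro σ g x hσ hg _
        have h := mvfderiv_smul hg (mdiff_toCoord I hσ)
        have h' : (fun y => toCoord I x y ((g • σ) y)) = g • fun y => toCoord I x y (σ y) := by
          funext y; simp
        ext u
        simp only [leviCivitaFun, h', h]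
        simp [ofCoord_toCoord]
        abel }

theorem leviCivita_frozen (x : M) (u v : TangentSpace I x) :
    leviCivita I (frozen I v) x u = christoffel I x u v := by
  have h : (fun y => toCoord I x y (frozen I v y)) =ᶠ[𝓝 x] fun _ => toCoord I x x v := by
    filter_upwards [baseSet_mem I x] with y hy
    exact (trivializationAt E (TangentSpace I) x).continuousLinearMapAt_symmL hy _
  have h2 : mvfderiv I (fun y => toCoord I x y (frozen I v y)) x = 0 := by
    unfold mvfderiv
    rw [h.mfderiv_eq, mfderiv_const]
    exact ContinuousLinearMap.comp_zero _
  change leviCivitaFun I (frozen I v) x u = _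
  rw [leviCivitaFun, h2, frozen_self]
  simp

theorem leviCivita_extend (x : M) (u v : TangentSpace I x) :
    leviCivita I (FiberBundle.extend E v) x u = christoffel I x u v := by
  rw [← leviCivita_frozen]
  congr 1
  exact (leviCivita I (M := M)).isCovariantDerivativeOn.congr_of_eventuallyEq
    (FiberBundle.mdifferentiableAt_extend I E v) (mdiff_frozen I v) univ_mem
    ((frozen_eventuallyEq I v).mono fun y hy => hy.symm)

theorem leviCivita_isMetricCompatible :
    CovariantDerivative.IsMetricCompatible (V := fun x : M => TangentSpace I x)
      (leviCivita I (M := M)) := by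
  unfold CovariantDerivative.IsMetricCompatible
  funext x
  ext v w u
  rw [CovariantDerivative.derivMetricTensor_apply_eq_extend]
  rw [leviCivita_extend, leviCivita_extend]
  have h : (fun y => (inner ℝ (FiberBundle.extend E v y) (FiberBundle.extend E w y) : ℝ)) =ᶠ[𝓝 x]
      fun y => (inner ℝ (frozen I v y) (frozen I w y) : ℝ) := by
    filter_upwards [frozen_eventuallyEq I v, frozen_eventuallyEq I w] with y hv hw
    rw [hv, hw]
  have h1 : mvfderiv I (fun y => (inner ℝ (FiberBundle.extend E v y)
      (FiberBundle.extend E w y) : ℝ)) x = dMetric I x v w := by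
    unfold dMetric mvfderiv
    rw [h.mfderiv_eq]
    rw [h.self_of_nhds]
  have h2 : inner ℝ (christoffel I x u v) w = _ := inner_christoffelVec I x u v w
  have h3 : inner ℝ v (christoffel I x u w) = _ :=
    (real_inner_comm _ _).trans (inner_christoffelVec I x u w v)
  refine (congrArg₂ (· - ·) (congrArg₂ (· - ·) (congrArg (fun l => l u) h1) h2) h3).trans ?_
  rw [dMetric_comm I x w v]
  change _ = (0 : ℝ)
  ring

theorem leviCivita_torsion : (leviCivita I (M := M)).torsion = 0 := by
  funext x
  ext u v
  rw [CovariantDerivative.torsion_apply_eq_extend, FiberBundle.extend_apply_self,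
    FiberBundle.extend_apply_self, leviCivita_extend, leviCivita_extend, mlieBracket_extend]
  have : christoffel I x u v = christoffel I x v u := ext_inner_right ℝ fun w => by
    refine (inner_christoffelVec I x u v w).trans
      (Eq.trans ?_ (inner_christoffelVec I x v u w).symm)
    rw [dMetric_comm I x v u]
    ring
  rw [this]
  simp

/-! ### Curvature -/

/-- `R(X, Y)Z = ∇_X ∇_Y Z - ∇_Y ∇_X Z - ∇_[X,Y] Z` for vector fields `X`, `Y`, `Z`. -/
def curvatureField (X Y Z : (x : M) → TangentSpace I x) (x : M) : TangentSpace I x :=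
  leviCivita I (fun y => leviCivita I Z y (Y y)) x (X x)
    - leviCivita I (fun y => leviCivita I Z y (X y)) x (Y x)
    - leviCivita I Z x (VectorField.mlieBracket I X Y x)

/-- The Riemannian curvature tensor `R(u, v)w` at `x`, computed with the extensions of `u`, `v`,
`w` that are constant in the chart at `x` (by tensoriality every smooth extension gives the
same value). -/
def curvature (x : M) (u v w : TangentSpace I x) : TangentSpace I x :=
  curvatureField I (frozen I u) (frozen I v) (frozen I w) x

variable (M) in
/-- `M` is a space form of curvature `K`: `R(X, Y)Z = K (⟨Z, Y⟩ X - ⟨Z, X⟩ Y)`. -/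
def HasConstantCurvature (K : ℝ) : Prop :=
  ∀ (x : M) (u v w : TangentSpace I x),
    curvature I x u v w = K • ((inner ℝ w v : ℝ) • u - (inner ℝ w u : ℝ) • v)

/-! ### Curves -/

/-- The velocity `c'(s)` of a curve. -/
def velocity {E : Type*} [NormedAddCommGroup E] [NormedSpace ℝ E]
    {H : Type*} [TopologicalSpace H] (I : ModelWithCorners ℝ E H)
    {M : Type*} [TopologicalSpace M] [ChartedSpace H M] (c : ℝ → M) (s : ℝ) :
    TangentSpace I (c s) :=
  mfderiv 𝓘(ℝ, ℝ) I c s (1 : ℝ)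

/-- The covariant derivative `∇_{c'} V` of a vector field `V` along a curve `c`. In the chart at
`c s` it is `dVᵏ/ds + Γᵏᵢⱼ c'ⁱ Vʲ`. -/
def covDerivAlong (c : ℝ → M) (V : (s : ℝ) → TangentSpace I (c s)) (s : ℝ) :
    TangentSpace I (c s) :=
  ofCoord I (c s) (c s) (deriv (fun r => toCoord I (c s) (c r) (V r)) s)
    + christoffel I (c s) (velocity I c s) (V s)

theorem covDerivAlong_restrict (c : ℝ → M) (X : (x : M) → TangentSpace I x) (s : ℝ)
    (hc : MDifferentiableAt 𝓘(ℝ, ℝ) I c s)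
    (hX : MDifferentiableAt I (I.prod 𝓘(ℝ, E)) (fun y => TotalSpace.mk' E y (X y)) (c s)) :
    covDerivAlong I c (fun r => X (c r)) s = leviCivita I X (c s) (velocity I c s) := by
  have h := mfderiv_comp s (mdiff_toCoord I hX) hc
  have h1 : deriv (fun r => toCoord I (c s) (c r) (X (c r))) s =
      mvfderiv I (fun y => toCoord I (c s) y (X y)) (c s) (velocity I c s) := by
    rw [← fderiv_apply_one_eq_deriv, ← mfderiv_eq_fderiv]
    exact congrArg (fun l => l (1 : ℝ)) h
  change _ = leviCivitaFun I X (c s) (velocity I c s)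
  rw [covDerivAlong, leviCivitaFun, h1]
  simp

/-- The tension field `τ(c) = ∇_{c'} c'`. -/
def tension (c : ℝ → M) (s : ℝ) : TangentSpace I (c s) :=
  covDerivAlong I c (velocity I c) s

/-- The `p`-bienergy `E_{2,p}(c) = (1/p) ∫ₐᵇ |τ(c)|ᵖ ds`. -/
def pBienergy (p a b : ℝ) (c : ℝ → M) : ℝ :=
  1 / p * ∫ s in a..b, ‖tension I c s‖ ^ p

/-- The vector field `|τ(c)|^{p-2} τ(c)` along `c`. -/
def pTension (p : ℝ) (c : ℝ → M) (s : ℝ) : TangentSpace I (c s) :=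
  ‖tension I c s‖ ^ (p - 2) • tension I c s

/-- The curve `c` solves the `p`-biharmonic equation
`∇∇(|τ|^{p-2} τ) - |τ|^{p-2} R(c', τ)c' = 0` in `(a, b)`. The field `|τ|^{p-2} τ` is required to be
twice differentiable along `c`, so that the left-hand side makes sense. -/
def IsPBiharmonic (p a b : ℝ) (c : ℝ → M) : Prop :=
  ∀ s ∈ Ioo a b,
    MDifferentiableAt 𝓘(ℝ, ℝ) I.tangent
      (fun r => (⟨c r, pTension I p c r⟩ : TangentBundle I M)) s ∧
    MDifferentiableAt 𝓘(ℝ, ℝ) I.tangent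
      (fun r => (⟨c r, covDerivAlong I c (pTension I p c) r⟩ : TangentBundle I M)) s ∧
    covDerivAlong I c (covDerivAlong I c (pTension I p c)) s
      - ‖tension I c s‖ ^ (p - 2) •
          curvature I (c s) (velocity I c s) (tension I c s) (velocity I c s) = 0

end PBiharmonic

namespace PBiharmonic

variable {E : Type*} [NormedAddCommGroup E] [NormedSpace ℝ E]
  {H : Type*} [TopologicalSpace H] (I : ModelWithCorners ℝ E H)
  {M : Type*} [TopologicalSpace M] [ChartedSpace H M]

/-! ### Variations -/

/-- `γ t s` is a smooth variation, `t ∈ (-ε, ε)` being the variation parameter and `s ∈ [a, b]`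
the curve parameter. Smoothness at the end points means that `γ` is smooth across them. -/
def IsSmoothVariation (ε a b : ℝ) (γ : ℝ → ℝ → M) : Prop :=
  ∀ t ∈ Ioo (-ε) ε, ∀ s ∈ Icc a b,
    ContMDiffAt 𝓘(ℝ, ℝ × ℝ) I ∞ (fun q : ℝ × ℝ => γ q.1 q.2) (t, s)

/-- All curves of the variation have the same end points and the same velocities there. -/
def IsClamped (ε a b : ℝ) (γ : ℝ → ℝ → M) : Prop :=
  ∀ t ∈ Ioo (-ε) ε, ∀ s ∈ ({a, b} : Set ℝ),
    (⟨γ t s, velocity I (γ t) s⟩ : TangentBundle I M) = ⟨γ 0 s, velocity I (γ 0) s⟩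

/-- All curves of the variation are closed with period `b - a`. -/
def IsClosedVariation (ε a b : ℝ) (γ : ℝ → ℝ → M) : Prop :=
  ∀ t ∈ Ioo (-ε) ε, ∀ s : ℝ, γ t (s + (b - a)) = γ t s

/-- The variation field `η = ∂γ_t/∂t` at `t = 0`, a vector field along `γ 0`. -/
def variationField (γ : ℝ → ℝ → M) (s : ℝ) : TangentSpace I (γ 0 s) :=
  velocity I (fun t => γ t s) 0

end PBiharmonic

end

open PBiharmonic

/-!
Write `T = ∂ₛγ`, `V = ∂ₜγ`, `τ = ∇ₛT`. By metric compatibility, `∂ₜ|τ|² = 2⟪∇ₜτ, τ⟫`, so two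
differentiations under the integral sign give
`∫ (p - 2)|τ|^{p-4} ⟪∇ₜτ, τ⟫² + |τ|^{p-2} (|∇ₜτ|² + ⟪∇ₜ∇ₜτ, τ⟫)` as the second derivative of the energy
(`hasDerivAt_deriv_integral_rpow`). The factor `|τ|^{p-4}` may be singular, but by Cauchy-Schwarz it
always occurs together with two factors of size `O(|τ|)`, so that all integrands are bounded by
continuous functions; at a zero of `τ` the derivatives exist because `⟪∇ₜτ, τ⟫` vanishes there.

Torsion-freeness, `∇ₜT = ∇ₛV` (`covSnd_velocity_fst`), and the commutation rule
`∇ₜ∇ₛ - ∇ₛ∇ₜ = R(V, T)` (`covFst_covSnd_sub`) turn `∇ₜτ` and `∇ₜ∇ₜτ` into derivatives of `V` along the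
curve plus curvature terms, which are explicit in a space form. Up to algebra
(`secondVariation_integrand`) the integrand becomes the one of the formula plus
`⟪∇ₛY, F⟫ - ⟪W, ∇ₛ∇ₛF⟫` and curvature terms, where `F = |τ|^{p-2}τ`, `W = ∇ₜV`, `Y = ∇ₜ∇ₛV`. By the
`p`-biharmonic equation this remainder is the derivative of `⟪Y, F⟫ - ⟪W, ∇ₛF⟫`
(`hasDerivAt_boundaryTerm`). That function is continuous on `[a, b]`, also where `τ` vanishes, and it
takes the same value at both ends: for clamped curves `W` and `Y` are zero there, for closed curves
everything is periodic.

The two geometric identities are proved in charts. The covariant derivative of the statement is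
computed at each point in the chart centred at that point; `leviCivita_ofCoord` (the Koszul formula)
and `toCoord_covDerivAlong` express it in a fixed chart, where it can be differentiated again.
-/

namespace PBiharmonic

/-! ### Norms on spaces of linear maps -/

/-! With `Bundle` opened, the search for a norm on a space of continuous linear maps tries the fibres
of Riemannian bundles and times out; the instances it should find are given here. -/

noncomputable local instance {E : Type*} [NormedAddCommGroup E] [NormedSpace ℝ E] :
    NormedAddCommGroup (E →L[ℝ] ℝ) := ContinuousLinearMap.toNormedAddCommGroup
noncomputable local instance {E : Type*} [NormedAddCommGroup E] [NormedSpace ℝ E] :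
    NormedSpace ℝ (E →L[ℝ] ℝ) := ContinuousLinearMap.toNormedSpace
noncomputable local instance {E : Type*} [NormedAddCommGroup E] [NormedSpace ℝ E] :
    NormedAddCommGroup (E →L[ℝ] E →L[ℝ] ℝ) := ContinuousLinearMap.toNormedAddCommGroup
noncomputable local instance {E : Type*} [NormedAddCommGroup E] [NormedSpace ℝ E] :
    NormedSpace ℝ (E →L[ℝ] E →L[ℝ] ℝ) := ContinuousLinearMap.toNormedSpace
noncomputable local instance {E : Type*} [NormedAddCommGroup E] [NormedSpace ℝ E] :
    NormedAddCommGroup (E →L[ℝ] E →L[ℝ] E →L[ℝ] ℝ) := inferInstance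
noncomputable local instance {E : Type*} [NormedAddCommGroup E] [NormedSpace ℝ E] :
    NormedSpace ℝ (E →L[ℝ] E →L[ℝ] E →L[ℝ] ℝ) := inferInstance
noncomputable local instance {E : Type*} [NormedAddCommGroup E] [NormedSpace ℝ E] :
    NormedAddCommGroup ((E →L[ℝ] ℝ) →L[ℝ] E) := ContinuousLinearMap.toNormedAddCommGroup
noncomputable local instance {E : Type*} [NormedAddCommGroup E] [NormedSpace ℝ E] :
    NormedSpace ℝ ((E →L[ℝ] ℝ) →L[ℝ] E) := ContinuousLinearMap.toNormedSpace
noncomputable local instance {E : Type*} [NormedAddCommGroup E] [NormedSpace ℝ E] :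
    NormedAddCommGroup (E →L[ℝ] E) := ContinuousLinearMap.toNormedAddCommGroup
noncomputable local instance {E : Type*} [NormedAddCommGroup E] [NormedSpace ℝ E] :
    NormedSpace ℝ (E →L[ℝ] E) := ContinuousLinearMap.toNormedSpace
noncomputable local instance {E : Type*} [NormedAddCommGroup E] [NormedSpace ℝ E] :
    NormedAddCommGroup (E →L[ℝ] E →L[ℝ] E) := ContinuousLinearMap.toNormedAddCommGroup
noncomputable local instance {E : Type*} [NormedAddCommGroup E] [NormedSpace ℝ E] :
    NormedSpace ℝ (E →L[ℝ] E →L[ℝ] E) := ContinuousLinearMap.toNormedSpace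

/-! ### The Koszul formula -/

section Koszul

variable {E : Type*} [NormedAddCommGroup E] [NormedSpace ℝ E]

/-- The bilinear map `Γ` with `h (Γ e f) k = (D e f k + D f e k - D k e f) / 2`, for a nondegenerate
bilinear form `h` (the metric) and a trilinear form `D` (its derivative). -/
noncomputable def koszulMap (h : E →L[ℝ] E →L[ℝ] ℝ) (D : E →L[ℝ] E →L[ℝ] E →L[ℝ] ℝ) :
    E →L[ℝ] E →L[ℝ] E :=
  (ContinuousLinearMap.compL ℝ E (E →L[ℝ] ℝ) E h.inverse) ∘L
    ((1 / 2 : ℝ) • (D + D.flip -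
      ((ContinuousLinearMap.flipₗᵢ ℝ E E ℝ).toContinuousLinearEquiv :
        (E →L[ℝ] E →L[ℝ] ℝ) →L[ℝ] E →L[ℝ] E →L[ℝ] ℝ) ∘L D.flip))

theorem apply_koszulMap {h : E →L[ℝ] E →L[ℝ] ℝ} (hh : h.IsInvertible)
    (D : E →L[ℝ] E →L[ℝ] E →L[ℝ] ℝ) (e f k : E) :
    h (koszulMap h D e f) k = 1 / 2 * (D e f k + D f e k - D k e f) := by
  have h1 : h (koszulMap h D e f) = _ := hh.self_apply_inverse _
  rw [h1]
  rfl

theorem contDiffAt_koszulMap [FiniteDimensional ℝ E] {g : E → E →L[ℝ] E →L[ℝ] ℝ} {u : E}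
    (hg : ContDiffAt ℝ ∞ g u) (hu : (g u).IsInvertible) :
    ContDiffAt ℝ ∞ (fun u => koszulMap (g u) (fderiv ℝ g u)) u := by
  have : CompleteSpace E := FiniteDimensional.complete ℝ E
  have hD : ContDiffAt ℝ ∞ (fderiv ℝ g) u := hg.fderiv_right (m := ∞) (by simp)
  have hinv : ContDiffAt ℝ ∞ (fun u => (g u).inverse) u := by
    obtain ⟨e, he⟩ := hu
    exact ContDiffAt.comp u (he ▸ contDiffAt_map_inverse e) hg
  have hflip : ContDiffAt ℝ ∞ (fun u => (fderiv ℝ g u).flip) u :=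
    (ContinuousLinearMap.flipₗᵢ ℝ E E (E →L[ℝ] ℝ)).toContinuousLinearEquiv.contDiff.contDiffAt.comp
      u hD
  unfold koszulMap
  refine ContDiffAt.clm_comp ?_ ?_
  · exact (ContinuousLinearMap.compL ℝ E (E →L[ℝ] ℝ) E).contDiff.contDiffAt.comp u hinv
  · exact ((hD.add hflip).sub (contDiffAt_const.clm_comp hflip)).const_smul _

end Koszul

/-! ### Coordinate vector fields -/

section LocalCoordinates

variable {E : Type*} [NormedAddCommGroup E] [NormedSpace ℝ E]
  {M : Type*} [TopologicalSpace M] [ChartedSpace E M] [IsManifold 𝓘(ℝ, E) ∞ M]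

theorem mem_baseSet_of_mem_source {x y : M} (hy : y ∈ (chartAt E x).source) :
    y ∈ (trivializationAt E (TangentSpace 𝓘(ℝ, E) : M → Type _) x).baseSet := by
  rwa [TangentBundle.trivializationAt_baseSet]

theorem toCoord_ofCoord {x y : M} (hy : y ∈ (chartAt E x).source) (e : E) :
    toCoord 𝓘(ℝ, E) x y (ofCoord 𝓘(ℝ, E) x y e) = e :=
  (trivializationAt E (TangentSpace 𝓘(ℝ, E)) x).continuousLinearMapAt_symmL
    (mem_baseSet_of_mem_source hy) e

theorem ofCoord_toCoord_of_mem {x y : M} (hy : y ∈ (chartAt E x).source)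
    (v : TangentSpace 𝓘(ℝ, E) y) :
    ofCoord 𝓘(ℝ, E) x y (toCoord 𝓘(ℝ, E) x y v) = v :=
  (trivializationAt E (TangentSpace 𝓘(ℝ, E)) x).symmL_continuousLinearMapAt
    (mem_baseSet_of_mem_source hy) v

theorem toCoord_eq_trivialization {x y : M} (hy : y ∈ (chartAt E x).source)
    (v : TangentSpace 𝓘(ℝ, E) y) :
    toCoord 𝓘(ℝ, E) x y v = (trivializationAt E (TangentSpace 𝓘(ℝ, E)) x ⟨y, v⟩).2 :=
  congrFun (Trivialization.coe_linearMapAt_of_mem _ (mem_baseSet_of_mem_source hy)) v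

theorem toCoord_eq_mfderiv {x y : M} (hy : y ∈ (chartAt E x).source) :
    toCoord 𝓘(ℝ, E) x y = mfderiv 𝓘(ℝ, E) 𝓘(ℝ, E) (extChartAt 𝓘(ℝ, E) x) y :=
  TangentBundle.continuousLinearMapAt_trivializationAt hy

theorem contMDiffAt_ofCoord {x y : M} (hy : y ∈ (chartAt E x).source) (e : E) :
    ContMDiffAt 𝓘(ℝ, E) (𝓘(ℝ, E).prod 𝓘(ℝ, E)) ∞
      (fun z => TotalSpace.mk' E z (ofCoord 𝓘(ℝ, E) x z e)) y := by
  refine ((trivializationAt E (TangentSpace 𝓘(ℝ, E)) x).contMDiffAt_section_iff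
    (mem_baseSet_of_mem_source hy)).2 ?_
  refine (contMDiffAt_const (c := e)).congr_of_eventuallyEq ?_
  filter_upwards [(chartAt E x).open_source.mem_nhds hy] with z hz
  rw [← toCoord_eq_trivialization hz, toCoord_ofCoord hz]

theorem mdifferentiableAt_ofCoord {x y : M} (hy : y ∈ (chartAt E x).source) (e : E) :
    MDifferentiableAt 𝓘(ℝ, E) (𝓘(ℝ, E).prod 𝓘(ℝ, E))
      (fun z => TotalSpace.mk' E z (ofCoord 𝓘(ℝ, E) x z e)) y :=
  (contMDiffAt_ofCoord hy e).mdifferentiableAt (by simp)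

/-- In a chart centred at `x`, the derivative of a scalar function along a coordinate vector is
the ordinary derivative of its coordinate expression. -/
theorem fderiv_comp_extChartAt_symm {x y : M} (hy : y ∈ (chartAt E x).source) {φ : M → ℝ}
    (hφ : MDifferentiableAt 𝓘(ℝ, E) 𝓘(ℝ, ℝ) φ y) (e : E) :
    fderiv ℝ (fun u => φ ((extChartAt 𝓘(ℝ, E) x).symm u)) (extChartAt 𝓘(ℝ, E) x y) e =
      mvfderiv 𝓘(ℝ, E) φ y (ofCoord 𝓘(ℝ, E) x y e) := by
  have hy' : y ∈ (extChartAt 𝓘(ℝ, E) x).source := by rwa [extChartAt_source]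
  have hinv := (extChartAt 𝓘(ℝ, E) x).left_inv hy'
  have h1 : ofCoord 𝓘(ℝ, E) x y = mfderiv 𝓘(ℝ, E) 𝓘(ℝ, E) (extChartAt 𝓘(ℝ, E) x).symm
      (extChartAt 𝓘(ℝ, E) x y) := by
    have := TangentBundle.symmL_trivializationAt (I := 𝓘(ℝ, E)) (𝕜 := ℝ) hy
    rw [modelWithCornersSelf_coe, range_id, mfderivWithin_univ] at this
    exact this
  have h2 : MDifferentiableAt 𝓘(ℝ, E) 𝓘(ℝ, E) (extChartAt 𝓘(ℝ, E) x).symm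
      (extChartAt 𝓘(ℝ, E) x y) := by
    have := mdifferentiableWithinAt_extChartAt_symm (I := 𝓘(ℝ, E))
      ((extChartAt 𝓘(ℝ, E) x).map_source hy')
    rwa [modelWithCornersSelf_coe, range_id, mdifferentiableWithinAt_univ] at this
  have h3 := mfderiv_comp_of_eq (I := 𝓘(ℝ, E)) (I' := 𝓘(ℝ, E)) (I'' := 𝓘(ℝ, ℝ))
    (x := extChartAt 𝓘(ℝ, E) x y) (f := (extChartAt 𝓘(ℝ, E) x).symm) (g := φ) hφ h2 hinv
  rw [mfderiv_eq_fderiv] at h3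
  rw [h1]
  refine (congrArg (fun l => l e) h3).trans ?_
  rw [hinv]
  rfl

/-- The constant vector field `e` on the model space. -/
def constVectorField (e : E) : (u : E) → TangentSpace 𝓘(ℝ, E) u := fun _ => e

theorem ofCoord_eq_mpullback [CompleteSpace E] {x y : M} (hy : y ∈ (chartAt E x).source) (e : E) :
    ofCoord 𝓘(ℝ, E) x y e =
      VectorField.mpullback 𝓘(ℝ, E) 𝓘(ℝ, E) (extChartAt 𝓘(ℝ, E) x) (constVectorField e) y := by
  rw [VectorField.mpullback_apply, ← toCoord_eq_mfderiv hy]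
  have : (toCoord 𝓘(ℝ, E) x y).IsInvertible := by
    rw [toCoord_eq_mfderiv hy]
    exact isInvertible_mfderiv_extChartAt (by rwa [extChartAt_source])
  exact (this.inverse_apply_eq.2 (toCoord_ofCoord hy e).symm).symm

theorem mlieBracket_ofCoord [CompleteSpace E] {x y : M} (hy : y ∈ (chartAt E x).source) (e f : E) :
    VectorField.mlieBracket 𝓘(ℝ, E) (fun z : M => ofCoord 𝓘(ℝ, E) x z e)
      (fun z => ofCoord 𝓘(ℝ, E) x z f) y = 0 := by
  have key : ∀ e : E, (fun z : M => ofCoord 𝓘(ℝ, E) x z e) =ᶠ[𝓝 y]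
      VectorField.mpullback 𝓘(ℝ, E) 𝓘(ℝ, E) (extChartAt 𝓘(ℝ, E) x) (constVectorField e) := by
    intro e
    filter_upwards [(chartAt E x).open_source.mem_nhds hy] with z hz
    exact ofCoord_eq_mpullback hz e
  have hd : ∀ (e u : E), MDifferentiableAt 𝓘(ℝ, E) (𝓘(ℝ, E).prod 𝓘(ℝ, E))
      (fun z => TotalSpace.mk' E z (constVectorField e z)) u := fun e u =>
    ContMDiffAt.mdifferentiableAt (n := 1)
      (contMDiffAt_vectorSpace_iff_contDiffAt.2 contDiffAt_const) one_ne_zero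
  have h0 : VectorField.mlieBracket 𝓘(ℝ, E) (constVectorField e) (constVectorField f) = 0 := by
    rw [← VectorField.mlieBracketWithin_univ, VectorField.mlieBracketWithin_eq_lieBracketWithin]
    funext z
    have h : ∀ e : E, fderivWithin ℝ (constVectorField e) univ z = 0 := fun e =>
      fderivWithin_const_apply e
    simp only [VectorField.lieBracketWithin, h]
    exact sub_self (0 : E)
  have h2 : minSmoothness ℝ 2 ≤ (∞ : ℕ∞ω) := by
    rw [minSmoothness_of_isRCLikeNormedField]
    exact WithTop.coe_le_coe.2 le_top
  have : IsManifold 𝓘(ℝ, E) (minSmoothness ℝ 2) M := IsManifold.of_le (n := ∞) h2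
  rw [(key e).mlieBracket_vectorField_eq (key f), ← VectorField.mpullback_mlieBracket (n := ∞)
    (hd e _) (hd f _) (contMDiffAt_extChartAt' hy) h2, h0, VectorField.mpullback_apply]
  exact map_zero _

/-! ### The metric and the Christoffel symbols in a chart -/

variable [RiemannianBundle (fun x : M => TangentSpace 𝓘(ℝ, E) x)]

/-- The metric in the chart centred at `x`, as a bilinear form depending on the coordinates `u`. -/
noncomputable def metricCoord (x : M) (u : E) : E →L[ℝ] E →L[ℝ] ℝ :=
  (innerSL ℝ (E := TangentSpace 𝓘(ℝ, E) ((extChartAt 𝓘(ℝ, E) x).symm u))).bilinearComp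
    (ofCoord 𝓘(ℝ, E) x ((extChartAt 𝓘(ℝ, E) x).symm u))
    (ofCoord 𝓘(ℝ, E) x ((extChartAt 𝓘(ℝ, E) x).symm u))

theorem metricCoord_apply (x : M) (u e f : E) :
    metricCoord x u e f = inner ℝ (ofCoord 𝓘(ℝ, E) x ((extChartAt 𝓘(ℝ, E) x).symm u) e)
      (ofCoord 𝓘(ℝ, E) x ((extChartAt 𝓘(ℝ, E) x).symm u) f) := rfl

theorem metricCoord_extChartAt {x y : M} (hy : y ∈ (chartAt E x).source) (e f : E) :
    metricCoord x (extChartAt 𝓘(ℝ, E) x y) e f =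
      inner ℝ (ofCoord 𝓘(ℝ, E) x y e) (ofCoord 𝓘(ℝ, E) x y f) := by
  rw [metricCoord_apply, (extChartAt 𝓘(ℝ, E) x).left_inv (by rwa [extChartAt_source])]

/-- The Christoffel symbols of the second kind in the chart centred at `x`, as a bilinear map
depending on the coordinates `u`. -/
noncomputable def christoffelCoord (x : M) (u : E) : E →L[ℝ] E →L[ℝ] E :=
  koszulMap (metricCoord x u) (fderiv ℝ (metricCoord x) u)

variable [FiniteDimensional ℝ E]

theorem isInvertible_metricCoord {x : M} {u : E} (hu : u ∈ (extChartAt 𝓘(ℝ, E) x).target) :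
    (metricCoord x u).IsInvertible := by
  have hy : (extChartAt 𝓘(ℝ, E) x).symm u ∈ (chartAt E x).source := by
    simpa using (extChartAt 𝓘(ℝ, E) x).map_target hu
  have hinj : Function.Injective (metricCoord x u) := by
    refine (injective_iff_map_eq_zero _).2 fun e he => ?_
    have h0 : metricCoord x u e e = 0 := by rw [he]; rfl
    rw [metricCoord_apply, inner_self_eq_zero] at h0
    have := congrArg (toCoord 𝓘(ℝ, E) x _) h0
    rwa [toCoord_ofCoord hy, map_zero] at this
  have hfin : Module.finrank ℝ E = Module.finrank ℝ (E →L[ℝ] ℝ) := by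
    rw [← (LinearMap.toContinuousLinearMap (𝕜 := ℝ) (E := E) (F' := ℝ)).finrank_eq]
    exact (Subspace.dual_finrank_eq (K := ℝ) (V := E)).symm
  exact ⟨(LinearEquiv.ofInjectiveOfFinrankEq (metricCoord x u : E →ₗ[ℝ] E →L[ℝ] ℝ) hinj
    hfin).toContinuousLinearEquiv, rfl⟩

theorem metricCoord_christoffelCoord {x : M} {u : E} (hu : u ∈ (extChartAt 𝓘(ℝ, E) x).target)
    (e f k : E) :
    metricCoord x u (christoffelCoord x u e f) k = 1 / 2 * (fderiv ℝ (metricCoord x) u e f k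
      + fderiv ℝ (metricCoord x) u f e k - fderiv ℝ (metricCoord x) u k e f) :=
  apply_koszulMap (isInvertible_metricCoord hu) _ e f k

variable [IsContMDiffRiemannianBundle 𝓘(ℝ, E) ∞ E (fun x : M => TangentSpace 𝓘(ℝ, E) x)]

theorem contDiffOn_metricCoord (x : M) :
    ContDiffOn ℝ ∞ (metricCoord x) (extChartAt 𝓘(ℝ, E) x).target := by
  rw [contDiffOn_clm_apply]
  intro e
  rw [contDiffOn_clm_apply]
  intro f u hu
  refine ContDiffAt.contDiffWithinAt ?_
  have hy : (extChartAt 𝓘(ℝ, E) x).symm u ∈ (chartAt E x).source := by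
    simpa using (extChartAt 𝓘(ℝ, E) x).map_target hu
  have h1 : ContMDiffAt 𝓘(ℝ, E) 𝓘(ℝ, ℝ) ∞ (fun y : M => (inner ℝ (ofCoord 𝓘(ℝ, E) x y e)
      (ofCoord 𝓘(ℝ, E) x y f) : ℝ)) ((extChartAt 𝓘(ℝ, E) x).symm u) :=
    ContMDiffAt.inner_bundle (IB := 𝓘(ℝ, E)) (F := E) (E := fun y : M => TangentSpace 𝓘(ℝ, E) y)
      (b := fun y => y) (v := fun y => ofCoord 𝓘(ℝ, E) x y e)
      (w := fun y => ofCoord 𝓘(ℝ, E) x y f) (contMDiffAt_ofCoord hy e) (contMDiffAt_ofCoord hy f)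
  have h2 : ContMDiffAt 𝓘(ℝ, E) 𝓘(ℝ, E) ∞ (extChartAt 𝓘(ℝ, E) x).symm u :=
    (contMDiffOn_extChartAt_symm x).contMDiffAt (extChartAt_target_mem_nhds' hu)
  exact (h1.comp u h2).contDiffAt

theorem contDiffAt_metricCoord {x : M} {u : E} (hu : u ∈ (extChartAt 𝓘(ℝ, E) x).target) :
    ContDiffAt ℝ ∞ (metricCoord x) u :=
  (contDiffOn_metricCoord x).contDiffAt (extChartAt_target_mem_nhds' hu)

theorem contDiffAt_christoffelCoord {x : M} {u : E} (hu : u ∈ (extChartAt 𝓘(ℝ, E) x).target) :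
    ContDiffAt ℝ ∞ (christoffelCoord x) u :=
  contDiffAt_koszulMap (contDiffAt_metricCoord hu) (isInvertible_metricCoord hu)

theorem fderiv_metricCoord_apply {x y : M} (hy : y ∈ (chartAt E x).source) (e f k : E) :
    fderiv ℝ (metricCoord x) (extChartAt 𝓘(ℝ, E) x y) e f k =
      mvfderiv 𝓘(ℝ, E) (fun z => (inner ℝ (ofCoord 𝓘(ℝ, E) x z f) (ofCoord 𝓘(ℝ, E) x z k) : ℝ)) y
        (ofCoord 𝓘(ℝ, E) x y e) := by
  have hu : extChartAt 𝓘(ℝ, E) x y ∈ (extChartAt 𝓘(ℝ, E) x).target :=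
    (extChartAt 𝓘(ℝ, E) x).map_source (by rwa [extChartAt_source])
  have h1 : IsContMDiffRiemannianBundle 𝓘(ℝ, E) 1 E (fun x : M => TangentSpace 𝓘(ℝ, E) x) :=
    inferInstance
  rw [← fderiv_comp_extChartAt_symm hy]
  · have hd : HasFDerivAt (metricCoord x) _ (extChartAt 𝓘(ℝ, E) x y) :=
      ((contDiffAt_metricCoord hu).differentiableAt (by simp)).hasFDerivAt
    have h2 := (hd.clm_apply (hasFDerivAt_const f _)).clm_apply (hasFDerivAt_const k _)
    have h3 := h2.fderiv
    simp only [metricCoord_apply] at h3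
    rw [h3]
    simp
  · exact MDifferentiableAt.inner_bundle (IB := 𝓘(ℝ, E)) (F := E)
      (E := fun y : M => TangentSpace 𝓘(ℝ, E) y) (b := fun y => y)
      (v := fun z => ofCoord 𝓘(ℝ, E) x z f) (w := fun z => ofCoord 𝓘(ℝ, E) x z k)
      (mdifferentiableAt_ofCoord hy f) (mdifferentiableAt_ofCoord hy k)

/-- The Levi-Civita connection in a chart, at every point of the chart and not only at its centre:
by the Koszul formula it is given by the Christoffel symbols of the metric in that chart. -/
theorem leviCivita_ofCoord {x y : M} (hy : y ∈ (chartAt E x).source) (e f : E) :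
    leviCivita 𝓘(ℝ, E) (fun z => ofCoord 𝓘(ℝ, E) x z f) y (ofCoord 𝓘(ℝ, E) x y e) =
      ofCoord 𝓘(ℝ, E) x y (christoffelCoord x (extChartAt 𝓘(ℝ, E) x y) e f) := by
  have hu : extChartAt 𝓘(ℝ, E) x y ∈ (extChartAt 𝓘(ℝ, E) x).target :=
    (extChartAt 𝓘(ℝ, E) x).map_source (by rwa [extChartAt_source])
  have hcomp : CompleteSpace E := FiniteDimensional.complete ℝ E
  set G : E → E → TangentSpace 𝓘(ℝ, E) y := fun e f =>
    leviCivita 𝓘(ℝ, E) (fun z => ofCoord 𝓘(ℝ, E) x z f) y (ofCoord 𝓘(ℝ, E) x y e) with hG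
  have hmet : ∀ e f k : E, fderiv ℝ (metricCoord x) (extChartAt 𝓘(ℝ, E) x y) e f k =
      inner ℝ (G e f) (ofCoord 𝓘(ℝ, E) x y k) + inner ℝ (ofCoord 𝓘(ℝ, E) x y f) (G e k) := by
    intro e f k
    rw [fderiv_metricCoord_apply hy]
    exact (leviCivita_isMetricCompatible (M := M) 𝓘(ℝ, E)).mvfderiv_inner_eq
      (fun z => ofCoord 𝓘(ℝ, E) x z e) (mdifferentiableAt_ofCoord hy f)
      (mdifferentiableAt_ofCoord hy k)
  have hsymm : ∀ e f : E, G e f = G f e := by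
    intro e f
    have h := (CovariantDerivative.torsion_eq_zero_iff _).1 (leviCivita_torsion (M := M) 𝓘(ℝ, E))
      (mdifferentiableAt_ofCoord hy e) (mdifferentiableAt_ofCoord hy f)
    rw [mlieBracket_ofCoord hy] at h
    exact sub_eq_zero.1 h
  change G e f = _
  refine ext_inner_right ℝ fun w => ?_
  obtain ⟨k, rfl⟩ : ∃ k, w = ofCoord 𝓘(ℝ, E) x y k := ⟨_, (ofCoord_toCoord_of_mem hy w).symm⟩
  rw [← metricCoord_extChartAt hy, metricCoord_christoffelCoord hu, hmet, hmet, hmet,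
    hsymm k e, hsymm k f, hsymm f e, real_inner_comm (G e k), real_inner_comm (G f k)]
  ring

end LocalCoordinates

/-! ### Vector fields along a curve -/

section AlongCurve

variable {E : Type*} [NormedAddCommGroup E] [NormedSpace ℝ E]
  {M : Type*} [TopologicalSpace M] [ChartedSpace E M] [IsManifold 𝓘(ℝ, E) ∞ M]

/-- The vector field `V` along the curve `c` is differentiable at `s`, as a curve in the tangent
bundle. -/
def IsDiffAlong (c : ℝ → M) (V : (s : ℝ) → TangentSpace 𝓘(ℝ, E) (c s)) (s : ℝ) : Prop :=
  MDifferentiableAt 𝓘(ℝ, ℝ) 𝓘(ℝ, E).tangent (fun r => (⟨c r, V r⟩ : TangentBundle 𝓘(ℝ, E) M)) s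

variable {c : ℝ → M} {V W : (s : ℝ) → TangentSpace 𝓘(ℝ, E) (c s)} {s : ℝ}

theorem isDiffAlong_iff {x : M} (hx : c s ∈ (chartAt E x).source) :
    IsDiffAlong c V s ↔ MDifferentiableAt 𝓘(ℝ, ℝ) 𝓘(ℝ, E) c s ∧
      DifferentiableAt ℝ (fun r => toCoord 𝓘(ℝ, E) x (c r) (V r)) s := by
  have hmem : (⟨c s, V s⟩ : TangentBundle 𝓘(ℝ, E) M) ∈
      (trivializationAt E (TangentSpace 𝓘(ℝ, E)) x).source := by
    rw [Trivialization.mem_source]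
    exact mem_baseSet_of_mem_source hx
  refine ((trivializationAt E (TangentSpace 𝓘(ℝ, E)) x).mdifferentiableAt_totalSpace_iff
    𝓘(ℝ, E) (fun r => (⟨c r, V r⟩ : TangentBundle 𝓘(ℝ, E) M)) hmem).trans ?_
  refine and_congr_right fun hc => ?_
  rw [mdifferentiableAt_iff_differentiableAt]
  refine EventuallyEq.differentiableAt_iff ?_
  filter_upwards [hc.continuousAt.preimage_mem_nhds ((chartAt E x).open_source.mem_nhds hx)]
    with r hr
  exact (toCoord_eq_trivialization hr _).symm

theorem IsDiffAlong.mdifferentiableAt (h : IsDiffAlong c V s) :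
    MDifferentiableAt 𝓘(ℝ, ℝ) 𝓘(ℝ, E) c s :=
  ((isDiffAlong_iff (mem_chart_source E (c s))).1 h).1

theorem IsDiffAlong.differentiableAt (h : IsDiffAlong c V s) {x : M}
    (hx : c s ∈ (chartAt E x).source) :
    DifferentiableAt ℝ (fun r => toCoord 𝓘(ℝ, E) x (c r) (V r)) s :=
  ((isDiffAlong_iff hx).1 h).2

theorem IsDiffAlong.add (hV : IsDiffAlong c V s) (hW : IsDiffAlong c W s) :
    IsDiffAlong c (fun r => V r + W r) s := by
  have hx := mem_chart_source E (c s)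
  refine (isDiffAlong_iff hx).2 ⟨hV.mdifferentiableAt, ?_⟩
  simp only [map_add]
  exact (hV.differentiableAt hx).add (hW.differentiableAt hx)

theorem IsDiffAlong.smul {f : ℝ → ℝ} (hf : DifferentiableAt ℝ f s) (hV : IsDiffAlong c V s) :
    IsDiffAlong c (fun r => f r • V r) s := by
  have hx := mem_chart_source E (c s)
  refine (isDiffAlong_iff hx).2 ⟨hV.mdifferentiableAt, ?_⟩
  simp only [map_smul]
  exact hf.smul (hV.differentiableAt hx)

theorem IsDiffAlong.restrict {X : (x : M) → TangentSpace 𝓘(ℝ, E) x}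
    (hc : MDifferentiableAt 𝓘(ℝ, ℝ) 𝓘(ℝ, E) c s)
    (hX : MDifferentiableAt 𝓘(ℝ, E) (𝓘(ℝ, E).prod 𝓘(ℝ, E))
      (fun y => TotalSpace.mk' E y (X y)) (c s)) :
    IsDiffAlong c (fun r => X (c r)) s :=
  MDifferentiableAt.comp (g := fun y => TotalSpace.mk' E y (X y)) s hX hc

/-- The velocity of a curve in the chart centred at `x`. -/
theorem toCoord_velocity (hc : MDifferentiableAt 𝓘(ℝ, ℝ) 𝓘(ℝ, E) c s) {x : M}
    (hx : c s ∈ (chartAt E x).source) :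
    toCoord 𝓘(ℝ, E) x (c s) (velocity 𝓘(ℝ, E) c s) =
      deriv (fun r => extChartAt 𝓘(ℝ, E) x (c r)) s := by
  have h := mfderiv_comp s (mdifferentiableAt_extChartAt (I := 𝓘(ℝ, E)) hx) hc
  rw [← fderiv_apply_one_eq_deriv, ← mfderiv_eq_fderiv, toCoord_eq_mfderiv hx]
  exact (congrArg (fun l => l (1 : ℝ)) h).symm

variable [RiemannianBundle (fun x : M => TangentSpace 𝓘(ℝ, E) x)] [FiniteDimensional ℝ E]
  [IsContMDiffRiemannianBundle 𝓘(ℝ, E) ∞ E (fun x : M => TangentSpace 𝓘(ℝ, E) x)]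

theorem covDerivAlong_add (hV : IsDiffAlong c V s) (hW : IsDiffAlong c W s) :
    covDerivAlong 𝓘(ℝ, E) c (fun r => V r + W r) s =
      covDerivAlong 𝓘(ℝ, E) c V s + covDerivAlong 𝓘(ℝ, E) c W s := by
  have hx := mem_chart_source E (c s)
  have h := deriv_fun_add (hV.differentiableAt hx) (hW.differentiableAt hx)
  simp only [covDerivAlong, map_add, h]
  abel

theorem covDerivAlong_smul {f : ℝ → ℝ} (hf : DifferentiableAt ℝ f s) (hV : IsDiffAlong c V s) :
    covDerivAlong 𝓘(ℝ, E) c (fun r => f r • V r) s =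
      deriv f s • V s + f s • covDerivAlong 𝓘(ℝ, E) c V s := by
  have hx := mem_chart_source E (c s)
  have h := deriv_fun_smul hf (hV.differentiableAt hx)
  simp only [covDerivAlong, map_smul, h, map_add, ofCoord_toCoord, smul_add]
  abel

/-- Where the field vanishes the Christoffel term drops out, and with it the dependence on the
chart. -/
theorem covDerivAlong_of_eq_zero (hV : IsDiffAlong c V s) (h0 : V s = 0) {x : M}
    (hx : c s ∈ (chartAt E x).source) :
    covDerivAlong 𝓘(ℝ, E) c V s =
      ofCoord 𝓘(ℝ, E) x (c s) (deriv (fun r => toCoord 𝓘(ℝ, E) x (c r) (V r)) s) := by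
  have hs := mem_chart_source E (c s)
  have hc := hV.mdifferentiableAt
  have hB : DifferentiableAt ℝ (fun r => ((trivializationAt E (TangentSpace 𝓘(ℝ, E)) x).coordChangeL
      ℝ (trivializationAt E (TangentSpace 𝓘(ℝ, E)) (c s)) (c r) : E →L[ℝ] E)) s :=
    (hc.coordChangeL (mem_baseSet_of_mem_source hx) (mem_baseSet_of_mem_source hs)).differentiableAt
  have hBe : ∀ᶠ r in 𝓝 s, ∀ e : E, (trivializationAt E (TangentSpace 𝓘(ℝ, E)) x).coordChangeL
      ℝ (trivializationAt E (TangentSpace 𝓘(ℝ, E)) (c s)) (c r) e =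
      toCoord 𝓘(ℝ, E) (c s) (c r) (ofCoord 𝓘(ℝ, E) x (c r) e) := by
    filter_upwards [hc.continuousAt.preimage_mem_nhds ((chartAt E x).open_source.mem_nhds hx),
      hc.continuousAt.preimage_mem_nhds ((chartAt E (c s)).open_source.mem_nhds hs)] with r h1 h2 e
    rw [toCoord_eq_trivialization h2, Trivialization.coordChangeL_apply _ _
      ⟨mem_baseSet_of_mem_source h1, mem_baseSet_of_mem_source h2⟩, ofCoord,
      Trivialization.symmL_apply _ (mem_baseSet_of_mem_source h1)]
  have heq : (fun r => toCoord 𝓘(ℝ, E) (c s) (c r) (V r)) =ᶠ[𝓝 s] fun r =>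
      ((trivializationAt E (TangentSpace 𝓘(ℝ, E)) x).coordChangeL
      ℝ (trivializationAt E (TangentSpace 𝓘(ℝ, E)) (c s)) (c r) : E →L[ℝ] E)
        (toCoord 𝓘(ℝ, E) x (c r) (V r)) := by
    filter_upwards [hBe,
      hc.continuousAt.preimage_mem_nhds ((chartAt E x).open_source.mem_nhds hx)] with r h1 h2
    refine Eq.trans ?_ (h1 _).symm
    rw [ofCoord_toCoord_of_mem h2]
  have hd := (hB.hasDerivAt.clm_apply (hV.differentiableAt hx).hasDerivAt).congr_of_eventuallyEq heq
  rw [covDerivAlong, hd.deriv, h0, map_zero, map_zero, map_zero, add_zero, zero_add]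
  refine (congrArg _ (hBe.self_of_nhds _)).trans ?_
  exact ofCoord_toCoord _ _ _

/-- The covariant derivative along a curve, in a chart that need not be centred at the point of
evaluation. -/
theorem toCoord_covDerivAlong (hV : IsDiffAlong c V s) {x : M}
    (hx : c s ∈ (chartAt E x).source) :
    toCoord 𝓘(ℝ, E) x (c s) (covDerivAlong 𝓘(ℝ, E) c V s) =
      deriv (fun r => toCoord 𝓘(ℝ, E) x (c r) (V r)) s +
        christoffelCoord x (extChartAt 𝓘(ℝ, E) x (c s))
          (deriv (fun r => extChartAt 𝓘(ℝ, E) x (c r)) s) (toCoord 𝓘(ℝ, E) x (c s) (V s)) := by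
  have hc := hV.mdifferentiableAt
  set e : E := toCoord 𝓘(ℝ, E) x (c s) (V s) with he
  -- subtract from `V` a field with constant coordinates, so that the rest vanishes at `s`
  have hX := mdifferentiableAt_ofCoord hx e
  have hA : IsDiffAlong c (fun r => ofCoord 𝓘(ℝ, E) x (c r) e) s := IsDiffAlong.restrict hc hX
  have hW : IsDiffAlong c (fun r => V r + (-1 : ℝ) • ofCoord 𝓘(ℝ, E) x (c r) e) s :=
    hV.add (hA.smul (differentiableAt_const _))
  have hsplit : covDerivAlong 𝓘(ℝ, E) c V s = covDerivAlong 𝓘(ℝ, E) c (fun r =>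
      (V r + (-1 : ℝ) • ofCoord 𝓘(ℝ, E) x (c r) e) + ofCoord 𝓘(ℝ, E) x (c r) e) s := by
    congr 1
    funext r
    module
  have h0 : V s + (-1 : ℝ) • ofCoord 𝓘(ℝ, E) x (c s) e = 0 := by
    rw [he, ofCoord_toCoord_of_mem hx]
    module
  have hcoord : (fun r => toCoord 𝓘(ℝ, E) x (c r) (V r + (-1 : ℝ) • ofCoord 𝓘(ℝ, E) x (c r) e))
      =ᶠ[𝓝 s] fun r => toCoord 𝓘(ℝ, E) x (c r) (V r) - e := by
    filter_upwards [hc.continuousAt.preimage_mem_nhds ((chartAt E x).open_source.mem_nhds hx)]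
      with r hr
    rw [map_add, map_smul, toCoord_ofCoord hr]
    module
  rw [hsplit, covDerivAlong_add hW hA, covDerivAlong_of_eq_zero hW h0 hx, map_add,
    toCoord_ofCoord hx, hcoord.deriv_eq, deriv_sub_const]
  congr 1
  rw [covDerivAlong_restrict 𝓘(ℝ, E) c (fun y => ofCoord 𝓘(ℝ, E) x y e) s hc hX,
    ← ofCoord_toCoord_of_mem hx (velocity 𝓘(ℝ, E) c s), leviCivita_ofCoord hx, toCoord_ofCoord hx,
    toCoord_velocity hc hx]

/-- The Levi-Civita connection is metric, along a curve. -/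
theorem IsDiffAlong.hasDerivAt_inner (hV : IsDiffAlong c V s) (hW : IsDiffAlong c W s) :
    HasDerivAt (fun r => (inner ℝ (V r) (W r) : ℝ))
      (inner ℝ (covDerivAlong 𝓘(ℝ, E) c V s) (W s) + inner ℝ (V s) (covDerivAlong 𝓘(ℝ, E) c W s))
      s := by
  have hc := hV.mdifferentiableAt
  have hx := mem_chart_source E (c s)
  set x := c s with hxdef
  set u : ℝ → E := fun r => extChartAt 𝓘(ℝ, E) x (c r) with hu
  set v : ℝ → E := fun r => toCoord 𝓘(ℝ, E) x (c r) (V r) with hv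
  set w : ℝ → E := fun r => toCoord 𝓘(ℝ, E) x (c r) (W r) with hw
  have hus : u s ∈ (extChartAt 𝓘(ℝ, E) x).target :=
    (extChartAt 𝓘(ℝ, E) x).map_source (by rwa [extChartAt_source])
  have hud : DifferentiableAt ℝ u s :=
    ((mdifferentiableAt_extChartAt (I := 𝓘(ℝ, E)) hx).comp s hc).differentiableAt
  have hg : HasDerivAt (fun r => metricCoord x (u r)) _ s :=
    ((contDiffAt_metricCoord hus).differentiableAt (by simp)).hasFDerivAt.comp_hasDerivAt s
      hud.hasDerivAt
  have hd := (hg.clm_apply (hV.differentiableAt hx).hasDerivAt).clm_apply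
    (hW.differentiableAt hx).hasDerivAt
  have heq : (fun r => (inner ℝ (V r) (W r) : ℝ)) =ᶠ[𝓝 s] fun r =>
      metricCoord x (u r) (v r) (w r) := by
    filter_upwards [hc.continuousAt.preimage_mem_nhds ((chartAt E x).open_source.mem_nhds hx)]
      with r hr
    rw [hu, hv, hw]
    beta_reduce
    rw [metricCoord_extChartAt hr, ofCoord_toCoord_of_mem hr, ofCoord_toCoord_of_mem hr]
  refine (hd.congr_of_eventuallyEq heq).congr_deriv ?_
  have hinner : ∀ y z : TangentSpace 𝓘(ℝ, E) (c s), (inner ℝ y z : ℝ) =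
      metricCoord x (u s) (toCoord 𝓘(ℝ, E) x (c s) y) (toCoord 𝓘(ℝ, E) x (c s) z) := by
    intro y z
    rw [hu]
    beta_reduce
    rw [metricCoord_extChartAt hx, ofCoord_toCoord_of_mem hx, ofCoord_toCoord_of_mem hx]
  rw [hinner, hinner, toCoord_covDerivAlong hV hx, toCoord_covDerivAlong hW hx]
  have hsym : ∀ e f, metricCoord x (u s) e f = metricCoord x (u s) f e := fun e f => by
    rw [metricCoord_apply, metricCoord_apply]
    exact real_inner_comm _ _
  have hsymD : ∀ k e f, fderiv ℝ (metricCoord x) (u s) k e f =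
      fderiv ℝ (metricCoord x) (u s) k f e := fun k e f => by
    rw [fderiv_metricCoord_apply hx, fderiv_metricCoord_apply hx]
    congr 1
    simp only [real_inner_comm]
  have h1 := metricCoord_christoffelCoord hus (deriv u s) (v s) (w s)
  have h2 := metricCoord_christoffelCoord hus (deriv u s) (w s) (v s)
  rw [hsym _ (v s)] at h2
  rw [hsymD (deriv u s) (w s) (v s)] at h2
  change (fderiv ℝ (metricCoord x) (u s) (deriv u s) (v s) + metricCoord x (u s) (deriv v s)) (w s)
    + metricCoord x (u s) (v s) (deriv w s) =
    metricCoord x (u s) (deriv v s + christoffelCoord x (u s) (deriv u s) (v s)) (w s) +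
    metricCoord x (u s) (v s) (deriv w s + christoffelCoord x (u s) (deriv u s) (w s))
  rw [map_add, map_add, add_apply, add_apply, h1, h2]
  ring

end AlongCurve

/-! ### Partial derivatives of functions of two variables -/

section PartialDerivatives

variable {F : Type*} [NormedAddCommGroup F] [NormedSpace ℝ F] {φ : ℝ × ℝ → F} {t s : ℝ}

theorem ContDiffAt.hasDerivAt_fst (h : ContDiffAt ℝ 1 φ (t, s)) :
    HasDerivAt (fun r => φ (r, s)) (fderiv ℝ φ (t, s) (1, 0)) t :=
  HasFDerivAt.comp_hasDerivAt (f := fun r : ℝ => (r, s)) t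
    (h.differentiableAt one_ne_zero).hasFDerivAt
    ((hasDerivAt_id t).prodMk (hasDerivAt_const t s))

theorem ContDiffAt.hasDerivAt_snd (h : ContDiffAt ℝ 1 φ (t, s)) :
    HasDerivAt (fun r => φ (t, r)) (fderiv ℝ φ (t, s) (0, 1)) s :=
  HasFDerivAt.comp_hasDerivAt (f := fun r : ℝ => (t, r)) s
    (h.differentiableAt one_ne_zero).hasFDerivAt
    ((hasDerivAt_const s t).prodMk (hasDerivAt_id s))

theorem ContDiffAt.fderiv_const_apply {q : ℝ × ℝ} (h : ContDiffAt ℝ ∞ φ q) (w : ℝ × ℝ) :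
    ContDiffAt ℝ ∞ (fun q => fderiv ℝ φ q w) q :=
  (h.fderiv_right (m := ∞) (by simp)).clm_apply contDiffAt_const

theorem ContDiffAt.fderiv_fderiv_comm {q : ℝ × ℝ} (h : ContDiffAt ℝ ∞ φ q) (w z : ℝ × ℝ) :
    fderiv ℝ (fun q => fderiv ℝ φ q w) q z = fderiv ℝ (fun q => fderiv ℝ φ q z) q w := by
  have h1 : DifferentiableAt ℝ (fderiv ℝ φ) q :=
    (h.fderiv_right (m := ∞) (by simp)).differentiableAt (by simp)
  have h2 : IsSymmSndFDerivAt ℝ φ q := h.isSymmSndFDerivAt (by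
    rw [minSmoothness_of_isRCLikeNormedField]
    exact WithTop.coe_le_coe.2 le_top)
  have h3 : ∀ w z, fderiv ℝ (fun q => fderiv ℝ φ q w) q z = fderiv ℝ (fderiv ℝ φ) q z w := by
    intro w z
    rw [fderiv_clm_apply h1 (differentiableAt_const w)]
    simp
  rw [h3, h3, h2.eq]

end PartialDerivatives

/-! ### Vector fields along a two-parameter map -/

section AlongSurface

variable {E : Type*} [NormedAddCommGroup E] [NormedSpace ℝ E]
  {M : Type*} [TopologicalSpace M] [ChartedSpace E M]
  {γ : ℝ → ℝ → M} {t s : ℝ}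

theorem eventually_nhds_swap {t s : ℝ} {p : ℝ × ℝ → Prop} (h : ∀ᶠ q in 𝓝 (s, t), p q) :
    ∀ᶠ q in 𝓝 (t, s), p (q.2, q.1) :=
  (continuous_swap.tendsto (t, s)).eventually h

theorem contMDiffAt_swap (h : ContMDiffAt 𝓘(ℝ, ℝ × ℝ) 𝓘(ℝ, E) ∞
    (fun q : ℝ × ℝ => γ q.1 q.2) (t, s)) :
    ContMDiffAt 𝓘(ℝ, ℝ × ℝ) 𝓘(ℝ, E) ∞ (fun q : ℝ × ℝ => γ q.2 q.1) (s, t) :=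
  ContMDiffAt.comp (g := fun q : ℝ × ℝ => γ q.1 q.2) (f := fun q : ℝ × ℝ => (q.2, q.1)) (s, t) h
    (contDiffAt_snd.prodMk contDiffAt_fst).contMDiffAt

theorem eventually_mem_source (hγ : ContMDiffAt 𝓘(ℝ, ℝ × ℝ) 𝓘(ℝ, E) ∞
      (fun q : ℝ × ℝ => γ q.1 q.2) (t, s)) {x : M} (hx : γ t s ∈ (chartAt E x).source) :
    ∀ᶠ q in 𝓝 (t, s), γ q.1 q.2 ∈ (chartAt E x).source :=
  hγ.continuousAt.preimage_mem_nhds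
    ((chartAt E x).open_source.mem_nhds (x := γ (t, s).1 (t, s).2) hx)

variable [IsManifold 𝓘(ℝ, E) ∞ M]

/-- The vector field `V` along the two-parameter map `γ` is smooth at `(t, s)`, as a map into the
tangent bundle. -/
def IsSmoothField (γ : ℝ → ℝ → M) (V : (t s : ℝ) → TangentSpace 𝓘(ℝ, E) (γ t s)) (t s : ℝ) :
    Prop :=
  ContMDiffAt 𝓘(ℝ, ℝ × ℝ) 𝓘(ℝ, E).tangent ∞
    (fun q : ℝ × ℝ => (⟨γ q.1 q.2, V q.1 q.2⟩ : TangentBundle 𝓘(ℝ, E) M)) (t, s)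

variable {V W : (t s : ℝ) → TangentSpace 𝓘(ℝ, E) (γ t s)}

theorem isSmoothField_iff {x : M} (hx : γ t s ∈ (chartAt E x).source) : IsSmoothField γ V t s ↔
    ContMDiffAt 𝓘(ℝ, ℝ × ℝ) 𝓘(ℝ, E) ∞ (fun q : ℝ × ℝ => γ q.1 q.2) (t, s) ∧
      ContDiffAt ℝ ∞ (fun q : ℝ × ℝ => toCoord 𝓘(ℝ, E) x (γ q.1 q.2) (V q.1 q.2)) (t, s) := by
  have : ContMDiffVectorBundle ∞ E (TangentSpace 𝓘(ℝ, E) : M → Type _) 𝓘(ℝ, E) := inferInstance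
  have hmem : (⟨γ t s, V t s⟩ : TangentBundle 𝓘(ℝ, E) M) ∈
      (trivializationAt E (TangentSpace 𝓘(ℝ, E)) x).source := by
    rw [Trivialization.mem_source]
    exact mem_baseSet_of_mem_source hx
  refine ((trivializationAt E (TangentSpace 𝓘(ℝ, E)) x).contMDiffAt_iff (IB := 𝓘(ℝ, E))
    (x₀ := (t, s)) (f := fun q : ℝ × ℝ => (⟨γ q.1 q.2, V q.1 q.2⟩ : TangentBundle 𝓘(ℝ, E) M))
    hmem).trans ?_
  refine and_congr_right fun hc => ?_
  rw [contMDiffAt_iff_contDiffAt]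
  have heq : (fun q : ℝ × ℝ => toCoord 𝓘(ℝ, E) x (γ q.1 q.2) (V q.1 q.2)) =ᶠ[𝓝 (t, s)]
      fun q => (trivializationAt E (TangentSpace 𝓘(ℝ, E)) x ⟨γ q.1 q.2, V q.1 q.2⟩).2 := by
    filter_upwards [hc.continuousAt.preimage_mem_nhds
      ((chartAt E x).open_source.mem_nhds (x := γ (t, s).1 (t, s).2) hx)] with r hr
    exact toCoord_eq_trivialization hr _
  exact ⟨fun h => h.congr_of_eventuallyEq heq, fun h => h.congr_of_eventuallyEq heq.symm⟩

theorem IsSmoothField.contMDiffAt (h : IsSmoothField γ V t s) :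
    ContMDiffAt 𝓘(ℝ, ℝ × ℝ) 𝓘(ℝ, E) ∞ (fun q : ℝ × ℝ => γ q.1 q.2) (t, s) :=
  ((isSmoothField_iff (mem_chart_source E _)).1 h).1

theorem IsSmoothField.contDiffAt (h : IsSmoothField γ V t s) {x : M}
    (hx : γ t s ∈ (chartAt E x).source) :
    ContDiffAt ℝ ∞ (fun q : ℝ × ℝ => toCoord 𝓘(ℝ, E) x (γ q.1 q.2) (V q.1 q.2)) (t, s) :=
  ((isSmoothField_iff hx).1 h).2

theorem IsSmoothField.swap (h : IsSmoothField γ V t s) :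
    IsSmoothField (fun s t => γ t s) (fun s t => V t s) s t :=
  ContMDiffAt.comp (g := fun q : ℝ × ℝ => (⟨γ q.1 q.2, V q.1 q.2⟩ : TangentBundle 𝓘(ℝ, E) M))
    (f := fun q : ℝ × ℝ => (q.2, q.1)) (s, t) h
    (contDiffAt_snd.prodMk contDiffAt_fst).contMDiffAt

theorem IsSmoothField.eventually_isDiffAlong (h : IsSmoothField γ V t s) :
    ∀ᶠ q in 𝓝 (t, s), IsDiffAlong (γ q.1) (V q.1) q.2 := by
  have h1 : ContMDiffAt 𝓘(ℝ, ℝ × ℝ) 𝓘(ℝ, E).tangent 1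
    (fun q : ℝ × ℝ => (⟨γ q.1 q.2, V q.1 q.2⟩ : TangentBundle 𝓘(ℝ, E) M)) (t, s) :=
    ContMDiffAt.of_le h (by simp)
  have : IsManifold 𝓘(ℝ, E).tangent 1 (TangentBundle 𝓘(ℝ, E) M) := inferInstance
  filter_upwards [contMDiffAt_iff_contMDiffAt_nhds (by simp) |>.1 h1] with q hq
  have hq' : MDifferentiableAt 𝓘(ℝ, ℝ × ℝ) 𝓘(ℝ, E).tangent
    (fun q : ℝ × ℝ => (⟨γ q.1 q.2, V q.1 q.2⟩ : TangentBundle 𝓘(ℝ, E) M)) (q.1, q.2) :=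
    ContMDiffAt.mdifferentiableAt hq one_ne_zero
  have hi : MDifferentiableAt 𝓘(ℝ, ℝ) 𝓘(ℝ, ℝ × ℝ) (fun r : ℝ => (q.1, r)) q.2 :=
    ((differentiableAt_const q.1).prodMk differentiableAt_id).mdifferentiableAt
  exact MDifferentiableAt.comp (f := fun r : ℝ => (q.1, r)) q.2 hq' hi

theorem IsSmoothField.isDiffAlong (h : IsSmoothField γ V t s) : IsDiffAlong (γ t) (V t) s :=
  h.eventually_isDiffAlong.self_of_nhds

theorem IsSmoothField.isDiffAlong_fst (h : IsSmoothField γ V t s) :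
    IsDiffAlong (fun t => γ t s) (fun t => V t s) t :=
  h.swap.isDiffAlong

theorem IsSmoothField.add (hV : IsSmoothField γ V t s) (hW : IsSmoothField γ W t s) :
    IsSmoothField γ (fun t s => V t s + W t s) t s := by
  have hx := mem_chart_source E (γ t s)
  refine (isSmoothField_iff hx).2 ⟨hV.contMDiffAt, ?_⟩
  simp only [map_add]
  exact (hV.contDiffAt hx).add (hW.contDiffAt hx)

theorem IsSmoothField.smul {f : ℝ → ℝ → ℝ} (hf : ContDiffAt ℝ ∞ (fun q : ℝ × ℝ => f q.1 q.2) (t, s))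
    (hV : IsSmoothField γ V t s) : IsSmoothField γ (fun t s => f t s • V t s) t s := by
  have hx := mem_chart_source E (γ t s)
  refine (isSmoothField_iff hx).2 ⟨hV.contMDiffAt, ?_⟩
  simp only [map_smul]
  exact hf.smul (hV.contDiffAt hx)

theorem contDiffAt_extChartAt_comp
    (hγ : ContMDiffAt 𝓘(ℝ, ℝ × ℝ) 𝓘(ℝ, E) ∞ (fun q : ℝ × ℝ => γ q.1 q.2) (t, s)) {x : M}
    (hx : γ t s ∈ (chartAt E x).source) :
    ContDiffAt ℝ ∞ (fun q : ℝ × ℝ => extChartAt 𝓘(ℝ, E) x (γ q.1 q.2)) (t, s) :=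
  (ContMDiffAt.comp (g := extChartAt 𝓘(ℝ, E) x) (t, s) (contMDiffAt_extChartAt' hx) hγ).contDiffAt

theorem eventually_mdifferentiableAt_snd
    (hγ : ContMDiffAt 𝓘(ℝ, ℝ × ℝ) 𝓘(ℝ, E) ∞ (fun q : ℝ × ℝ => γ q.1 q.2) (t, s)) :
    ∀ᶠ q in 𝓝 (t, s), MDifferentiableAt 𝓘(ℝ, ℝ) 𝓘(ℝ, E) (γ q.1) q.2 := by
  have h1 : ContMDiffAt 𝓘(ℝ, ℝ × ℝ) 𝓘(ℝ, E) 1 (fun q : ℝ × ℝ => γ q.1 q.2) (t, s) :=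
    ContMDiffAt.of_le hγ (by simp)
  have : IsManifold 𝓘(ℝ, E) 1 M := inferInstance
  filter_upwards [contMDiffAt_iff_contMDiffAt_nhds (by simp) |>.1 h1] with q hq
  have hq' : MDifferentiableAt 𝓘(ℝ, ℝ × ℝ) 𝓘(ℝ, E) (fun q : ℝ × ℝ => γ q.1 q.2) (q.1, q.2) :=
    ContMDiffAt.mdifferentiableAt hq one_ne_zero
  have hi : MDifferentiableAt 𝓘(ℝ, ℝ) 𝓘(ℝ, ℝ × ℝ) (fun r : ℝ => (q.1, r)) q.2 :=
    ((differentiableAt_const q.1).prodMk differentiableAt_id).mdifferentiableAt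
  exact MDifferentiableAt.comp (f := fun r : ℝ => (q.1, r)) q.2 hq' hi

/-- In a chart, the velocity of the curves `γ t` is the partial derivative in the second variable. -/
theorem eventually_toCoord_velocity
    (hγ : ContMDiffAt 𝓘(ℝ, ℝ × ℝ) 𝓘(ℝ, E) ∞ (fun q : ℝ × ℝ => γ q.1 q.2) (t, s)) {x : M}
    (hx : γ t s ∈ (chartAt E x).source) :
    ∀ᶠ q in 𝓝 (t, s), toCoord 𝓘(ℝ, E) x (γ q.1 q.2) (velocity 𝓘(ℝ, E) (γ q.1) q.2) =
      fderiv ℝ (fun q : ℝ × ℝ => extChartAt 𝓘(ℝ, E) x (γ q.1 q.2)) q (0, 1) := by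
  have h1 : ContDiffAt ℝ 1 (fun q : ℝ × ℝ => extChartAt 𝓘(ℝ, E) x (γ q.1 q.2)) (t, s) :=
    (contDiffAt_extChartAt_comp hγ hx).of_le (by simp)
  filter_upwards [eventually_mdifferentiableAt_snd hγ, eventually_mem_source hγ hx,
    h1.eventually (by simp)] with q h2 h3 h4
  rw [toCoord_velocity h2 h3]
  exact (ContDiffAt.hasDerivAt_snd (φ := fun q : ℝ × ℝ => extChartAt 𝓘(ℝ, E) x (γ q.1 q.2))
    h4).deriv

theorem isSmoothField_velocity
    (hγ : ContMDiffAt 𝓘(ℝ, ℝ × ℝ) 𝓘(ℝ, E) ∞ (fun q : ℝ × ℝ => γ q.1 q.2) (t, s)) :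
    IsSmoothField γ (fun t s => velocity 𝓘(ℝ, E) (γ t) s) t s := by
  have hx := mem_chart_source E (γ t s)
  refine (isSmoothField_iff hx).2 ⟨hγ, ?_⟩
  exact (ContDiffAt.fderiv_const_apply (contDiffAt_extChartAt_comp hγ hx) (0, 1)
    ).congr_of_eventuallyEq (eventually_toCoord_velocity hγ hx)

theorem isSmoothField_velocity_fst
    (hγ : ContMDiffAt 𝓘(ℝ, ℝ × ℝ) 𝓘(ℝ, E) ∞ (fun q : ℝ × ℝ => γ q.1 q.2) (t, s)) :
    IsSmoothField γ (fun t s => velocity 𝓘(ℝ, E) (fun t => γ t s) t) t s :=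
  (isSmoothField_velocity (contMDiffAt_swap hγ)).swap

theorem eventually_toCoord_velocity_fst
    (hγ : ContMDiffAt 𝓘(ℝ, ℝ × ℝ) 𝓘(ℝ, E) ∞ (fun q : ℝ × ℝ => γ q.1 q.2) (t, s)) {x : M}
    (hx : γ t s ∈ (chartAt E x).source) :
    ∀ᶠ q in 𝓝 (t, s), toCoord 𝓘(ℝ, E) x (γ q.1 q.2) (velocity 𝓘(ℝ, E) (fun t => γ t q.2) q.1) =
      fderiv ℝ (fun q : ℝ × ℝ => extChartAt 𝓘(ℝ, E) x (γ q.1 q.2)) q (1, 0) := by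
  have h1 : ContDiffAt ℝ 1 (fun q : ℝ × ℝ => extChartAt 𝓘(ℝ, E) x (γ q.1 q.2)) (t, s) :=
    (contDiffAt_extChartAt_comp hγ hx).of_le (by simp)
  filter_upwards [eventually_nhds_swap (eventually_mdifferentiableAt_snd
      (γ := fun s t => γ t s) (contMDiffAt_swap hγ)),
    eventually_mem_source hγ hx, h1.eventually (by simp)] with q h2 h3 h4
  rw [toCoord_velocity h2 h3]
  exact (ContDiffAt.hasDerivAt_fst (φ := fun q : ℝ × ℝ => extChartAt 𝓘(ℝ, E) x (γ q.1 q.2))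
    h4).deriv

theorem toCoord_injective {x y : M} (hy : y ∈ (chartAt E x).source) :
    Function.Injective (toCoord 𝓘(ℝ, E) x y) :=
  Function.LeftInverse.injective (g := ofCoord 𝓘(ℝ, E) x y) (ofCoord_toCoord_of_mem hy)

theorem mlieBracket_frozen [FiniteDimensional ℝ E] (x : M) (u v : TangentSpace 𝓘(ℝ, E) x) :
    VectorField.mlieBracket 𝓘(ℝ, E) (frozen 𝓘(ℝ, E) u) (frozen 𝓘(ℝ, E) v) x = 0 :=
  haveI : CompleteSpace E := FiniteDimensional.complete ℝ E
  mlieBracket_ofCoord (mem_chart_source E x) _ _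

variable [RiemannianBundle (fun x : M => TangentSpace 𝓘(ℝ, E) x)]

section
variable [IsContMDiffRiemannianBundle 𝓘(ℝ, E) ∞ E (fun x : M => TangentSpace 𝓘(ℝ, E) x)]

theorem IsSmoothField.contDiffAt_inner (hV : IsSmoothField γ V t s) (hW : IsSmoothField γ W t s) :
    ContDiffAt ℝ ∞ (fun q : ℝ × ℝ => (inner ℝ (V q.1 q.2) (W q.1 q.2) : ℝ)) (t, s) :=
  have hV' : ContMDiffAt 𝓘(ℝ, ℝ × ℝ) (𝓘(ℝ, E).prod 𝓘(ℝ, E)) ∞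
      (fun q : ℝ × ℝ => TotalSpace.mk' E (γ q.1 q.2) (V q.1 q.2)) (t, s) := hV
  have hW' : ContMDiffAt 𝓘(ℝ, ℝ × ℝ) (𝓘(ℝ, E).prod 𝓘(ℝ, E)) ∞
      (fun q : ℝ × ℝ => TotalSpace.mk' E (γ q.1 q.2) (W q.1 q.2)) (t, s) := hW
  have h : ContMDiffAt 𝓘(ℝ, ℝ × ℝ) 𝓘(ℝ, ℝ) ∞
      (fun q : ℝ × ℝ => (inner ℝ (V q.1 q.2) (W q.1 q.2) : ℝ)) (t, s) :=
    ContMDiffAt.inner_bundle (IB := 𝓘(ℝ, E)) (F := E) (E := fun y : M => TangentSpace 𝓘(ℝ, E) y)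
      (b := fun q : ℝ × ℝ => γ q.1 q.2) (v := fun q => V q.1 q.2) (w := fun q => W q.1 q.2)
      hV' hW'
  h.contDiffAt

end

variable [FiniteDimensional ℝ E]
  [IsContMDiffRiemannianBundle 𝓘(ℝ, E) ∞ E (fun x : M => TangentSpace 𝓘(ℝ, E) x)]

/-- The covariant derivative `∇_s V` of a field along a two-parameter map. -/
noncomputable def covSnd (γ : ℝ → ℝ → M) (V : (t s : ℝ) → TangentSpace 𝓘(ℝ, E) (γ t s)) (t s : ℝ) :
    TangentSpace 𝓘(ℝ, E) (γ t s) :=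
  covDerivAlong 𝓘(ℝ, E) (γ t) (V t) s

/-- The covariant derivative `∇_t V` of a field along a two-parameter map. -/
noncomputable def covFst (γ : ℝ → ℝ → M) (V : (t s : ℝ) → TangentSpace 𝓘(ℝ, E) (γ t s)) (t s : ℝ) :
    TangentSpace 𝓘(ℝ, E) (γ t s) :=
  covDerivAlong 𝓘(ℝ, E) (fun t => γ t s) (fun t => V t s) t

theorem IsSmoothField.eventually_toCoord_covSnd (hV : IsSmoothField γ V t s) {x : M}
    (hx : γ t s ∈ (chartAt E x).source) :
    ∀ᶠ q in 𝓝 (t, s), toCoord 𝓘(ℝ, E) x (γ q.1 q.2) (covSnd γ V q.1 q.2) =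
      fderiv ℝ (fun q : ℝ × ℝ => toCoord 𝓘(ℝ, E) x (γ q.1 q.2) (V q.1 q.2)) q (0, 1) +
      christoffelCoord x (extChartAt 𝓘(ℝ, E) x (γ q.1 q.2))
        (fderiv ℝ (fun q : ℝ × ℝ => extChartAt 𝓘(ℝ, E) x (γ q.1 q.2)) q (0, 1))
        (toCoord 𝓘(ℝ, E) x (γ q.1 q.2) (V q.1 q.2)) := by
  have h1 : ContDiffAt ℝ 1 (fun q : ℝ × ℝ => extChartAt 𝓘(ℝ, E) x (γ q.1 q.2)) (t, s) :=
    (contDiffAt_extChartAt_comp hV.contMDiffAt hx).of_le (by simp)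
  have h2 : ContDiffAt ℝ 1 (fun q : ℝ × ℝ => toCoord 𝓘(ℝ, E) x (γ q.1 q.2) (V q.1 q.2)) (t, s) :=
    (hV.contDiffAt hx).of_le (by simp)
  filter_upwards [hV.eventually_isDiffAlong, eventually_mem_source hV.contMDiffAt hx,
    h1.eventually (by simp), h2.eventually (by simp)] with q h3 h4 h5 h6
  rw [covSnd, toCoord_covDerivAlong h3 h4]
  rw [(ContDiffAt.hasDerivAt_snd (φ := fun q : ℝ × ℝ => extChartAt 𝓘(ℝ, E) x (γ q.1 q.2)) h5).deriv,
    (ContDiffAt.hasDerivAt_snd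
      (φ := fun q : ℝ × ℝ => toCoord 𝓘(ℝ, E) x (γ q.1 q.2) (V q.1 q.2)) h6).deriv]

theorem IsSmoothField.eventually_toCoord_covFst (hV : IsSmoothField γ V t s) {x : M}
    (hx : γ t s ∈ (chartAt E x).source) :
    ∀ᶠ q in 𝓝 (t, s), toCoord 𝓘(ℝ, E) x (γ q.1 q.2) (covFst γ V q.1 q.2) =
      fderiv ℝ (fun q : ℝ × ℝ => toCoord 𝓘(ℝ, E) x (γ q.1 q.2) (V q.1 q.2)) q (1, 0) +
      christoffelCoord x (extChartAt 𝓘(ℝ, E) x (γ q.1 q.2))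
        (fderiv ℝ (fun q : ℝ × ℝ => extChartAt 𝓘(ℝ, E) x (γ q.1 q.2)) q (1, 0))
        (toCoord 𝓘(ℝ, E) x (γ q.1 q.2) (V q.1 q.2)) := by
  have h1 : ContDiffAt ℝ 1 (fun q : ℝ × ℝ => extChartAt 𝓘(ℝ, E) x (γ q.1 q.2)) (t, s) :=
    (contDiffAt_extChartAt_comp hV.contMDiffAt hx).of_le (by simp)
  have h2 : ContDiffAt ℝ 1 (fun q : ℝ × ℝ => toCoord 𝓘(ℝ, E) x (γ q.1 q.2) (V q.1 q.2)) (t, s) :=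
    (hV.contDiffAt hx).of_le (by simp)
  filter_upwards [eventually_nhds_swap hV.swap.eventually_isDiffAlong,
    eventually_mem_source hV.contMDiffAt hx, h1.eventually (by simp), h2.eventually (by simp)]
    with q h3 h4 h5 h6
  rw [covFst, toCoord_covDerivAlong h3 h4]
  rw [(ContDiffAt.hasDerivAt_fst (φ := fun q : ℝ × ℝ => extChartAt 𝓘(ℝ, E) x (γ q.1 q.2)) h5).deriv,
    (ContDiffAt.hasDerivAt_fst
      (φ := fun q : ℝ × ℝ => toCoord 𝓘(ℝ, E) x (γ q.1 q.2) (V q.1 q.2)) h6).deriv]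

theorem IsSmoothField.covSnd (hV : IsSmoothField γ V t s) :
    IsSmoothField γ (PBiharmonic.covSnd γ V) t s := by
  have hx := mem_chart_source E (γ t s)
  have hu := contDiffAt_extChartAt_comp hV.contMDiffAt hx
  have hv := hV.contDiffAt hx
  refine (isSmoothField_iff hx).2 ⟨hV.contMDiffAt, ?_⟩
  refine ContDiffAt.congr_of_eventuallyEq ?_ (hV.eventually_toCoord_covSnd hx)
  have hΓ : ContDiffAt ℝ ∞ (fun q : ℝ × ℝ => christoffelCoord (γ t s)
      (extChartAt 𝓘(ℝ, E) (γ t s) (γ q.1 q.2))) (t, s) :=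
    ContDiffAt.comp (g := christoffelCoord (γ t s)) (t, s) (contDiffAt_christoffelCoord
      ((extChartAt 𝓘(ℝ, E) (γ t s)).map_source (by rwa [extChartAt_source]))) hu
  exact (ContDiffAt.fderiv_const_apply hv (0, 1)).add
    ((hΓ.clm_apply (ContDiffAt.fderiv_const_apply hu (0, 1))).clm_apply hv)

theorem IsSmoothField.covFst (hV : IsSmoothField γ V t s) :
    IsSmoothField γ (PBiharmonic.covFst γ V) t s :=
  hV.swap.covSnd.swap

theorem christoffelCoord_comm {x : M} {u : E} (hu : u ∈ (extChartAt 𝓘(ℝ, E) x).target) (e f : E) :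
    christoffelCoord x u e f = christoffelCoord x u f e := by
  have hy : (extChartAt 𝓘(ℝ, E) x).symm u ∈ (chartAt E x).source := by
    simpa using (extChartAt 𝓘(ℝ, E) x).map_target hu
  obtain ⟨A, hA⟩ := isInvertible_metricCoord hu
  have hinj : Function.Injective (metricCoord x u) := by
    rw [← hA]
    exact A.injective
  refine hinj (ContinuousLinearMap.ext fun k => ?_)
  have hsymD : fderiv ℝ (metricCoord x) u k e f = fderiv ℝ (metricCoord x) u k f e := by
    rw [← (extChartAt 𝓘(ℝ, E) x).right_inv hu, fderiv_metricCoord_apply hy,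
      fderiv_metricCoord_apply hy]
    congr 1
    simp only [real_inner_comm]
  rw [metricCoord_christoffelCoord hu, metricCoord_christoffelCoord hu, hsymD]
  ring

/-- The connection is torsion-free, along a two-parameter map. -/
theorem covSnd_velocity_fst
    (hγ : ContMDiffAt 𝓘(ℝ, ℝ × ℝ) 𝓘(ℝ, E) ∞ (fun q : ℝ × ℝ => γ q.1 q.2) (t, s)) :
    covSnd γ (fun t s => velocity 𝓘(ℝ, E) (fun t => γ t s) t) t s =
      covFst γ (fun t s => velocity 𝓘(ℝ, E) (γ t) s) t s := by
  have hx := mem_chart_source E (γ t s)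
  have hus : extChartAt 𝓘(ℝ, E) (γ t s) (γ t s) ∈ (extChartAt 𝓘(ℝ, E) (γ t s)).target :=
    mem_extChartAt_target _
  have h1 := ((isSmoothField_velocity_fst hγ).eventually_toCoord_covSnd hx).self_of_nhds
  have h2 := ((isSmoothField_velocity hγ).eventually_toCoord_covFst hx).self_of_nhds
  have e1 := eventually_toCoord_velocity hγ hx
  have e2 := eventually_toCoord_velocity_fst hγ hx
  rw [EventuallyEq.fderiv_eq e2, e2.self_of_nhds] at h1
  rw [EventuallyEq.fderiv_eq e1, e1.self_of_nhds] at h2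
  refine toCoord_injective hx (h1.trans (Eq.trans ?_ h2.symm))
  rw [ContDiffAt.fderiv_fderiv_comm (contDiffAt_extChartAt_comp hγ hx) (1, 0) (0, 1)]
  congr 1
  exact christoffelCoord_comm hus _ _

theorem toCoord_leviCivita_ofCoord {x y : M} (hy : y ∈ (chartAt E x).source) (e f : E) :
    toCoord 𝓘(ℝ, E) x y
      (leviCivita 𝓘(ℝ, E) (fun z => ofCoord 𝓘(ℝ, E) x z f) y (ofCoord 𝓘(ℝ, E) x y e)) =
      christoffelCoord x (extChartAt 𝓘(ℝ, E) x y) e f := by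
  rw [leviCivita_ofCoord hy, toCoord_ofCoord hy]

theorem toCoord_christoffel (x : M) (u v : TangentSpace 𝓘(ℝ, E) x) :
    toCoord 𝓘(ℝ, E) x x (christoffel 𝓘(ℝ, E) x u v) =
      christoffelCoord x (extChartAt 𝓘(ℝ, E) x x) (toCoord 𝓘(ℝ, E) x x u)
        (toCoord 𝓘(ℝ, E) x x v) := by
  rw [← leviCivita_frozen, ← toCoord_leviCivita_ofCoord (mem_chart_source E x), ofCoord_toCoord]
  rfl

/-- The second covariant derivative of coordinate fields, in coordinates. -/
theorem toCoord_leviCivita_leviCivita (x : M) (u v w : TangentSpace 𝓘(ℝ, E) x) :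
    toCoord 𝓘(ℝ, E) x x (leviCivita 𝓘(ℝ, E) (fun y => leviCivita 𝓘(ℝ, E) (frozen 𝓘(ℝ, E) w) y
      (frozen 𝓘(ℝ, E) v y)) x u) =
    fderiv ℝ (christoffelCoord x) (extChartAt 𝓘(ℝ, E) x x) (toCoord 𝓘(ℝ, E) x x u)
      (toCoord 𝓘(ℝ, E) x x v) (toCoord 𝓘(ℝ, E) x x w) +
    christoffelCoord x (extChartAt 𝓘(ℝ, E) x x) (toCoord 𝓘(ℝ, E) x x u)
      (christoffelCoord x (extChartAt 𝓘(ℝ, E) x x) (toCoord 𝓘(ℝ, E) x x v)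
        (toCoord 𝓘(ℝ, E) x x w)) := by
  have hx := mem_chart_source E x
  have hu : extChartAt 𝓘(ℝ, E) x x ∈ (extChartAt 𝓘(ℝ, E) x).target := mem_extChartAt_target x
  set e : E := toCoord 𝓘(ℝ, E) x x v
  set f : E := toCoord 𝓘(ℝ, E) x x w
  change toCoord 𝓘(ℝ, E) x x (leviCivitaFun 𝓘(ℝ, E) (fun y => leviCivita 𝓘(ℝ, E)
    (fun z => ofCoord 𝓘(ℝ, E) x z f) y (ofCoord 𝓘(ℝ, E) x y e)) x u) = _
  have h1 : (fun y : M => toCoord 𝓘(ℝ, E) x y (leviCivita 𝓘(ℝ, E)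
      (fun z => ofCoord 𝓘(ℝ, E) x z f) y (ofCoord 𝓘(ℝ, E) x y e))) =ᶠ[𝓝 x]
      fun y => christoffelCoord x (extChartAt 𝓘(ℝ, E) x y) e f := by
    filter_upwards [(chartAt E x).open_source.mem_nhds hx] with y hy
    exact toCoord_leviCivita_ofCoord hy e f
  have h2 : HasFDerivAt (fun z => christoffelCoord x z e f)
      (((fderiv ℝ (christoffelCoord x) (extChartAt 𝓘(ℝ, E) x x)).flip e).flip f)
      (extChartAt 𝓘(ℝ, E) x x) := by
    refine (((((contDiffAt_christoffelCoord hu).differentiableAt (by simp)).hasFDerivAt).clm_apply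
      (hasFDerivAt_const e _)).clm_apply (hasFDerivAt_const f _)).congr_fderiv ?_
    ext z
    simp
  have h3 : mvfderiv 𝓘(ℝ, E) (fun y : M => toCoord 𝓘(ℝ, E) x y (leviCivita 𝓘(ℝ, E)
      (fun z => ofCoord 𝓘(ℝ, E) x z f) y (ofCoord 𝓘(ℝ, E) x y e))) x u =
      fderiv ℝ (christoffelCoord x) (extChartAt 𝓘(ℝ, E) x x) (toCoord 𝓘(ℝ, E) x x u) e f := by
    have h4 := mfderiv_comp (I := 𝓘(ℝ, E)) (I' := 𝓘(ℝ, E)) (I'' := 𝓘(ℝ, E)) x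
      (g := fun z => christoffelCoord x z e f)
      h2.differentiableAt.mdifferentiableAt (mdifferentiableAt_extChartAt (I := 𝓘(ℝ, E)) hx)
    rw [mfderiv_eq_fderiv, h2.fderiv, ← toCoord_eq_mfderiv hx] at h4
    have h5 := congrArg (fun l => l u) (h1.mfderiv_eq (I := 𝓘(ℝ, E)) (I' := 𝓘(ℝ, E)))
    exact h5.trans (congrArg (fun l => l u) h4)
  rw [leviCivitaFun, add_apply, map_add, ContinuousLinearMap.comp_apply, h3, toCoord_ofCoord hx]
  congr 1
  refine (toCoord_christoffel x u _).trans ?_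
  rw [toCoord_leviCivita_ofCoord hx]

/-- Covariant derivatives along a two-parameter map commute up to curvature. -/
theorem covFst_covSnd_sub (hV : IsSmoothField γ V t s) :
    covFst γ (covSnd γ V) t s - covSnd γ (covFst γ V) t s =
      curvature 𝓘(ℝ, E) (γ t s) (velocity 𝓘(ℝ, E) (fun t => γ t s) t) (velocity 𝓘(ℝ, E) (γ t) s)
        (V t s) := by
  have hx := mem_chart_source E (γ t s)
  have hγ := hV.contMDiffAt
  set x := γ t s with hxdef
  have hus : extChartAt 𝓘(ℝ, E) x x ∈ (extChartAt 𝓘(ℝ, E) x).target := mem_extChartAt_target _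
  set u : ℝ × ℝ → E := fun q => extChartAt 𝓘(ℝ, E) x (γ q.1 q.2) with hudef
  set v : ℝ × ℝ → E := fun q => toCoord 𝓘(ℝ, E) x (γ q.1 q.2) (V q.1 q.2) with hvdef
  have hu : ContDiffAt ℝ ∞ u (t, s) := contDiffAt_extChartAt_comp hγ hx
  have hv : ContDiffAt ℝ ∞ v (t, s) := hV.contDiffAt hx
  have hΓ := (contDiffAt_christoffelCoord hus).differentiableAt (by simp)
  -- the derivative of the coordinates of `∇V` in a direction `w`, for `∇` in the direction `z`
  have key : ∀ z w : ℝ × ℝ, HasFDerivAt (fun q => fderiv ℝ v q z +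
      christoffelCoord x (u q) (fderiv ℝ u q z) (v q)) _ (t, s) := fun z w =>
    ((ContDiffAt.fderiv_const_apply hv z).differentiableAt (by simp)).hasFDerivAt.add
      (((HasFDerivAt.comp (g := christoffelCoord x) (t, s) hΓ.hasFDerivAt
        (hu.differentiableAt (by simp)).hasFDerivAt).clm_apply
        ((ContDiffAt.fderiv_const_apply hu z).differentiableAt (by simp)).hasFDerivAt).clm_apply
        (hv.differentiableAt (by simp)).hasFDerivAt)
  have e1 := hV.eventually_toCoord_covSnd hx
  have e2 := hV.eventually_toCoord_covFst hx
  have h1 := (hV.covSnd.eventually_toCoord_covFst hx).self_of_nhds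
  have h2 := (hV.covFst.eventually_toCoord_covSnd hx).self_of_nhds
  rw [EventuallyEq.fderiv_eq e1, e1.self_of_nhds, (key (0, 1) (1, 0)).fderiv] at h1
  rw [EventuallyEq.fderiv_eq e2, e2.self_of_nhds, (key (1, 0) (0, 1)).fderiv] at h2
  refine toCoord_injective hx ?_
  rw [map_sub]
  refine (congrArg₂ (· - ·) h1 h2).trans ?_
  rw [curvature, curvatureField, mlieBracket_frozen, map_zero, sub_zero, map_sub, frozen_self,
    frozen_self, toCoord_leviCivita_leviCivita, toCoord_leviCivita_leviCivita]
  rw [(eventually_toCoord_velocity hγ hx).self_of_nhds,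
    (eventually_toCoord_velocity_fst hγ hx).self_of_nhds]
  have hc := ContDiffAt.fderiv_fderiv_comm hu (1, 0) (0, 1)
  have hc' := ContDiffAt.fderiv_fderiv_comm hv (1, 0) (0, 1)
  simp only [add_apply, ContinuousLinearMap.comp_apply, ContinuousLinearMap.flip_apply, hc, hc',
    map_add]
  simp only [hudef, hvdef, hxdef, Function.comp_apply]
  abel

end AlongSurface

/-! ### Powers of a norm -/

section Powers

/-- At a zero of `g` the product rule needs only the continuity of `f`. -/
theorem hasDerivAt_smul_of_eq_zero {F : Type*} [NormedAddCommGroup F] [NormedSpace ℝ F]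
    {f : ℝ → ℝ} {g : ℝ → F} {g' : F} {x : ℝ} (hf : ContinuousAt f x) (hg : HasDerivAt g g' x)
    (h0 : g x = 0) : HasDerivAt (fun y => f y • g y) (f x • g') x := by
  rw [hasDerivAt_iff_tendsto_slope] at hg ⊢
  refine ((hf.tendsto.mono_left nhdsWithin_le_nhds).smul hg).congr fun y => ?_
  simp only [slope, h0, smul_zero, vsub_eq_sub, sub_zero]
  exact smul_comm _ _ _

theorem rpow_eq_sq_rpow {x : ℝ} (hx : 0 ≤ x) (q : ℝ) : x ^ q = (x ^ 2) ^ (q / 2) := by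
  rw [← Real.rpow_natCast, ← Real.rpow_mul hx]
  congr 1
  push_cast
  ring

theorem rpow_mul_sq {x : ℝ} (hx : 0 < x) (q : ℝ) : x ^ (q - 4) * x ^ 2 = x ^ (q - 2) := by
  rw [← Real.rpow_natCast, ← Real.rpow_add hx]
  congr 1
  push_cast
  ring

/-- The singular factor `x ^ (p - 4)` is compensated by two factors of size `O(x)`. -/
theorem abs_rpow_mul_mul_le {x y z Y Z : ℝ} (hx : 0 ≤ x) (hy : |y| ≤ x * Y) (hz : |z| ≤ x * Z)
    (hY : 0 ≤ Y) (hZ : 0 ≤ Z) (q : ℝ) : |x ^ (q - 4) * (y * z)| ≤ x ^ (q - 2) * (Y * Z) := by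
  rcases hx.eq_or_lt with rfl | hx
  · have hy0 : y = 0 := abs_nonpos_iff.1 (by simpa using hy)
    subst hy0
    rcases eq_or_ne (q - 2) 0 with h | h
    · rw [h]
      simpa using mul_nonneg hY hZ
    · rw [Real.zero_rpow h]
      simp
  · rw [abs_mul, abs_mul, abs_of_nonneg (Real.rpow_nonneg hx.le _), ← rpow_mul_sq hx]
    calc x ^ (q - 4) * (|y| * |z|) ≤ x ^ (q - 4) * ((x * Y) * (x * Z)) := by
          gcongr
      _ = _ := by ring

variable {p t : ℝ} {ρ N A : ℝ → ℝ} {A' : ℝ}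

theorem hasDerivAt_rpow_norm (hρ : ∀ t, 0 ≤ ρ t) (hN : ∀ t, N t = ρ t ^ 2)
    (hd : HasDerivAt N (2 * A t) t) (hp : 2 ≤ p ∨ ρ t ≠ 0) :
    HasDerivAt (fun t => ρ t ^ p) (p * (ρ t ^ (p - 2) * A t)) t := by
  have h : (fun t => ρ t ^ p) = fun t => N t ^ (p / 2) := by
    funext t
    rw [rpow_eq_sq_rpow (hρ t), hN]
  rw [h]
  refine (hd.rpow_const (p := p / 2) ?_).congr_deriv ?_
  · rcases hp with hp | hp
    · right; linarith
    · left; rw [hN]; exact pow_ne_zero 2 hp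
  · rw [rpow_eq_sq_rpow (hρ t), hN, show p / 2 - 1 = (p - 2) / 2 by ring]
    ring

/-- At a zero of `ρ` the term with `ρ ^ (p - 4)` is `0`, since `A` vanishes there. -/
theorem hasDerivAt_rpow_norm_mul (hρ : ∀ t, 0 ≤ ρ t) (hN : ∀ t, N t = ρ t ^ 2)
    (hd : HasDerivAt N (2 * A t) t) (hA : HasDerivAt A A' t) (hp : 2 ≤ p ∨ ρ t ≠ 0)
    (h0 : ρ t = 0 → A t = 0) :
    HasDerivAt (fun t => ρ t ^ (p - 2) * A t)
      ((p - 2) * (ρ t ^ (p - 4) * A t ^ 2) + ρ t ^ (p - 2) * A') t := by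
  rcases eq_or_ne (ρ t) 0 with h | h
  · have hp2 : 2 ≤ p := hp.resolve_right fun hn => hn h
    have hc : ContinuousAt (fun t => ρ t ^ (p - 2)) t := by
      have h2 : (fun t => ρ t ^ (p - 2)) = fun t => N t ^ ((p - 2) / 2) := by
        funext t
        rw [rpow_eq_sq_rpow (hρ t), hN]
      rw [h2]
      exact hd.continuousAt.rpow_const (Or.inr (by linarith))
    refine (hasDerivAt_smul_of_eq_zero hc hA (h0 h)).congr_deriv ?_
    rw [h0 h]
    simp
  · have h2 : (fun t => ρ t ^ (p - 2)) = fun t => N t ^ ((p - 2) / 2) := by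
      funext t
      rw [rpow_eq_sq_rpow (hρ t), hN]
    have h3 : HasDerivAt (fun t => ρ t ^ (p - 2)) ((p - 2) * (ρ t ^ (p - 4) * A t)) t := by
      rw [h2]
      refine (hd.rpow_const (p := (p - 2) / 2) (Or.inl ?_)).congr_deriv ?_
      · rw [hN]; exact pow_ne_zero 2 h
      · rw [rpow_eq_sq_rpow (hρ t) (p - 4), hN, show (p - 2) / 2 - 1 = (p - 4) / 2 by ring]
        ring
    refine (h3.mul hA).congr_deriv ?_
    ring

end Powers

/-! ### Differentiation of integrals of powers -/

section Integrals

theorem hasDerivAt_integral_of_bounded {a b δ c : ℝ} (hab : a ≤ b) {F F' : ℝ → ℝ → ℝ}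
    (hF : ∀ t ∈ Ioo (-δ) δ, ContinuousOn (F t) (Icc a b))
    (hF' : ∀ t ∈ Ioo (-δ) δ, AEStronglyMeasurable (F' t) (volume.restrict (Icc a b)))
    (hd : ∀ t ∈ Ioo (-δ) δ, ∀ s ∈ Icc a b, HasDerivAt (fun t => F t s) (F' t s) t)
    (hc : ∀ t ∈ Ioo (-δ) δ, ∀ s ∈ Icc a b, |F' t s| ≤ c) {t : ℝ} (ht : t ∈ Ioo (-δ) δ) :
    HasDerivAt (fun t => ∫ s in a..b, F t s) (∫ s in a..b, F' t s) t := by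
  have hI : uIoc a b ⊆ Icc a b := by
    rw [uIoc_of_le hab]
    exact Ioc_subset_Icc_self
  refine (intervalIntegral.hasDerivAt_integral_of_dominated_loc_of_deriv_le
    (bound := fun _ => c) (isOpen_Ioo.mem_nhds ht) ?_ ?_ ?_ ?_ ?_ ?_).2
  · filter_upwards [isOpen_Ioo.mem_nhds ht] with r hr
    exact ((hF r hr).aestronglyMeasurable measurableSet_Icc).mono_measure
      (Measure.restrict_mono hI le_rfl)
  · exact ContinuousOn.intervalIntegrable (by rw [uIcc_of_le hab]; exact hF t ht)
  · exact (hF' t ht).mono_measure (Measure.restrict_mono hI le_rfl)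
  · exact Eventually.of_forall fun s hs r hr => hc r hr s (hI hs)
  · exact intervalIntegrable_const
  · exact Eventually.of_forall fun s hs r hr => hd r hr s (hI hs)

variable {p a b ε : ℝ} {ρ N A B C : ℝ → ℝ → ℝ}

/-- The first two derivatives of `t ↦ 1 / p * ∫ ρᵖ`, where `ρ² = N`, `∂ₜN = 2 A` and
`∂ₜA = B + C`. The inequality `A² ≤ N * B` controls the singular factor `ρ ^ (p - 4)`. -/
theorem hasDerivAt_deriv_integral_rpow (hp0 : 0 < p) (hab : a ≤ b) (hε : 0 < ε)
    (hρ : ∀ t s, 0 ≤ ρ t s) (hN : ∀ t s, N t s = ρ t s ^ 2)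
    (cN : ∀ t ∈ Ioo (-ε) ε, ∀ s ∈ Icc a b, ContinuousAt (fun q : ℝ × ℝ => N q.1 q.2) (t, s))
    (cA : ∀ t ∈ Ioo (-ε) ε, ∀ s ∈ Icc a b, ContinuousAt (fun q : ℝ × ℝ => A q.1 q.2) (t, s))
    (cB : ∀ t ∈ Ioo (-ε) ε, ∀ s ∈ Icc a b, ContinuousAt (fun q : ℝ × ℝ => B q.1 q.2) (t, s))
    (cC : ∀ t ∈ Ioo (-ε) ε, ∀ s ∈ Icc a b, ContinuousAt (fun q : ℝ × ℝ => C q.1 q.2) (t, s))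
    (dN : ∀ t ∈ Ioo (-ε) ε, ∀ s ∈ Icc a b, HasDerivAt (fun t => N t s) (2 * A t s) t)
    (dA : ∀ t ∈ Ioo (-ε) ε, ∀ s ∈ Icc a b, HasDerivAt (fun t => A t s) (B t s + C t s) t)
    (hAB : ∀ t s, A t s ^ 2 ≤ N t s * B t s)
    (hp : 2 ≤ p ∨ ∀ s ∈ Icc a b, ρ 0 s ≠ 0) :
    (∀ᶠ t in 𝓝 (0 : ℝ), DifferentiableAt ℝ (fun t => 1 / p * ∫ s in a..b, ρ t s ^ p) t) ∧
    HasDerivAt (deriv fun t => 1 / p * ∫ s in a..b, ρ t s ^ p)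
      (∫ s in a..b, ((p - 2) * (ρ 0 s ^ (p - 4) * A 0 s ^ 2) + ρ 0 s ^ (p - 2) * (B 0 s + C 0 s)))
      0 := by
  have hρN : (fun q : ℝ × ℝ => ρ q.1 q.2) = fun q => √(N q.1 q.2) := by
    funext q
    rw [hN, Real.sqrt_sq (hρ _ _)]
  have cρ : ∀ t ∈ Ioo (-ε) ε, ∀ s ∈ Icc a b,
      ContinuousAt (fun q : ℝ × ℝ => ρ q.1 q.2) (t, s) := fun t ht s hs => by
    rw [hρN]
    exact (cN t ht s hs).sqrt
  -- if `ρ 0` has no zeros, neither has `ρ t` for small `t`, as `[a, b]` is compact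
  obtain ⟨δ, hδ, hδε, hne⟩ : ∃ δ > 0, δ < ε ∧
      ∀ t ∈ Icc (-δ) δ, ∀ s ∈ Icc a b, ρ t s ≠ 0 ∨ 0 ≤ p - 2 := by
    have h0 : (0 : ℝ) ∈ Ioo (-ε) ε := ⟨by linarith, hε⟩
    have hev : ∀ᶠ t in 𝓝 (0 : ℝ), ∀ s ∈ Icc a b, ρ t s ≠ 0 ∨ 0 ≤ p - 2 := by
      rcases hp with hp | hp
      · exact Eventually.of_forall fun t s _ => Or.inr (by linarith)
      · refine (isCompact_Icc.eventually_forall_of_forall_eventually fun s hs => ?_).mono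
          fun t ht s hs => Or.inl (ht s hs)
        exact (cρ 0 h0 s hs).eventually_ne (hp s hs)
    obtain ⟨r, hr, hr'⟩ := Metric.eventually_nhds_iff.1 hev
    refine ⟨min r ε / 2, by positivity, ?_, fun t ht => hr' ?_⟩
    · linarith [min_le_right r ε]
    · rw [Real.dist_eq, sub_zero, abs_lt]
      have := lt_min hr hε
      constructor <;> linarith [ht.1, ht.2, min_le_left r ε]
  have hsub : Icc (-δ) δ ⊆ Ioo (-ε) ε := fun t ht => ⟨by linarith [ht.1], by linarith [ht.2]⟩
  have hIoo : Ioo (-δ) δ ⊆ Icc (-δ) δ := Ioo_subset_Icc_self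
  have cpow : ∀ t ∈ Icc (-δ) δ, ∀ s ∈ Icc a b,
      ContinuousAt (fun q : ℝ × ℝ => ρ q.1 q.2 ^ (p - 2)) (t, s) := fun t ht s hs =>
    (cρ t (hsub ht) s hs).rpow_const (hne t ht s hs)
  have slice : ∀ {f : ℝ → ℝ → ℝ}, (∀ t ∈ Icc (-δ) δ, ∀ s ∈ Icc a b,
      ContinuousAt (fun q : ℝ × ℝ => f q.1 q.2) (t, s)) →
      ∀ t ∈ Ioo (-δ) δ, ContinuousOn (f t) (Icc a b) := fun {f} hf t ht s hs =>
    ((hf t (hIoo ht) s hs).comp (f := fun s => (t, s)) (by fun_prop)).continuousWithinAt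
  have bdd : ∀ {f : ℝ → ℝ → ℝ}, (∀ t ∈ Icc (-δ) δ, ∀ s ∈ Icc a b,
      ContinuousAt (fun q : ℝ × ℝ => f q.1 q.2) (t, s)) →
      ∃ c, ∀ t ∈ Ioo (-δ) δ, ∀ s ∈ Icc a b, |f t s| ≤ c := fun {f} hf => by
    obtain ⟨c, hc⟩ := (isCompact_Icc.prod isCompact_Icc).exists_bound_of_continuousOn
      (s := Icc (-δ) δ ×ˢ Icc a b) (f := fun q : ℝ × ℝ => f q.1 q.2)
      fun q hq => (hf q.1 hq.1 q.2 hq.2).continuousWithinAt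
    exact ⟨c, fun t ht s hs => hc (t, s) ⟨hIoo ht, hs⟩⟩
  have hB : ∀ t s, ρ t s ≠ 0 → 0 ≤ B t s := fun t s h => by
    have h1 := (sq_nonneg _).trans (hAB t s)
    rw [hN] at h1
    exact nonneg_of_mul_nonneg_right h1 (by positivity)
  have hA0 : ∀ t s, ρ t s = 0 → A t s = 0 := fun t s h => by
    have h1 := hAB t s
    rw [hN, h] at h1
    exact pow_eq_zero_iff two_ne_zero |>.1 (le_antisymm (by simpa using h1) (sq_nonneg _))
  have hpos : ∀ t ∈ Icc (-δ) δ, ∀ s ∈ Icc a b, 2 ≤ p ∨ ρ t s ≠ 0 := fun t ht s hs =>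
    (hne t ht s hs).symm.imp_left fun h => by linarith
  -- the first derivative
  have d1 : ∀ t ∈ Ioo (-δ) δ, HasDerivAt (fun t => 1 / p * ∫ s in a..b, ρ t s ^ p)
      (∫ s in a..b, ρ t s ^ (p - 2) * A t s) t := by
    intro t ht
    have hcont : ∀ t ∈ Icc (-δ) δ, ∀ s ∈ Icc a b, ContinuousAt
        (fun q : ℝ × ℝ => p * (ρ q.1 q.2 ^ (p - 2) * A q.1 q.2)) (t, s) := fun t ht s hs =>
      continuousAt_const.mul ((cpow t ht s hs).mul (cA t (hsub ht) s hs))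
    obtain ⟨c, hc⟩ := bdd (f := fun t s => p * (ρ t s ^ (p - 2) * A t s)) hcont
    have h := hasDerivAt_integral_of_bounded (F := fun t s => ρ t s ^ p)
      (F' := fun t s => p * (ρ t s ^ (p - 2) * A t s)) hab
      (slice (f := fun t s => ρ t s ^ p) fun t ht s hs =>
        (cρ t (hsub ht) s hs).rpow_const (Or.inr hp0.le))
      (fun t ht => (slice (f := fun t s => p * (ρ t s ^ (p - 2) * A t s)) hcont t
        ht).aestronglyMeasurable measurableSet_Icc)
      (fun t ht s hs => hasDerivAt_rpow_norm (ρ := fun t => ρ t s) (N := fun t => N t s)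
        (A := fun t => A t s) (fun t => hρ t s) (fun t => hN t s)
        (dN t (hsub (hIoo ht)) s hs) (hpos t (hIoo ht) s hs)) hc ht
    refine (h.const_mul (1 / p)).congr_deriv ?_
    rw [intervalIntegral.integral_const_mul, ← mul_assoc, one_div_mul_cancel hp0.ne', one_mul]
  have h0 : (0 : ℝ) ∈ Ioo (-δ) δ := ⟨by linarith, hδ⟩
  have hnhds : Ioo (-δ) δ ∈ 𝓝 (0 : ℝ) := isOpen_Ioo.mem_nhds h0
  refine ⟨by filter_upwards [hnhds] with t ht using (d1 t ht).differentiableAt, ?_⟩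
  have hderiv : (deriv fun t => 1 / p * ∫ s in a..b, ρ t s ^ p) =ᶠ[𝓝 0]
      fun t => ∫ s in a..b, ρ t s ^ (p - 2) * A t s := by
    filter_upwards [hnhds] with t ht using (d1 t ht).deriv
  refine HasDerivAt.congr_of_eventuallyEq ?_ hderiv
  -- the second derivative
  obtain ⟨c, hc⟩ := bdd (f := fun t s => |p - 2| * (ρ t s ^ (p - 2) * |B t s|) +
    ρ t s ^ (p - 2) * |B t s + C t s|) fun t ht s hs =>
      (continuousAt_const.mul ((cpow t ht s hs).mul (cB t (hsub ht) s hs).abs)).add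
        ((cpow t ht s hs).mul ((cB t (hsub ht) s hs).add (cC t (hsub ht) s hs)).abs)
  have meas : ∀ {f : ℝ → ℝ → ℝ}, (∀ t ∈ Ioo (-ε) ε, ∀ s ∈ Icc a b,
      ContinuousAt (fun q : ℝ × ℝ => f q.1 q.2) (t, s)) →
      ∀ t ∈ Ioo (-δ) δ, AEMeasurable (f t) (volume.restrict (Icc a b)) := fun {f} hf t ht =>
    (slice (fun t ht => hf t (hsub ht)) t ht).aemeasurable measurableSet_Icc
  refine hasDerivAt_integral_of_bounded (δ := δ) (c := c)
    (F := fun t s => ρ t s ^ (p - 2) * A t s)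
    (F' := fun t s => (p - 2) * (ρ t s ^ (p - 4) * A t s ^ 2) + ρ t s ^ (p - 2) * (B t s + C t s))
    hab (slice (f := fun t s => ρ t s ^ (p - 2) * A t s) fun t ht s hs =>
      (cpow t ht s hs).mul (cA t (hsub ht) s hs)) (fun t ht => ?_)
    (fun t ht s hs => hasDerivAt_rpow_norm_mul (ρ := fun t => ρ t s) (N := fun t => N t s)
        (A := fun t => A t s) (fun t => hρ t s) (fun t => hN t s)
        (dN t (hsub (hIoo ht)) s hs) (dA t (hsub (hIoo ht)) s hs) (hpos t (hIoo ht) s hs)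
        (hA0 t s)) (fun t ht s hs => ?_) h0
  · have mρ := meas (f := ρ) cρ t ht
    have mA := meas (f := A) cA t ht
    have mB := meas (f := B) cB t ht
    have mC := meas (f := C) cC t ht
    exact ((((mρ.pow_const (p - 4)).mul (mA.pow_const 2)).const_mul (p - 2)).add
      ((mρ.pow_const (p - 2)).mul (mB.add mC))).aestronglyMeasurable
  · refine le_trans ?_ ((le_abs_self _).trans (hc t ht s hs))
    have hr : 0 ≤ ρ t s ^ (p - 2) := Real.rpow_nonneg (hρ t s) _
    refine (abs_add_le _ _).trans (add_le_add ?_ ?_)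
    · rw [abs_mul]
      refine mul_le_mul_of_nonneg_left ?_ (abs_nonneg _)
      rcases eq_or_ne (ρ t s) 0 with h | h
      · rw [hA0 t s h]
        simpa using mul_nonneg hr (abs_nonneg (B t s))
      · have hs' : |A t s| ≤ ρ t s * √(B t s) := by
          rw [← Real.sqrt_sq (hρ t s), ← Real.sqrt_mul (sq_nonneg _), ← hN]
          exact Real.abs_le_sqrt (hAB t s)
        have := abs_rpow_mul_mul_le (hρ t s) hs' hs' (Real.sqrt_nonneg _) (Real.sqrt_nonneg _) p
        rw [Real.mul_self_sqrt (hB t s h), ← sq] at this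
        exact this.trans (by gcongr; exact le_abs_self _)
    · rw [abs_mul, abs_of_nonneg hr]

end Integrals

/-! ### Commutation identities in a space form -/

section SpaceForm

/-- The vector `|T|² v - ⟪v, T⟫ T`. In a space form of curvature `K`, `R(v, T)T` is its multiple
by `K`. -/
noncomputable def jacobiVec {X : Type*} [NormedAddCommGroup X] [InnerProductSpace ℝ X] (T v : X) : X :=
  (inner ℝ T T : ℝ) • v - (inner ℝ T v : ℝ) • T

variable {E : Type*} [NormedAddCommGroup E] [NormedSpace ℝ E]
  {M : Type*} [TopologicalSpace M] [ChartedSpace E M] {γ : ℝ → ℝ → M} {t s : ℝ}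

/-- The velocity `∂ₛγ` of the curves `γ t`. -/
noncomputable abbrev velSnd (E : Type*) [NormedAddCommGroup E] [NormedSpace ℝ E] [ChartedSpace E M]
    (γ : ℝ → ℝ → M) (t s : ℝ) : TangentSpace 𝓘(ℝ, E) (γ t s) :=
  velocity 𝓘(ℝ, E) (γ t) s

/-- The variation field `∂ₜγ`. -/
noncomputable abbrev velFst (E : Type*) [NormedAddCommGroup E] [NormedSpace ℝ E] [ChartedSpace E M]
    (γ : ℝ → ℝ → M) (t s : ℝ) : TangentSpace 𝓘(ℝ, E) (γ t s) :=
  velocity 𝓘(ℝ, E) (fun t => γ t s) t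

/-- The two-parameter map `γ` is smooth at all points near `(t, s)`. -/
def IsSmoothNear (E : Type*) [NormedAddCommGroup E] [NormedSpace ℝ E] [ChartedSpace E M] (γ : ℝ → ℝ → M) (t s : ℝ) : Prop :=
  ∀ᶠ q in 𝓝 (t, s), ContMDiffAt 𝓘(ℝ, ℝ × ℝ) 𝓘(ℝ, E) ∞ (fun q : ℝ × ℝ => γ q.1 q.2) (q.1, q.2)

theorem IsSmoothNear.eventually (h : IsSmoothNear E γ t s) :
    ∀ᶠ q in 𝓝 (t, s), IsSmoothNear E γ q.1 q.2 :=
  eventually_eventually_nhds.2 h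

variable [IsManifold 𝓘(ℝ, E) ∞ M]

theorem IsSmoothNear.isSmoothField_velSnd (h : IsSmoothNear E γ t s) :
    IsSmoothField γ (velSnd E γ) t s :=
  isSmoothField_velocity h.self_of_nhds

theorem IsSmoothNear.isSmoothField_velFst (h : IsSmoothNear E γ t s) :
    IsSmoothField γ (velFst E γ) t s :=
  isSmoothField_velocity_fst h.self_of_nhds

variable [RiemannianBundle (fun x : M => TangentSpace 𝓘(ℝ, E) x)]
  [IsContMDiffRiemannianBundle 𝓘(ℝ, E) ∞ E (fun x : M => TangentSpace 𝓘(ℝ, E) x)]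
  {V W : (t s : ℝ) → TangentSpace 𝓘(ℝ, E) (γ t s)} {K : ℝ}

theorem isSmoothField_jacobiVec (hV : IsSmoothField γ V t s) (hW : IsSmoothField γ W t s) :
    IsSmoothField γ (fun t s => jacobiVec (V t s) (W t s)) t s := by
  have h1 := hW.smul (f := fun t s => inner ℝ (V t s) (V t s)) (hV.contDiffAt_inner hV)
  have h2 := hV.smul (f := fun t s => -inner ℝ (V t s) (W t s)) (hV.contDiffAt_inner hW).neg
  have h3 : (fun t s => jacobiVec (V t s) (W t s)) = fun t s =>
      (inner ℝ (V t s) (V t s) : ℝ) • W t s + (-inner ℝ (V t s) (W t s) : ℝ) • V t s := by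
    funext t s
    rw [jacobiVec]
    module
  rw [h3]
  exact h1.add h2

variable [FiniteDimensional ℝ E]

theorem covDerivAlong_congr {c : ℝ → M} {V W : (s : ℝ) → TangentSpace 𝓘(ℝ, E) (c s)}
    (h : ∀ᶠ r in 𝓝 s, V r = W r) :
    covDerivAlong 𝓘(ℝ, E) c V s = covDerivAlong 𝓘(ℝ, E) c W s := by
  have h1 : (fun r => toCoord 𝓘(ℝ, E) (c s) (c r) (V r)) =ᶠ[𝓝 s]
      fun r => toCoord 𝓘(ℝ, E) (c s) (c r) (W r) := by
    filter_upwards [h] with r hr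
    rw [hr]
  rw [covDerivAlong, covDerivAlong, h1.deriv_eq, h.self_of_nhds]

theorem covSnd_congr (h : ∀ᶠ q in 𝓝 (t, s), V q.1 q.2 = W q.1 q.2) :
    covSnd γ V t s = covSnd γ W t s :=
  covDerivAlong_congr ((Continuous.tendsto (f := fun r : ℝ => (t, r)) (by fun_prop) s).eventually h)

theorem covFst_congr (h : ∀ᶠ q in 𝓝 (t, s), V q.1 q.2 = W q.1 q.2) :
    covFst γ V t s = covFst γ W t s :=
  covDerivAlong_congr ((Continuous.tendsto (f := fun r : ℝ => (r, s)) (by fun_prop) t).eventually h)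

theorem covFst_add (hV : IsSmoothField γ V t s) (hW : IsSmoothField γ W t s) :
    covFst γ (fun t s => V t s + W t s) t s = covFst γ V t s + covFst γ W t s :=
  covDerivAlong_add hV.isDiffAlong_fst hW.isDiffAlong_fst

theorem covFst_smul {f : ℝ → ℝ → ℝ} (hf : ContDiffAt ℝ ∞ (fun q : ℝ × ℝ => f q.1 q.2) (t, s))
    (hV : IsSmoothField γ V t s) :
    covFst γ (fun t s => f t s • V t s) t s =
      deriv (fun t => f t s) t • V t s + f t s • covFst γ V t s :=
  covDerivAlong_smul (f := fun t => f t s) ((ContDiffAt.hasDerivAt_fst (hf.of_le (by simp))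
    ).differentiableAt) hV.isDiffAlong_fst

theorem covFst_covSnd (hK : HasConstantCurvature 𝓘(ℝ, E) M K) (hV : IsSmoothField γ V t s) :
    covFst γ (covSnd γ V) t s = covSnd γ (covFst γ V) t s +
      K • ((inner ℝ (V t s) (velSnd E γ t s) : ℝ) • velFst E γ t s -
        (inner ℝ (V t s) (velFst E γ t s) : ℝ) • velSnd E γ t s) := by
  rw [← hK, ← covFst_covSnd_sub hV]
  abel

theorem covFst_velSnd (h : IsSmoothNear E γ t s) :
    covFst γ (velSnd E γ) t s = covSnd γ (velFst E γ) t s :=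
  (covSnd_velocity_fst h.self_of_nhds).symm

/-- The derivative of the tension field in the direction of the variation. -/
theorem covFst_covSnd_velSnd (hK : HasConstantCurvature 𝓘(ℝ, E) M K)
    (h : IsSmoothNear E γ t s) :
    covFst γ (covSnd γ (velSnd E γ)) t s = covSnd γ (covSnd γ (velFst E γ)) t s +
      K • jacobiVec (velSnd E γ t s) (velFst E γ t s) := by
  rw [covFst_covSnd hK h.isSmoothField_velSnd, jacobiVec]
  congr 1
  exact covSnd_congr (h.eventually.mono fun q hq => covFst_velSnd hq)

theorem hasDerivAt_inner_fst (hV : IsSmoothField γ V t s) (hW : IsSmoothField γ W t s) :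
    HasDerivAt (fun t => (inner ℝ (V t s) (W t s) : ℝ))
      (inner ℝ (covFst γ V t s) (W t s) + inner ℝ (V t s) (covFst γ W t s)) t :=
  hV.isDiffAlong_fst.hasDerivAt_inner hW.isDiffAlong_fst

theorem covFst_jacobiVec (hV : IsSmoothField γ V t s) (hW : IsSmoothField γ W t s) :
    covFst γ (fun t s => jacobiVec (V t s) (W t s)) t s =
      ((2 * inner ℝ (covFst γ V t s) (V t s) : ℝ) • W t s +
        (inner ℝ (V t s) (V t s) : ℝ) • covFst γ W t s) -
      ((inner ℝ (covFst γ V t s) (W t s) + inner ℝ (V t s) (covFst γ W t s) : ℝ) • V t s +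
        (inner ℝ (V t s) (W t s) : ℝ) • covFst γ V t s) := by
  have c1 : ContDiffAt ℝ ∞ (fun q : ℝ × ℝ => -(inner ℝ (V q.1 q.2) (W q.1 q.2) : ℝ)) (t, s) :=
    (hV.contDiffAt_inner hW).neg
  have h1 := hW.smul (f := fun t s => inner ℝ (V t s) (V t s)) (hV.contDiffAt_inner hV)
  have h2 := hV.smul (f := fun t s => -inner ℝ (V t s) (W t s)) c1
  have h3 : (fun t s => jacobiVec (V t s) (W t s)) = fun t s =>
      (inner ℝ (V t s) (V t s) : ℝ) • W t s + (-inner ℝ (V t s) (W t s) : ℝ) • V t s := by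
    funext t s
    rw [jacobiVec]
    module
  rw [h3, covFst_add h1 h2,
    covFst_smul (f := fun t s => inner ℝ (V t s) (V t s)) (hV.contDiffAt_inner hV) hW,
    covFst_smul (f := fun t s => -inner ℝ (V t s) (W t s)) c1 hV,
    (hasDerivAt_inner_fst hV hV).deriv, (hasDerivAt_inner_fst hV hW).fun_neg.deriv,
    real_inner_comm (covFst γ V t s) (V t s)]
  module

/-- The second derivative of the tension field in the direction of the variation. -/
theorem covFst_covFst_tension (hK : HasConstantCurvature 𝓘(ℝ, E) M K)
    (h : IsSmoothNear E γ t s) :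
    covFst γ (covFst γ (covSnd γ (velSnd E γ))) t s =
      covSnd γ (covFst γ (covSnd γ (velFst E γ))) t s +
      K • ((inner ℝ (covSnd γ (velFst E γ) t s) (velSnd E γ t s) : ℝ) • velFst E γ t s -
        (inner ℝ (covSnd γ (velFst E γ) t s) (velFst E γ t s) : ℝ) • velSnd E γ t s) +
      K • (((2 * inner ℝ (covSnd γ (velFst E γ) t s) (velSnd E γ t s) : ℝ) • velFst E γ t s +
        (inner ℝ (velSnd E γ t s) (velSnd E γ t s) : ℝ) • covFst γ (velFst E γ) t s) -
      ((inner ℝ (covSnd γ (velFst E γ) t s) (velFst E γ t s) +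
          inner ℝ (velSnd E γ t s) (covFst γ (velFst E γ) t s) : ℝ) • velSnd E γ t s +
        (inner ℝ (velSnd E γ t s) (velFst E γ t s) : ℝ) • covSnd γ (velFst E γ) t s)) := by
  have hT := h.isSmoothField_velSnd
  have hV := h.isSmoothField_velFst
  have hJ := isSmoothField_jacobiVec hT hV
  have hV2 := hV.covSnd.covSnd
  have hKJ : IsSmoothField γ (fun t s => K • jacobiVec (velSnd E γ t s) (velFst E γ t s)) t s :=
    hJ.smul (f := fun _ _ => K) contDiffAt_const
  rw [covFst_congr (W := fun t s => covSnd γ (covSnd γ (velFst E γ)) t s +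
      K • jacobiVec (velSnd E γ t s) (velFst E γ t s)) (h.eventually.mono fun q hq => covFst_covSnd_velSnd hK hq), covFst_add hV2 hKJ,
    covFst_covSnd hK hV.covSnd, covFst_smul (f := fun _ _ => K) contDiffAt_const hJ,
    covFst_jacobiVec hT hV, covFst_velSnd h, deriv_const, zero_smul, zero_add]

end SpaceForm

/-! ### Weighted products -/

section Weighted

variable {p a b : ℝ} {ρ y z Y Z : ℝ → ℝ}

/-- For `p = 2` the singular product need not be continuous, but its coefficient `p - 2` vanishes. -/
theorem continuousOn_rpow_mul_mul {S : Set ℝ} (hρ : ∀ s, 0 ≤ ρ s) (hy : ∀ s, |y s| ≤ ρ s * Y s)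
    (hz : ∀ s, |z s| ≤ ρ s * Z s) (hY : ∀ s, 0 ≤ Y s) (hZ : ∀ s, 0 ≤ Z s)
    (cρ : ContinuousOn ρ S) (cy : ContinuousOn y S) (cz : ContinuousOn z S)
    (cY : ContinuousOn Y S) (cZ : ContinuousOn Z S) (hp : ∀ s ∈ S, 2 ≤ p ∨ ρ s ≠ 0) :
    ContinuousOn (fun s => (p - 2) * (ρ s ^ (p - 4) * (y s * z s))) S := by
  intro s hs
  rcases eq_or_ne (ρ s) 0 with h | h
  · rcases ((hp s hs).resolve_right fun hn => hn h).eq_or_lt with rfl | hp2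
    · simpa using continuousWithinAt_const
    · have h0 : y s = 0 := abs_nonpos_iff.1 (by simpa [h] using hy s)
      have hb : ContinuousWithinAt (fun s => |p - 2| * (ρ s ^ (p - 2) * (Y s * Z s))) S s :=
        continuousWithinAt_const.mul (((cρ s hs).rpow_const (Or.inr (by linarith))).mul
          ((cY s hs).mul (cZ s hs)))
      rw [ContinuousWithinAt, h, Real.zero_rpow (by linarith), zero_mul, mul_zero] at hb
      rw [ContinuousWithinAt, h0, zero_mul, mul_zero, mul_zero]
      refine squeeze_zero_norm (fun r => ?_) hb
      rw [Real.norm_eq_abs, abs_mul]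
      exact mul_le_mul_of_nonneg_left (abs_rpow_mul_mul_le (hρ r) (hy r) (hz r) (hY r) (hZ r) p)
        (abs_nonneg _)
  · exact continuousWithinAt_const.mul (((cρ s hs).rpow_const (Or.inl h)).mul
      ((cy s hs).mul (cz s hs)))

theorem intervalIntegrable_rpow_mul_mul (hab : a ≤ b) (hρ : ∀ s, 0 ≤ ρ s)
    (hy : ∀ s, |y s| ≤ ρ s * Y s) (hz : ∀ s, |z s| ≤ ρ s * Z s) (hY : ∀ s, 0 ≤ Y s)
    (hZ : ∀ s, 0 ≤ Z s) (cρ : ContinuousOn ρ (Icc a b)) (cy : ContinuousOn y (Icc a b))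
    (cz : ContinuousOn z (Icc a b)) (cY : ContinuousOn Y (Icc a b)) (cZ : ContinuousOn Z (Icc a b))
    (hp : ∀ s ∈ Icc a b, 2 ≤ p ∨ ρ s ≠ 0) :
    IntervalIntegrable (fun s => ρ s ^ (p - 4) * (y s * z s)) volume a b := by
  rw [intervalIntegrable_iff_integrableOn_Icc_of_le hab]
  have hb : IntegrableOn (fun s => ρ s ^ (p - 2) * (Y s * Z s)) (Icc a b) :=
    ContinuousOn.integrableOn_Icc ((cρ.rpow_const fun s hs =>
      (hp s hs).symm.imp_right fun h => by linarith).mul (cY.mul cZ))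
  refine hb.mono' ?_ (Eventually.of_forall fun s =>
    abs_rpow_mul_mul_le (hρ s) (hy s) (hz s) (hY s) (hZ s) p)
  exact (((cρ.aemeasurable measurableSet_Icc).pow_const (p - 4)).mul
    ((cy.aemeasurable measurableSet_Icc).mul
      (cz.aemeasurable measurableSet_Icc))).aestronglyMeasurable

end Weighted

/-! ### The second-variation integrand -/

section Integrand

variable {X : Type*} [NormedAddCommGroup X] [InnerProductSpace ℝ X]

/-- The integrand of the second derivative of the energy is the one in the second-variation formula,
up to the derivative of `⟪∇ₜ∇ₛ∂ₜγ, F⟫ - ⟪∇ₜ∂ₜγ, ∇F⟫` with `F = |τ|^{p-2} τ`. Here `T`, `V`, `V₁`,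
`V₂`, `W`, `Y'`, `F'` stand for `∂ₛγ`, `∂ₜγ`, `∇ₛ∂ₜγ`, `∇ₛ∇ₛ∂ₜγ`, `∇ₜ∂ₜγ`, `∇ₛ∇ₜ∇ₛ∂ₜγ`, `∇ₛF`, and
`q`, `r` for `|τ|^{p-4}`, `|τ|^{p-2}`. -/
theorem secondVariation_integrand (T τ V V₁ V₂ W Y' F' : X) (K p q r : ℝ) :
    (p - 2) * (q * (inner ℝ (V₂ + K • jacobiVec T V) τ) ^ 2) +
      r * (inner ℝ (V₂ + K • jacobiVec T V) (V₂ + K • jacobiVec T V) +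
        inner ℝ (Y' + K • ((inner ℝ V₁ T : ℝ) • V - (inner ℝ V₁ V : ℝ) • T) +
          K • (((2 * inner ℝ V₁ T : ℝ) • V + (inner ℝ T T : ℝ) • W) -
            ((inner ℝ V₁ V + inner ℝ T W : ℝ) • T + (inner ℝ T V : ℝ) • V₁))) τ) =
    (p - 2) * (q * |inner ℝ V₂ τ| ^ 2) + r * ‖V₂‖ ^ 2
      + (p - 2) * K ^ 2 * (q * |inner ℝ V T * inner ℝ T τ - ‖T‖ ^ 2 * inner ℝ τ V| ^ 2)
      + K ^ 2 * (r * ‖(inner ℝ V T : ℝ) • T - ‖T‖ ^ 2 • V‖ ^ 2)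
      + K * (‖V‖ ^ 2 * inner ℝ T F' - inner ℝ V T * inner ℝ V F')
      - 2 * K * (r * (inner ℝ T τ * inner ℝ V₁ V - inner ℝ V₁ T * inner ℝ τ V))
      + 2 * (p - 2) * K * (inner ℝ V₂ τ * q * (‖T‖ ^ 2 * inner ℝ V τ - inner ℝ V T * inner ℝ T τ))
      - 2 * K * (r * (inner ℝ T V₂ * inner ℝ T V - ‖T‖ ^ 2 * inner ℝ V₂ V))
      - K * (r * (inner ℝ τ V₁ * inner ℝ T V - inner ℝ V₁ T * inner ℝ τ V))
      + (r * inner ℝ Y' τ + K * (inner ℝ V T * inner ℝ V F' - inner ℝ V V * inner ℝ T F')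
        - r * (K * (inner ℝ T τ * inner ℝ W T - inner ℝ T T * inner ℝ W τ))) := by
  simp only [jacobiVec, ← real_inner_self_eq_norm_sq, sq_abs, inner_add_left, inner_add_right,
    inner_sub_left, inner_sub_right, real_inner_smul_left, real_inner_smul_right,
    real_inner_comm T V, real_inner_comm T V₁, real_inner_comm T V₂, real_inner_comm T W,
    real_inner_comm V τ, real_inner_comm V₁ τ, real_inner_comm V V₁, real_inner_comm V V₂]
  ring

theorem jacobiVec_eq_neg (T V : X) : jacobiVec T V = -((inner ℝ V T : ℝ) • T - ‖T‖ ^ 2 • V) := by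
  rw [jacobiVec, real_inner_self_eq_norm_sq, real_inner_comm]
  abel

end Integrand

/-! ### Curves that coincide or repeat -/

section Coincidence

variable {E : Type*} [NormedAddCommGroup E] [NormedSpace ℝ E]
  {M : Type*} [TopologicalSpace M] [ChartedSpace E M]
  {c c₁ c₂ : ℝ → M} {s : ℝ}

/-- Curves that coincide near `s` have the same velocity there. The equality is one in the tangent
bundle, as the base points agree only propositionally. -/
theorem velocity_congr (h : ∀ᶠ r in 𝓝 s, c₁ r = c₂ r) :
    (⟨c₁ s, velocity 𝓘(ℝ, E) c₁ s⟩ : TangentBundle 𝓘(ℝ, E) M) = ⟨c₂ s, velocity 𝓘(ℝ, E) c₂ s⟩ := by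
  have h1 : (velocity 𝓘(ℝ, E) c₁ s : E) = velocity 𝓘(ℝ, E) c₂ s :=
    congrArg (fun l : ℝ →L[ℝ] E => l 1) (EventuallyEq.mfderiv_eq (I := 𝓘(ℝ, ℝ)) (I' := 𝓘(ℝ, E)) h)
  exact (congrArg (fun e : E => (⟨c₁ s, e⟩ : TangentBundle 𝓘(ℝ, E) M)) h1).trans
    (congrArg (fun x : M => (⟨x, (velocity 𝓘(ℝ, E) c₂ s : E)⟩ : TangentBundle 𝓘(ℝ, E) M))
      h.self_of_nhds)

/-- No differentiability is needed: where it fails, both sides are `0`. -/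
theorem velocity_comp_add_const (c : ℝ → M) (L s : ℝ) :
    velocity 𝓘(ℝ, E) (fun r => c (r + L)) s = velocity 𝓘(ℝ, E) c (s + L) := by
  have hadd : ∀ L s : ℝ, MDifferentiableAt 𝓘(ℝ, ℝ) 𝓘(ℝ, ℝ) (fun r : ℝ => r + L) s := fun L s =>
    (differentiableAt_id.add_const L).mdifferentiableAt
  by_cases h : MDifferentiableAt 𝓘(ℝ, ℝ) 𝓘(ℝ, E) c (s + L)
  · have h1 := mfderiv_comp (g := c) (f := fun r : ℝ => r + L) s h (hadd L s)
    have h2 : mfderiv 𝓘(ℝ, ℝ) 𝓘(ℝ, ℝ) (fun r : ℝ => r + L) s (1 : ℝ) = (1 : ℝ) := by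
      rw [mfderiv_eq_fderiv]
      exact (fderiv_apply_one_eq_deriv).trans ((hasDerivAt_id s).add_const L).deriv
    refine (congrArg (fun l : ℝ →L[ℝ] E => l 1) h1).trans ?_
    exact congrArg (mfderiv 𝓘(ℝ, ℝ) 𝓘(ℝ, E) c (s + L)) h2
  · have h' : ¬ MDifferentiableAt 𝓘(ℝ, ℝ) 𝓘(ℝ, E) (fun r => c (r + L)) s := fun hc => by
      have hc' : MDifferentiableAt 𝓘(ℝ, ℝ) 𝓘(ℝ, E) (fun r => c (r + L)) (s + L + -L) := by
        rwa [add_neg_cancel_right]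
      have := MDifferentiableAt.comp (g := fun r => c (r + L)) (f := fun r : ℝ => r + -L) (s + L)
        hc' (hadd (-L) (s + L))
      exact h (by simpa [Function.comp_def] using this)
    rw [velocity, velocity, mfderiv_zero_of_not_mdifferentiableAt h,
      mfderiv_zero_of_not_mdifferentiableAt h']
    rfl

theorem velocity_periodic {L : ℝ} (h : ∀ r, c (r + L) = c r) (s : ℝ) :
    (⟨c (s + L), velocity 𝓘(ℝ, E) c (s + L)⟩ : TangentBundle 𝓘(ℝ, E) M) =
      ⟨c s, velocity 𝓘(ℝ, E) c s⟩ := by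
  rw [← velocity_comp_add_const]
  exact velocity_congr (c₁ := fun r => c (r + L)) (Eventually.of_forall h)

theorem velocity_of_eventually_const {x : M} (h : ∀ᶠ r in 𝓝 s, c r = x) :
    (⟨c s, velocity 𝓘(ℝ, E) c s⟩ : TangentBundle 𝓘(ℝ, E) M) = ⟨x, 0⟩ := by
  rw [velocity_congr (c₂ := fun _ => x) h, velocity, mfderiv_const]
  rfl

variable [RiemannianBundle (fun x : M => TangentSpace 𝓘(ℝ, E) x)]

theorem inner_eq_of_mk_eq {x y : M} {v w : TangentSpace 𝓘(ℝ, E) x} {v' w' : TangentSpace 𝓘(ℝ, E) y}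
    (hv : (⟨x, v⟩ : TangentBundle 𝓘(ℝ, E) M) = ⟨y, v'⟩)
    (hw : (⟨x, w⟩ : TangentBundle 𝓘(ℝ, E) M) = ⟨y, w'⟩) :
    (inner ℝ v w : ℝ) = inner ℝ v' w' := by
  cases hv
  cases hw
  rfl

variable [IsManifold 𝓘(ℝ, E) ∞ M] [FiniteDimensional ℝ E]
  [IsContMDiffRiemannianBundle 𝓘(ℝ, E) ∞ E (fun x : M => TangentSpace 𝓘(ℝ, E) x)]

theorem covDerivAlong_total_congr {V₁ : (s : ℝ) → TangentSpace 𝓘(ℝ, E) (c₁ s)}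
    {V₂ : (s : ℝ) → TangentSpace 𝓘(ℝ, E) (c₂ s)}
    (h : ∀ᶠ r in 𝓝 s, (⟨c₁ r, V₁ r⟩ : TangentBundle 𝓘(ℝ, E) M) = ⟨c₂ r, V₂ r⟩) :
    (⟨c₁ s, covDerivAlong 𝓘(ℝ, E) c₁ V₁ s⟩ : TangentBundle 𝓘(ℝ, E) M) =
      ⟨c₂ s, covDerivAlong 𝓘(ℝ, E) c₂ V₂ s⟩ := by
  -- the covariant derivative as a function of non-dependent data
  let Φ : TangentBundle 𝓘(ℝ, E) M → E → TangentBundle 𝓘(ℝ, E) M → TangentBundle 𝓘(ℝ, E) M :=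
    fun P d Q => ⟨P.1, ofCoord 𝓘(ℝ, E) P.1 P.1 d +
      christoffel 𝓘(ℝ, E) P.1 (Q.2 : E) P.2⟩
  have h1 : (fun r => toCoord 𝓘(ℝ, E) (c₁ s) (c₁ r) (V₁ r)) =ᶠ[𝓝 s]
      fun r => toCoord 𝓘(ℝ, E) (c₂ s) (c₂ r) (V₂ r) := by
    have hs : c₁ s = c₂ s := congrArg TotalSpace.proj h.self_of_nhds
    filter_upwards [h] with r hr
    rw [hs]
    exact congrArg (fun P : TangentBundle 𝓘(ℝ, E) M => toCoord 𝓘(ℝ, E) (c₂ s) P.1 P.2) hr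
  have h2 := velocity_congr (E := E) (h.mono fun r hr => congrArg TotalSpace.proj hr)
  change Φ ⟨c₁ s, V₁ s⟩ (deriv (fun r => toCoord 𝓘(ℝ, E) (c₁ s) (c₁ r) (V₁ r)) s)
    ⟨c₁ s, velocity 𝓘(ℝ, E) c₁ s⟩ = Φ ⟨c₂ s, V₂ s⟩
    (deriv (fun r => toCoord 𝓘(ℝ, E) (c₂ s) (c₂ r) (V₂ r)) s) ⟨c₂ s, velocity 𝓘(ℝ, E) c₂ s⟩
  rw [h.self_of_nhds, h1.deriv_eq, h2]

theorem covDerivAlong_comp_add_const (c : ℝ → M) (V : (s : ℝ) → TangentSpace 𝓘(ℝ, E) (c s))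
    (L s : ℝ) : covDerivAlong 𝓘(ℝ, E) (fun r => c (r + L)) (fun r => V (r + L)) s =
      covDerivAlong 𝓘(ℝ, E) c V (s + L) := by
  rw [covDerivAlong, covDerivAlong, velocity_comp_add_const]
  congr 2
  exact deriv_comp_add_const (fun r => toCoord 𝓘(ℝ, E) (c (s + L)) (c r) (V r)) L s

theorem covDerivAlong_periodic {V : (s : ℝ) → TangentSpace 𝓘(ℝ, E) (c s)} {L : ℝ}
    (h : ∀ r, (⟨c (r + L), V (r + L)⟩ : TangentBundle 𝓘(ℝ, E) M) = ⟨c r, V r⟩) (s : ℝ) :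
    (⟨c (s + L), covDerivAlong 𝓘(ℝ, E) c V (s + L)⟩ : TangentBundle 𝓘(ℝ, E) M) =
      ⟨c s, covDerivAlong 𝓘(ℝ, E) c V s⟩ := by
  rw [← covDerivAlong_comp_add_const]
  exact covDerivAlong_total_congr (c₁ := fun r => c (r + L)) (V₁ := fun r => V (r + L))
    (Eventually.of_forall h)

theorem covDerivAlong_of_eventually_const {V : (s : ℝ) → TangentSpace 𝓘(ℝ, E) (c s)} {x : M}
    {v : TangentSpace 𝓘(ℝ, E) x}
    (h : ∀ᶠ r in 𝓝 s, (⟨c r, V r⟩ : TangentBundle 𝓘(ℝ, E) M) = ⟨x, v⟩) :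
    (⟨c s, covDerivAlong 𝓘(ℝ, E) c V s⟩ : TangentBundle 𝓘(ℝ, E) M) = ⟨x, 0⟩ := by
  rw [covDerivAlong_total_congr (c₂ := fun _ => x) (V₂ := fun _ => v) h, covDerivAlong, velocity,
    mfderiv_const, deriv_const, map_zero]
  congr 1
  refine (zero_add _).trans ?_
  exact congrArg (fun l => l v) (map_zero (christoffel 𝓘(ℝ, E) x))

end Coincidence

/-! ### Powers of the norm of a field along a curve -/

section NormPower

variable {E : Type*} [NormedAddCommGroup E] [NormedSpace ℝ E]
  {M : Type*} [TopologicalSpace M] [ChartedSpace E M] [IsManifold 𝓘(ℝ, E) ∞ M]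
  [RiemannianBundle (fun x : M => TangentSpace 𝓘(ℝ, E) x)] [FiniteDimensional ℝ E]
  [IsContMDiffRiemannianBundle 𝓘(ℝ, E) ∞ E (fun x : M => TangentSpace 𝓘(ℝ, E) x)]
  {c : ℝ → M} {V : (s : ℝ) → TangentSpace 𝓘(ℝ, E) (c s)} {s p : ℝ}

/-- The Leibniz rule at a zero of the field needs only the continuity of the coefficient. -/
theorem covDerivAlong_smul_of_eq_zero {f : ℝ → ℝ} (hf : ContinuousAt f s) (hV : IsDiffAlong c V s)
    (h0 : V s = 0) : covDerivAlong 𝓘(ℝ, E) c (fun r => f r • V r) s =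
      f s • covDerivAlong 𝓘(ℝ, E) c V s := by
  have h := hasDerivAt_smul_of_eq_zero hf
    (hV.differentiableAt (mem_chart_source E (c s))).hasDerivAt (by rw [h0, map_zero])
  simp only [covDerivAlong, map_smul, h.deriv, smul_add]

theorem covDerivAlong_rpow_norm_smul (hV : IsDiffAlong c V s) (hp : 2 ≤ p ∨ V s ≠ 0) :
    covDerivAlong 𝓘(ℝ, E) c (fun r => ‖V r‖ ^ (p - 2) • V r) s =
      ((p - 2) * (‖V s‖ ^ (p - 4) * inner ℝ (covDerivAlong 𝓘(ℝ, E) c V s) (V s))) • V s +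
        ‖V s‖ ^ (p - 2) • covDerivAlong 𝓘(ℝ, E) c V s := by
  have hN : HasDerivAt (fun r => (inner ℝ (V r) (V r) : ℝ))
      (2 * inner ℝ (covDerivAlong 𝓘(ℝ, E) c V s) (V s)) s :=
    (hV.hasDerivAt_inner hV).congr_deriv (by
      rw [real_inner_comm (covDerivAlong 𝓘(ℝ, E) c V s) (V s)]
      ring)
  rcases eq_or_ne (V s) 0 with h | h
  · have hc : ContinuousAt (fun r => ‖V r‖ ^ (p - 2)) s := by
      have h2 : (fun r => ‖V r‖ ^ (p - 2)) =
          fun r => (inner ℝ (V r) (V r) : ℝ) ^ ((p - 2) / 2) := by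
        funext r
        rw [rpow_eq_sq_rpow (norm_nonneg (V r)), real_inner_self_eq_norm_sq]
      rw [h2]
      exact hN.continuousAt.rpow_const (Or.inr (by linarith [hp.resolve_right fun hn => hn h]))
    rw [covDerivAlong_smul_of_eq_zero hc hV h, h, smul_zero, zero_add]
  · have hd := hasDerivAt_rpow_norm (p := p - 2) (ρ := fun r => ‖V r‖)
      (N := fun r => (inner ℝ (V r) (V r) : ℝ)) (t := s)
      (A := fun r => inner ℝ (covDerivAlong 𝓘(ℝ, E) c V r) (V r)) (fun r => norm_nonneg (V r))
      (fun r => real_inner_self_eq_norm_sq (V r)) hN (Or.inr (norm_ne_zero_iff.2 h))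
    rw [covDerivAlong_smul (f := fun r => ‖V r‖ ^ (p - 2)) hd.differentiableAt hV, hd.deriv,
      show p - 2 - 2 = p - 4 by ring]

end NormPower

/-! ### The boundary term -/

section Boundary

variable {E : Type*} [NormedAddCommGroup E] [NormedSpace ℝ E]
  {M : Type*} [TopologicalSpace M] [ChartedSpace E M]
  {γ : ℝ → ℝ → M} {p a b ε K s t : ℝ}

theorem IsSmoothVariation.isSmoothNear (hγ : IsSmoothVariation 𝓘(ℝ, E) ε a b γ)
    (ht : t ∈ Ioo (-ε) ε) (hs : s ∈ Ioo a b) : IsSmoothNear E γ t s := by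
  filter_upwards [(isOpen_Ioo.prod isOpen_Ioo).mem_nhds (x := (t, s)) ⟨ht, hs⟩] with q hq
  exact hγ q.1 hq.1 q.2 (Ioo_subset_Icc_self hq.2)

variable [IsManifold 𝓘(ℝ, E) ∞ M]
  [RiemannianBundle (fun x : M => TangentSpace 𝓘(ℝ, E) x)] [FiniteDimensional ℝ E]
  [IsContMDiffRiemannianBundle 𝓘(ℝ, E) ∞ E (fun x : M => TangentSpace 𝓘(ℝ, E) x)]

variable (E) in
/-- The boundary term `⟪∇ₜ∇ₛ∂ₜγ, F⟫ - ⟪∇ₜ∂ₜγ, ∇F⟫`, `F = |τ|^{p-2} τ`, of the second variation. -/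
noncomputable def boundaryTerm (p : ℝ) (γ : ℝ → ℝ → M) (s : ℝ) : ℝ :=
  inner ℝ (covFst γ (covSnd γ (velFst E γ)) 0 s) (pTension 𝓘(ℝ, E) p (γ 0) s) -
    inner ℝ (covFst γ (velFst E γ) 0 s)
      (covDerivAlong 𝓘(ℝ, E) (γ 0) (pTension 𝓘(ℝ, E) p (γ 0)) s)

theorem boundaryTerm_of_clamped (hγ : IsSmoothVariation 𝓘(ℝ, E) ε a b γ) (hab : a ≤ b)
    (hε : 0 < ε) (hc : IsClamped 𝓘(ℝ, E) ε a b γ) (hs : s ∈ ({a, b} : Set ℝ)) :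
    boundaryTerm E p γ s = 0 := by
  have hs' : s ∈ Icc a b := by
    rcases hs with rfl | rfl
    · exact left_mem_Icc.2 hab
    · exact right_mem_Icc.2 hab
  have h0 : (0 : ℝ) ∈ Ioo (-ε) ε := ⟨by linarith, hε⟩
  have ev : ∀ {t : ℝ}, t ∈ Ioo (-ε) ε → ∀ᶠ t in 𝓝 t, t ∈ Ioo (-ε) ε := fun ht =>
    isOpen_Ioo.mem_nhds ht
  have hV : ∀ t ∈ Ioo (-ε) ε,
      (⟨γ t s, velFst E γ t s⟩ : TangentBundle 𝓘(ℝ, E) M) = ⟨γ 0 s, 0⟩ := fun t ht =>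
    velocity_of_eventually_const (c := fun t => γ t s)
      ((ev ht).mono fun r hr => congrArg TotalSpace.proj (hc r hr s hs))
  have hV' : ∀ t ∈ Ioo (-ε) ε,
      (⟨γ t s, covSnd γ (velFst E γ) t s⟩ : TangentBundle 𝓘(ℝ, E) M) = ⟨γ 0 s, 0⟩ := fun t ht => by
    rw [covSnd_velocity_fst (hγ t ht s hs')]
    exact covDerivAlong_of_eventually_const (c := fun t => γ t s) (V := fun t => velSnd E γ t s)
      ((ev ht).mono fun r hr => hc r hr s hs)
  have hW : covFst γ (velFst E γ) 0 s = 0 := eq_of_heq (TotalSpace.mk.inj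
    (covDerivAlong_of_eventually_const (c := fun t => γ t s) (V := fun t => velFst E γ t s)
      ((ev h0).mono hV))).2
  have hY : covFst γ (covSnd γ (velFst E γ)) 0 s = 0 := eq_of_heq (TotalSpace.mk.inj
    (covDerivAlong_of_eventually_const (c := fun t => γ t s)
      (V := fun t => covSnd γ (velFst E γ) t s) ((ev h0).mono hV'))).2
  rw [boundaryTerm, hW, hY, inner_zero_left, inner_zero_left, sub_zero]

theorem boundaryTerm_of_closed (hε : 0 < ε) (hc : IsClosedVariation ε a b γ) :
    boundaryTerm E p γ b = boundaryTerm E p γ a := by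
  have h0 : (0 : ℝ) ∈ Ioo (-ε) ε := ⟨by linarith, hε⟩
  have ev : ∀ {t : ℝ}, t ∈ Ioo (-ε) ε → ∀ᶠ t in 𝓝 t, t ∈ Ioo (-ε) ε := fun ht =>
    isOpen_Ioo.mem_nhds ht
  set l := b - a with hl
  have hτ : ∀ s, (⟨γ 0 (s + l), tension 𝓘(ℝ, E) (γ 0) (s + l)⟩ : TangentBundle 𝓘(ℝ, E) M) =
      ⟨γ 0 s, tension 𝓘(ℝ, E) (γ 0) s⟩ :=
    covDerivAlong_periodic (velocity_periodic (hc 0 h0))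
  have hF : ∀ s, (⟨γ 0 (s + l), pTension 𝓘(ℝ, E) p (γ 0) (s + l)⟩ : TangentBundle 𝓘(ℝ, E) M) =
      ⟨γ 0 s, pTension 𝓘(ℝ, E) p (γ 0) s⟩ := fun s =>
    congrArg (fun P : TangentBundle 𝓘(ℝ, E) M =>
      (⟨P.1, ‖P.2‖ ^ (p - 2) • P.2⟩ : TangentBundle 𝓘(ℝ, E) M)) (hτ s)
  have hV : ∀ t ∈ Ioo (-ε) ε, ∀ s,
      (⟨γ t (s + l), velFst E γ t (s + l)⟩ : TangentBundle 𝓘(ℝ, E) M) =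
        ⟨γ t s, velFst E γ t s⟩ := fun t ht s =>
    velocity_congr (c₁ := fun t => γ t (s + l)) (c₂ := fun t => γ t s)
      ((ev ht).mono fun r hr => hc r hr s)
  have hV' : ∀ t ∈ Ioo (-ε) ε, ∀ s,
      (⟨γ t (s + l), covSnd γ (velFst E γ) t (s + l)⟩ : TangentBundle 𝓘(ℝ, E) M) =
        ⟨γ t s, covSnd γ (velFst E γ) t s⟩ := fun t ht s =>
    covDerivAlong_periodic (c := γ t) (V := fun s => velFst E γ t s) (hV t ht) s
  have hW : (⟨γ 0 (a + l), covFst γ (velFst E γ) 0 (a + l)⟩ : TangentBundle 𝓘(ℝ, E) M) =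
        ⟨γ 0 a, covFst γ (velFst E γ) 0 a⟩ :=
    covDerivAlong_total_congr (c₁ := fun t => γ t (a + l)) (c₂ := fun t => γ t a)
      (V₁ := fun t => velFst E γ t (a + l)) (V₂ := fun t => velFst E γ t a)
      ((ev h0).mono fun t ht => hV t ht a)
  have hY : (⟨γ 0 (a + l), covFst γ (covSnd γ (velFst E γ)) 0 (a + l)⟩ :
      TangentBundle 𝓘(ℝ, E) M) = ⟨γ 0 a, covFst γ (covSnd γ (velFst E γ)) 0 a⟩ :=
    covDerivAlong_total_congr (c₁ := fun t => γ t (a + l)) (c₂ := fun t => γ t a)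
      (V₁ := fun t => covSnd γ (velFst E γ) t (a + l)) (V₂ := fun t => covSnd γ (velFst E γ) t a)
      ((ev h0).mono fun t ht => hV' t ht a)
  have h : boundaryTerm E p γ (a + l) = boundaryTerm E p γ a :=
    congrArg₂ (· - ·) (inner_eq_of_mk_eq hY (hF a))
      (inner_eq_of_mk_eq hW (covDerivAlong_periodic hF a))
  rwa [hl, add_sub_cancel] at h

theorem hasDerivAt_boundaryTerm (hK : HasConstantCurvature 𝓘(ℝ, E) M K)
    (h : IsSmoothNear E γ 0 s) (hs : s ∈ Ioo a b) (hcrit : IsPBiharmonic 𝓘(ℝ, E) p a b (γ 0)) :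
    HasDerivAt (boundaryTerm E p γ)
      (‖tension 𝓘(ℝ, E) (γ 0) s‖ ^ (p - 2) *
          inner ℝ (covSnd γ (covFst γ (covSnd γ (velFst E γ))) 0 s) (tension 𝓘(ℝ, E) (γ 0) s) +
        K * (inner ℝ (velFst E γ 0 s) (velSnd E γ 0 s) * inner ℝ (velFst E γ 0 s)
            (covDerivAlong 𝓘(ℝ, E) (γ 0) (pTension 𝓘(ℝ, E) p (γ 0)) s) -
          inner ℝ (velFst E γ 0 s) (velFst E γ 0 s) * inner ℝ (velSnd E γ 0 s)
            (covDerivAlong 𝓘(ℝ, E) (γ 0) (pTension 𝓘(ℝ, E) p (γ 0)) s)) -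
        ‖tension 𝓘(ℝ, E) (γ 0) s‖ ^ (p - 2) *
          (K * (inner ℝ (velSnd E γ 0 s) (tension 𝓘(ℝ, E) (γ 0) s) *
              inner ℝ (covFst γ (velFst E γ) 0 s) (velSnd E γ 0 s) -
            inner ℝ (velSnd E γ 0 s) (velSnd E γ 0 s) *
              inner ℝ (covFst γ (velFst E γ) 0 s) (tension 𝓘(ℝ, E) (γ 0) s)))) s := by
  obtain ⟨hF, hF', heq⟩ := hcrit s hs
  have hV := h.isSmoothField_velFst
  have d1 := hV.covSnd.covFst.isDiffAlong.hasDerivAt_inner (W := pTension 𝓘(ℝ, E) p (γ 0)) hF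
  have d2 := hV.covFst.isDiffAlong.hasDerivAt_inner
    (W := covDerivAlong 𝓘(ℝ, E) (γ 0) (pTension 𝓘(ℝ, E) p (γ 0))) hF'
  refine (d1.sub d2).congr_deriv ?_
  have hY := covFst_covSnd hK hV
  rw [hK] at heq
  rw [sub_eq_zero.1 heq, hY]
  change inner ℝ (covSnd γ (covFst γ (covSnd γ (velFst E γ))) 0 s)
    (‖tension 𝓘(ℝ, E) (γ 0) s‖ ^ (p - 2) • tension 𝓘(ℝ, E) (γ 0) s) + _ -
    (inner ℝ (covSnd γ (covFst γ (velFst E γ)) 0 s) _ + _) = _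
  simp only [inner_add_left, inner_sub_left, inner_sub_right, real_inner_smul_left,
    real_inner_smul_right]
  ring

end Boundary

/-! ### The second variation -/

section SecondVariation

theorem integral_linear_combination {a b : ℝ} {f₁ f₂ f₃ f₄ f₅ f₆ f₇ f₈ f₉ h : ℝ → ℝ}
    {k₁ k₃ k₄ k₅ k₆ k₇ k₈ k₉ : ℝ} (i₁ : IntervalIntegrable f₁ volume a b)
    (i₂ : IntervalIntegrable f₂ volume a b) (i₃ : IntervalIntegrable f₃ volume a b)
    (i₄ : IntervalIntegrable f₄ volume a b) (i₅ : IntervalIntegrable f₅ volume a b)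
    (i₆ : IntervalIntegrable f₆ volume a b) (i₇ : IntervalIntegrable f₇ volume a b)
    (i₈ : IntervalIntegrable f₈ volume a b) (i₉ : IntervalIntegrable f₉ volume a b)
    (ih : IntervalIntegrable h volume a b) :
    ∫ s in a..b, (k₁ * f₁ s + f₂ s + k₃ * f₃ s + k₄ * f₄ s + k₅ * f₅ s - k₆ * f₆ s + k₇ * f₇ s -
      k₈ * f₈ s - k₉ * f₉ s + h s) =
    k₁ * (∫ s in a..b, f₁ s) + (∫ s in a..b, f₂ s) + k₃ * (∫ s in a..b, f₃ s) +
      k₄ * (∫ s in a..b, f₄ s) + k₅ * (∫ s in a..b, f₅ s) - k₆ * (∫ s in a..b, f₆ s) +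
      k₇ * (∫ s in a..b, f₇ s) - k₈ * (∫ s in a..b, f₈ s) - k₉ * (∫ s in a..b, f₉ s) +
      ∫ s in a..b, h s := by
  have j₂ := (i₁.const_mul k₁).add i₂
  have j₃ := j₂.add (i₃.const_mul k₃)
  have j₄ := j₃.add (i₄.const_mul k₄)
  have j₅ := j₄.add (i₅.const_mul k₅)
  have j₆ := j₅.sub (i₆.const_mul k₆)
  have j₇ := j₆.add (i₇.const_mul k₇)
  have j₈ := j₇.sub (i₈.const_mul k₈)
  have j₉ := j₈.sub (i₉.const_mul k₉)
  rw [intervalIntegral.integral_add j₉ ih, intervalIntegral.integral_sub j₈ (i₉.const_mul k₉),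
    intervalIntegral.integral_sub j₇ (i₈.const_mul k₈),
    intervalIntegral.integral_add j₆ (i₇.const_mul k₇),
    intervalIntegral.integral_sub j₅ (i₆.const_mul k₆),
    intervalIntegral.integral_add j₄ (i₅.const_mul k₅),
    intervalIntegral.integral_add j₃ (i₄.const_mul k₄),
    intervalIntegral.integral_add j₂ (i₃.const_mul k₃),
    intervalIntegral.integral_add (i₁.const_mul k₁) i₂]
  simp only [intervalIntegral.integral_const_mul]

theorem abs_inner_le_norm_mul {F : Type*} [NormedAddCommGroup F] [InnerProductSpace ℝ F] (v w : F) :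
    |(inner ℝ v w : ℝ)| ≤ ‖w‖ * ‖v‖ :=
  (abs_real_inner_le_norm v w).trans_eq (mul_comm _ _)

variable {E : Type*} [NormedAddCommGroup E] [NormedSpace ℝ E]
  {M : Type*} [TopologicalSpace M] [ChartedSpace E M] [IsManifold 𝓘(ℝ, E) ∞ M]
  [RiemannianBundle (fun x : M => TangentSpace 𝓘(ℝ, E) x)]
  [IsContMDiffRiemannianBundle 𝓘(ℝ, E) ∞ E (fun x : M => TangentSpace 𝓘(ℝ, E) x)]
  {γ : ℝ → ℝ → M} {p a b ε K s t : ℝ} {V W X τ : (t s : ℝ) → TangentSpace 𝓘(ℝ, E) (γ t s)}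

theorem continuousOn_inner {S : Set ℝ} (hV : ∀ s ∈ S, IsSmoothField γ V t s)
    (hW : ∀ s ∈ S, IsSmoothField γ W t s) :
    ContinuousOn (fun s => (inner ℝ (V t s) (W t s) : ℝ)) S := fun s hs =>
  (((hV s hs).contDiffAt_inner (hW s hs)).continuousAt.comp (f := fun s => (t, s))
    (by fun_prop)).continuousWithinAt

theorem continuousOn_norm {S : Set ℝ} (hV : ∀ s ∈ S, IsSmoothField γ V t s) :
    ContinuousOn (fun s => ‖V t s‖) S := by
  have h := (continuousOn_inner hV hV).sqrt
  simp only [real_inner_self_eq_norm_sq] at h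
  simpa only [Real.sqrt_sq (norm_nonneg _)] using h

/-- The singular integrals of the second-variation formula converge. -/
theorem intervalIntegrable_rpow_mul_inner (hab : a ≤ b)
    (hτ : ∀ s ∈ Icc a b, IsSmoothField γ τ t s) (hV : ∀ s ∈ Icc a b, IsSmoothField γ V t s)
    (hW : ∀ s ∈ Icc a b, IsSmoothField γ W t s) (hp : ∀ s ∈ Icc a b, 2 ≤ p ∨ ‖τ t s‖ ≠ 0) :
    IntervalIntegrable (fun s => ‖τ t s‖ ^ (p - 4) *
      ((inner ℝ (V t s) (τ t s) : ℝ) * inner ℝ (W t s) (τ t s))) volume a b :=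
  intervalIntegrable_rpow_mul_mul (ρ := fun s => ‖τ t s‖) (Y := fun s => ‖V t s‖)
    (Z := fun s => ‖W t s‖) hab (fun _ => norm_nonneg _)
    (fun _ => abs_inner_le_norm_mul _ _) (fun _ => abs_inner_le_norm_mul _ _)
    (fun _ => norm_nonneg _) (fun _ => norm_nonneg _) (continuousOn_norm hτ)
    (continuousOn_inner hV hτ) (continuousOn_inner hW hτ) (continuousOn_norm hV)
    (continuousOn_norm hW) hp

variable [FiniteDimensional ℝ E]

/-- The covariant derivative of `|τ|^{p-2} τ` is continuous, also where `τ` vanishes. -/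
theorem continuousOn_inner_covDerivAlong_rpow_norm_smul
    (hτ : ∀ s ∈ Icc a b, IsSmoothField γ τ t s) (hV : ∀ s ∈ Icc a b, IsSmoothField γ V t s)
    (hp : ∀ s ∈ Icc a b, 2 ≤ p ∨ ‖τ t s‖ ≠ 0) :
    ContinuousOn (fun s => (inner ℝ (V t s)
      (covDerivAlong 𝓘(ℝ, E) (γ t) (fun s => ‖τ t s‖ ^ (p - 2) • τ t s) s) : ℝ)) (Icc a b) := by
  have hτ' : ∀ s ∈ Icc a b, IsSmoothField γ (covSnd γ τ) t s := fun s hs => (hτ s hs).covSnd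
  have h1 := continuousOn_rpow_mul_mul (p := p) (ρ := fun s => ‖τ t s‖)
    (Y := fun s => ‖covSnd γ τ t s‖) (Z := fun s => ‖V t s‖) (fun _ => norm_nonneg _)
    (fun _ => abs_inner_le_norm_mul _ _) (fun _ => abs_inner_le_norm_mul _ _)
    (fun _ => norm_nonneg _) (fun _ => norm_nonneg _) (continuousOn_norm hτ)
    (continuousOn_inner hτ' hτ) (continuousOn_inner hV hτ) (continuousOn_norm hτ')
    (continuousOn_norm hV) hp
  have h2 : ContinuousOn (fun s => ‖τ t s‖ ^ (p - 2) * (inner ℝ (V t s) (covSnd γ τ t s) : ℝ))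
      (Icc a b) := ((continuousOn_norm hτ).rpow_const fun s hs =>
    (hp s hs).symm.imp_right fun h => by linarith).mul (continuousOn_inner hV hτ')
  refine (h1.add h2).congr fun s hs => ?_
  have h3 := covDerivAlong_rpow_norm_smul (p := p) (hτ s hs).isDiffAlong
    ((hp s hs).imp_right norm_ne_zero_iff.1)
  rw [h3, inner_add_right, real_inner_smul_right, real_inner_smul_right]
  simp only [covSnd, Pi.add_apply]
  ring

set_option maxHeartbeats 400000 in
/-- The second-variation formula on a manifold modelled on a finite-dimensional normed space. -/
theorem hasDerivAt_deriv_pBienergy (hK : HasConstantCurvature 𝓘(ℝ, E) M K)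
    (hp : 0 < p) (hab : a < b) (hε : 0 < ε)
    (hγ : IsSmoothVariation 𝓘(ℝ, E) ε a b γ)
    (hends : IsClamped 𝓘(ℝ, E) ε a b γ ∨ IsClosedVariation ε a b γ)
    (hcrit : IsPBiharmonic 𝓘(ℝ, E) p a b (γ 0))
    (hnondeg : p < 2 → ∀ s ∈ Icc a b, tension 𝓘(ℝ, E) (γ 0) s ≠ 0) :
    let T := velocity 𝓘(ℝ, E) (γ 0)
    let τ := tension 𝓘(ℝ, E) (γ 0)
    let F' := covDerivAlong 𝓘(ℝ, E) (γ 0) (pTension 𝓘(ℝ, E) p (γ 0))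
    let η := variationField 𝓘(ℝ, E) γ
    let η' := covDerivAlong 𝓘(ℝ, E) (γ 0) η
    let η'' := covDerivAlong 𝓘(ℝ, E) (γ 0) η'
    let f₁ : ℝ → ℝ := fun s => ‖τ s‖ ^ (p - 4) * |inner ℝ (η'' s) (τ s)| ^ 2
    let f₂ : ℝ → ℝ := fun s => ‖τ s‖ ^ (p - 2) * ‖η'' s‖ ^ 2
    let f₃ : ℝ → ℝ := fun s => ‖τ s‖ ^ (p - 4) *
      |inner ℝ (η s) (T s) * inner ℝ (T s) (τ s) - ‖T s‖ ^ 2 * inner ℝ (τ s) (η s)| ^ 2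
    let f₄ : ℝ → ℝ := fun s => ‖τ s‖ ^ (p - 2) *
      ‖(inner ℝ (η s) (T s) : ℝ) • T s - ‖T s‖ ^ 2 • η s‖ ^ 2
    let f₅ : ℝ → ℝ := fun s => ‖η s‖ ^ 2 * inner ℝ (T s) (F' s)
      - inner ℝ (η s) (T s) * inner ℝ (η s) (F' s)
    let f₆ : ℝ → ℝ := fun s => ‖τ s‖ ^ (p - 2) *
      (inner ℝ (T s) (τ s) * inner ℝ (η' s) (η s) - inner ℝ (η' s) (T s) * inner ℝ (τ s) (η s))
    let f₇ : ℝ → ℝ := fun s => inner ℝ (η'' s) (τ s) * ‖τ s‖ ^ (p - 4) *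
      (‖T s‖ ^ 2 * inner ℝ (η s) (τ s) - inner ℝ (η s) (T s) * inner ℝ (T s) (τ s))
    let f₈ : ℝ → ℝ := fun s => ‖τ s‖ ^ (p - 2) *
      (inner ℝ (T s) (η'' s) * inner ℝ (T s) (η s) - ‖T s‖ ^ 2 * inner ℝ (η'' s) (η s))
    let f₉ : ℝ → ℝ := fun s => ‖τ s‖ ^ (p - 2) *
      (inner ℝ (τ s) (η' s) * inner ℝ (T s) (η s) - inner ℝ (η' s) (T s) * inner ℝ (τ s) (η s))
    (∀ f ∈ [f₁, f₂, f₃, f₄, f₅, f₆, f₇, f₈, f₉], IntervalIntegrable f volume a b) ∧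
    (∀ᶠ t in 𝓝 (0 : ℝ), DifferentiableAt ℝ (fun t => pBienergy 𝓘(ℝ, E) p a b (γ t)) t) ∧
    HasDerivAt (deriv fun t => pBienergy 𝓘(ℝ, E) p a b (γ t))
      ((p - 2) * (∫ s in a..b, f₁ s)
        + (∫ s in a..b, f₂ s)
        + (p - 2) * K ^ 2 * (∫ s in a..b, f₃ s)
        + K ^ 2 * (∫ s in a..b, f₄ s)
        + K * (∫ s in a..b, f₅ s)
        - 2 * K * (∫ s in a..b, f₆ s)
        + 2 * (p - 2) * K * (∫ s in a..b, f₇ s)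
        - 2 * K * (∫ s in a..b, f₈ s)
        - K * (∫ s in a..b, f₉ s)) 0 := by
  intro T τ F' η η' η'' f₁ f₂ f₃ f₄ f₅ f₆ f₇ f₈ f₉
  have h0 : (0 : ℝ) ∈ Ioo (-ε) ε := ⟨by linarith, hε⟩
  -- the fields along the variation whose restrictions to `γ 0` occur in the formula
  let Tγ : (t s : ℝ) → TangentSpace 𝓘(ℝ, E) (γ t s) := velSnd E γ
  let Vγ : (t s : ℝ) → TangentSpace 𝓘(ℝ, E) (γ t s) := velFst E γ
  let τγ : (t s : ℝ) → TangentSpace 𝓘(ℝ, E) (γ t s) := covSnd γ Tγ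
  have sT : ∀ t ∈ Ioo (-ε) ε, ∀ s ∈ Icc a b, IsSmoothField γ Tγ t s := fun t ht s hs =>
    isSmoothField_velocity (hγ t ht s hs)
  have sV : ∀ t ∈ Ioo (-ε) ε, ∀ s ∈ Icc a b, IsSmoothField γ Vγ t s := fun t ht s hs =>
    isSmoothField_velocity_fst (hγ t ht s hs)
  have sτ : ∀ t ∈ Ioo (-ε) ε, ∀ s ∈ Icc a b, IsSmoothField γ τγ t s := fun t ht s hs =>
    (sT t ht s hs).covSnd
  have sV' : ∀ s ∈ Icc a b, IsSmoothField γ (covSnd γ Vγ) 0 s := fun s hs => (sV 0 h0 s hs).covSnd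
  have sV'' : ∀ s ∈ Icc a b, IsSmoothField γ (covSnd γ (covSnd γ Vγ)) 0 s := fun s hs =>
    (sV' s hs).covSnd
  have sJ : ∀ s ∈ Icc a b, IsSmoothField γ (fun t s => jacobiVec (Tγ t s) (Vγ t s)) 0 s :=
    fun s hs => isSmoothField_jacobiVec (sT 0 h0 s hs) (sV 0 h0 s hs)
  have sW : ∀ s ∈ Icc a b, IsSmoothField γ (covFst γ Vγ) 0 s := fun s hs => (sV 0 h0 s hs).covFst
  have sY : ∀ s ∈ Icc a b, IsSmoothField γ (covFst γ (covSnd γ Vγ)) 0 s := fun s hs =>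
    (sV' s hs).covFst
  have hp' : ∀ s ∈ Icc a b, 2 ≤ p ∨ ‖τγ 0 s‖ ≠ 0 := fun s hs =>
    (le_or_gt 2 p).imp_right fun h => norm_ne_zero_iff.2 (hnondeg h s hs)
  have cr : ContinuousOn (fun s => ‖τ s‖ ^ (p - 2)) (Icc a b) :=
    (continuousOn_norm (sτ 0 h0)).rpow_const fun s hs =>
      (hp' s hs).symm.imp_right fun h => by linarith
  have cF : ∀ {X : (t s : ℝ) → TangentSpace 𝓘(ℝ, E) (γ t s)},
      (∀ s ∈ Icc a b, IsSmoothField γ X 0 s) →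
      ContinuousOn (fun s => (inner ℝ (X 0 s) (F' s) : ℝ)) (Icc a b) := fun {X} hX =>
    continuousOn_inner_covDerivAlong_rpow_norm_smul (τ := τγ) (t := 0) (V := X) (p := p)
      (sτ 0 h0) hX hp'
  have int : ∀ {f : ℝ → ℝ}, ContinuousOn f (Icc a b) → IntervalIntegrable f volume a b :=
    fun hf => ContinuousOn.intervalIntegrable (by rwa [uIcc_of_le hab.le])
  have cTT : ContinuousOn (fun s => ‖T s‖ ^ 2) (Icc a b) := (continuousOn_norm (sT 0 h0)).pow 2
  have cVV : ContinuousOn (fun s => ‖η s‖ ^ 2) (Icc a b) := (continuousOn_norm (sV 0 h0)).pow 2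
  have cVT : ContinuousOn (fun s => (inner ℝ (η s) (T s) : ℝ)) (Icc a b) :=
    continuousOn_inner (sV 0 h0) (sT 0 h0)
  have cTV : ContinuousOn (fun s => (inner ℝ (T s) (η s) : ℝ)) (Icc a b) :=
    continuousOn_inner (sT 0 h0) (sV 0 h0)
  have cTτ : ContinuousOn (fun s => (inner ℝ (T s) (τ s) : ℝ)) (Icc a b) :=
    continuousOn_inner (sT 0 h0) (sτ 0 h0)
  have cτV : ContinuousOn (fun s => (inner ℝ (τ s) (η s) : ℝ)) (Icc a b) :=
    continuousOn_inner (sτ 0 h0) (sV 0 h0)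
  have cV'T : ContinuousOn (fun s => (inner ℝ (η' s) (T s) : ℝ)) (Icc a b) :=
    continuousOn_inner sV' (sT 0 h0)
  have i₁ : IntervalIntegrable f₁ volume a b := by
    have e : f₁ = fun s => ‖τγ 0 s‖ ^ (p - 4) *
        ((inner ℝ (covSnd γ (covSnd γ Vγ) 0 s) (τγ 0 s) : ℝ) *
          inner ℝ (covSnd γ (covSnd γ Vγ) 0 s) (τγ 0 s)) := by
      funext s
      exact congrArg (_ * ·) ((sq_abs _).trans (sq _))
    rw [e]
    exact intervalIntegrable_rpow_mul_inner (τ := τγ) (t := 0)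
      (V := (covSnd γ (covSnd γ Vγ)))
      (W := (covSnd γ (covSnd γ Vγ))) hab.le (sτ 0 h0) sV'' sV'' hp'
  have i₂ : IntervalIntegrable f₂ volume a b := int (cr.mul ((continuousOn_norm sV'').pow 2))
  have hJ : ∀ s, jacobiVec (Tγ 0 s) (Vγ 0 s) =
      -((inner ℝ (η s) (T s) : ℝ) • T s - ‖T s‖ ^ 2 • η s) := fun s => jacobiVec_eq_neg _ _
  have hJτ : ∀ s, (inner ℝ (jacobiVec (Tγ 0 s) (Vγ 0 s)) (τγ 0 s) : ℝ) =
      -(inner ℝ (η s) (T s) * inner ℝ (T s) (τ s) - ‖T s‖ ^ 2 * inner ℝ (τ s) (η s)) := fun s => by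
    rw [hJ, inner_neg_left, inner_sub_left, real_inner_smul_left, real_inner_smul_left,
      real_inner_comm (τγ 0 s) (η s)]
    rfl
  have i₃ : IntervalIntegrable f₃ volume a b := by
    have e : f₃ = fun s => ‖τγ 0 s‖ ^ (p - 4) *
        ((inner ℝ (jacobiVec (Tγ 0 s) (Vγ 0 s)) (τγ 0 s) : ℝ) *
          inner ℝ (jacobiVec (Tγ 0 s) (Vγ 0 s)) (τγ 0 s)) := by
      funext s
      rw [hJτ, neg_mul_neg, ← sq, ← sq_abs]
      rfl
    rw [e]
    exact intervalIntegrable_rpow_mul_inner (τ := τγ) (t := 0)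
      (V := (fun t s => jacobiVec (Tγ t s) (Vγ t s)))
      (W := (fun t s => jacobiVec (Tγ t s) (Vγ t s))) hab.le (sτ 0 h0) sJ sJ hp'
  have i₄ : IntervalIntegrable f₄ volume a b := by
    have e : f₄ = fun s => ‖τ s‖ ^ (p - 2) * ‖jacobiVec (Tγ 0 s) (Vγ 0 s)‖ ^ 2 := by
      funext s
      rw [hJ, norm_neg]
    rw [e]
    exact int (cr.mul ((continuousOn_norm sJ).pow 2))
  have i₅ : IntervalIntegrable f₅ volume a b :=
    int ((cVV.mul (cF (sT 0 h0))).sub (cVT.mul (cF (sV 0 h0))))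
  have i₆ : IntervalIntegrable f₆ volume a b :=
    int (cr.mul ((cTτ.mul (continuousOn_inner sV' (sV 0 h0))).sub (cV'T.mul cτV)))
  have i₇ : IntervalIntegrable f₇ volume a b := by
    have e : f₇ = fun s => ‖τγ 0 s‖ ^ (p - 4) *
        ((inner ℝ (covSnd γ (covSnd γ Vγ) 0 s) (τγ 0 s) : ℝ) *
          inner ℝ (jacobiVec (Tγ 0 s) (Vγ 0 s)) (τγ 0 s)) := by
      funext s
      rw [hJτ]
      change inner ℝ (η'' s) (τ s) * ‖τ s‖ ^ (p - 4) * (‖T s‖ ^ 2 * inner ℝ (η s) (τ s) -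
        inner ℝ (η s) (T s) * inner ℝ (T s) (τ s)) = ‖τ s‖ ^ (p - 4) *
        (inner ℝ (η'' s) (τ s) * -(inner ℝ (η s) (T s) * inner ℝ (T s) (τ s) -
          ‖T s‖ ^ 2 * inner ℝ (τ s) (η s)))
      rw [real_inner_comm (τ s) (η s)]
      ring
    rw [e]
    exact intervalIntegrable_rpow_mul_inner (τ := τγ) (t := 0)
      (V := (covSnd γ (covSnd γ Vγ)))
      (W := (fun t s => jacobiVec (Tγ t s) (Vγ t s))) hab.le (sτ 0 h0) sV'' sJ hp'
  have i₈ : IntervalIntegrable f₈ volume a b :=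
    int (cr.mul (((continuousOn_inner (sT 0 h0) sV'').mul cTV).sub
      (cTT.mul (continuousOn_inner sV'' (sV 0 h0)))))
  have i₉ : IntervalIntegrable f₉ volume a b :=
    int (cr.mul (((continuousOn_inner (sτ 0 h0) sV').mul cTV).sub (cV'T.mul cτV)))
  refine ⟨by simp only [List.forall_mem_cons, List.not_mem_nil, false_imp_iff, implies_true,
    and_true]; exact ⟨i₁, i₂, i₃, i₄, i₅, i₆, i₇, i₈, i₉⟩, ?_⟩
  -- differentiation under the integral sign
  obtain ⟨hdiff, hd⟩ := hasDerivAt_deriv_integral_rpow (p := p) (ρ := fun t s => ‖τγ t s‖)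
    (N := fun t s => inner ℝ (τγ t s) (τγ t s))
    (A := fun t s => inner ℝ (covFst γ τγ t s) (τγ t s))
    (B := fun t s => inner ℝ (covFst γ τγ t s) (covFst γ τγ t s))
    (C := fun t s => inner ℝ (covFst γ (covFst γ τγ) t s) (τγ t s))
    hp hab.le hε (fun _ _ => norm_nonneg _) (fun _ _ => real_inner_self_eq_norm_sq _)
    (fun t ht s hs => ((sτ t ht s hs).contDiffAt_inner (sτ t ht s hs)).continuousAt)
    (fun t ht s hs => ((sτ t ht s hs).covFst.contDiffAt_inner (sτ t ht s hs)).continuousAt)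
    (fun t ht s hs => ((sτ t ht s hs).covFst.contDiffAt_inner (sτ t ht s hs).covFst).continuousAt)
    (fun t ht s hs => ((sτ t ht s hs).covFst.covFst.contDiffAt_inner (sτ t ht s hs)).continuousAt)
    (fun t ht s hs => (hasDerivAt_inner_fst (sτ t ht s hs) (sτ t ht s hs)).congr_deriv (by
      rw [real_inner_comm (covFst γ τγ t s) (τγ t s)]
      ring))
    (fun t ht s hs => (hasDerivAt_inner_fst (sτ t ht s hs).covFst (sτ t ht s hs)).congr_deriv
      (add_comm _ _))
    (fun t s => by
      rw [sq, mul_comm (inner ℝ (τγ t s) (τγ t s) : ℝ)]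
      exact real_inner_mul_inner_self_le _ _)
    ((le_or_gt 2 p).imp_right fun h s hs => norm_ne_zero_iff.2 (hnondeg h s hs))
  refine ⟨hdiff, hd.congr_deriv ?_⟩
  -- the integrand of the formula is the one found, up to the derivative of the boundary term
  let h' : ℝ → ℝ := fun s => ‖τ s‖ ^ (p - 2) *
      inner ℝ (covSnd γ (covFst γ (covSnd γ Vγ)) 0 s) (τ s) +
    K * (inner ℝ (η s) (T s) * inner ℝ (η s) (F' s) - inner ℝ (η s) (η s) * inner ℝ (T s) (F' s)) -
    ‖τ s‖ ^ (p - 2) * (K * (inner ℝ (T s) (τ s) * inner ℝ (covFst γ Vγ 0 s) (T s) -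
      inner ℝ (T s) (T s) * inner ℝ (covFst γ Vγ 0 s) (τ s)))
  have ih : IntervalIntegrable h' volume a b := int
    (((cr.mul (continuousOn_inner (fun s hs => (sY s hs).covSnd) (sτ 0 h0))).add
      (continuousOn_const.mul ((cVT.mul (cF (sV 0 h0))).sub
        ((continuousOn_inner (sV 0 h0) (sV 0 h0)).mul (cF (sT 0 h0)))))).sub
      (cr.mul (continuousOn_const.mul ((cTτ.mul (continuousOn_inner sW (sT 0 h0))).sub
        ((continuousOn_inner (sT 0 h0) (sT 0 h0)).mul (continuousOn_inner sW (sτ 0 h0)))))))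
  have hh : ∫ s in a..b, h' s = 0 := by
    have hbd : boundaryTerm E p γ b = boundaryTerm E p γ a := by
      rcases hends with hc | hc
      · rw [boundaryTerm_of_clamped hγ hab.le hε hc (by simp),
          boundaryTerm_of_clamped hγ hab.le hε hc (by simp)]
      · exact boundaryTerm_of_closed hε hc
    have hcont : ContinuousOn (boundaryTerm E p γ) (Icc a b) := by
      refine ContinuousOn.sub ?_ (cF sW)
      refine (cr.mul (continuousOn_inner sY (sτ 0 h0))).congr fun s hs => ?_
      exact real_inner_smul_right _ _ _
    exact (intervalIntegral.integral_eq_sub_of_hasDerivAt_of_le (f' := h') hab.le hcont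
      (fun s hs => hasDerivAt_boundaryTerm hK (hγ.isSmoothNear h0 hs) hs hcrit) ih).trans
      (sub_eq_zero.2 hbd)
  refine Eq.trans ?_ ((integral_linear_combination i₁ i₂ i₃ i₄ i₅ i₆ i₇ i₈ i₉ ih).trans
    ((congrArg _ hh).trans (add_zero _)))
  refine intervalIntegral.integral_congr_Ioo_of_le hab.le fun s hs => ?_
  have hn := hγ.isSmoothNear h0 hs
  have e1 : covFst γ τγ 0 s = _ := covFst_covSnd_velSnd hK hn
  have e2 : covFst γ (covFst γ τγ) 0 s = _ := covFst_covFst_tension hK hn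
  rw [e1, e2]
  exact secondVariation_integrand _ _ _ _ _ _ _ _ _ _ _ _

end SecondVariation

end PBiharmonic

theorem mainTheorem7 {n : ℕ} {M : Type*} [TopologicalSpace M]
    [ChartedSpace (EuclideanSpace ℝ (Fin n)) M] [IsManifold (𝓡 n) ∞ M]
    [RiemannianBundle (fun x : M => TangentSpace (𝓡 n) x)]
    [IsContMDiffRiemannianBundle (𝓡 n) ∞ (EuclideanSpace ℝ (Fin n))
      (fun x : M => TangentSpace (𝓡 n) x)]
    (K : ℝ) (hK : HasConstantCurvature (𝓡 n) M K)
    (p : ℝ) (hp : 0 < p) (a b : ℝ) (hab : a < b) (ε : ℝ) (hε : 0 < ε)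
    (γ : ℝ → ℝ → M) (hγ : IsSmoothVariation (𝓡 n) ε a b γ)
    (hends : IsClamped (𝓡 n) ε a b γ ∨ IsClosedVariation ε a b γ)
    (hcrit : IsPBiharmonic (𝓡 n) p a b (γ 0))
    (hnondeg : p < 2 → ∀ s ∈ Icc a b, tension (𝓡 n) (γ 0) s ≠ 0) :
    let T := velocity (𝓡 n) (γ 0)
    let τ := tension (𝓡 n) (γ 0)
    let F' := covDerivAlong (𝓡 n) (γ 0) (pTension (𝓡 n) p (γ 0))
    let η := variationField (𝓡 n) γ
    let η' := covDerivAlong (𝓡 n) (γ 0) η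
    let η'' := covDerivAlong (𝓡 n) (γ 0) η'
    let f₁ : ℝ → ℝ := fun s => ‖τ s‖ ^ (p - 4) * |inner ℝ (η'' s) (τ s)| ^ 2
    let f₂ : ℝ → ℝ := fun s => ‖τ s‖ ^ (p - 2) * ‖η'' s‖ ^ 2
    let f₃ : ℝ → ℝ := fun s => ‖τ s‖ ^ (p - 4) *
      |inner ℝ (η s) (T s) * inner ℝ (T s) (τ s) - ‖T s‖ ^ 2 * inner ℝ (τ s) (η s)| ^ 2
    let f₄ : ℝ → ℝ := fun s => ‖τ s‖ ^ (p - 2) *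
      ‖(inner ℝ (η s) (T s) : ℝ) • T s - ‖T s‖ ^ 2 • η s‖ ^ 2
    let f₅ : ℝ → ℝ := fun s => ‖η s‖ ^ 2 * inner ℝ (T s) (F' s)
      - inner ℝ (η s) (T s) * inner ℝ (η s) (F' s)
    let f₆ : ℝ → ℝ := fun s => ‖τ s‖ ^ (p - 2) *
      (inner ℝ (T s) (τ s) * inner ℝ (η' s) (η s) - inner ℝ (η' s) (T s) * inner ℝ (τ s) (η s))
    let f₇ : ℝ → ℝ := fun s => inner ℝ (η'' s) (τ s) * ‖τ s‖ ^ (p - 4) *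
      (‖T s‖ ^ 2 * inner ℝ (η s) (τ s) - inner ℝ (η s) (T s) * inner ℝ (T s) (τ s))
    let f₈ : ℝ → ℝ := fun s => ‖τ s‖ ^ (p - 2) *
      (inner ℝ (T s) (η'' s) * inner ℝ (T s) (η s) - ‖T s‖ ^ 2 * inner ℝ (η'' s) (η s))
    let f₉ : ℝ → ℝ := fun s => ‖τ s‖ ^ (p - 2) *
      (inner ℝ (τ s) (η' s) * inner ℝ (T s) (η s) - inner ℝ (η' s) (T s) * inner ℝ (τ s) (η s))
    (∀ f ∈ [f₁, f₂, f₃, f₄, f₅, f₆, f₇, f₈, f₉], IntervalIntegrable f volume a b) ∧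
    (∀ᶠ t in 𝓝 (0 : ℝ), DifferentiableAt ℝ (fun t => pBienergy (𝓡 n) p a b (γ t)) t) ∧
    HasDerivAt (deriv fun t => pBienergy (𝓡 n) p a b (γ t))
      ((p - 2) * (∫ s in a..b, f₁ s)
        + (∫ s in a..b, f₂ s)
        + (p - 2) * K ^ 2 * (∫ s in a..b, f₃ s)
        + K ^ 2 * (∫ s in a..b, f₄ s)
        + K * (∫ s in a..b, f₅ s)
        - 2 * K * (∫ s in a..b, f₆ s)
        + 2 * (p - 2) * K * (∫ s in a..b, f₇ s)
        - 2 * K * (∫ s in a..b, f₈ s)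
        - K * (∫ s in a..b, f₉ s)) 0 :=
  hasDerivAt_deriv_pBienergy hK hp hab hε hγ hends hcrit hnondeg
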